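/- Theorem. Let $N\ge 1$ and let $\alpha\in\mathbb R^N$ be rationally independent, i.e. $\alpha\cdot k\neq 0$ for all $k\in\mathbb Z^N\setminus\{0\}$. For $s\in\mathbb R$ put $$\|c\|_{s}^2=\sum_{k\in\mathbb Z^N}(1+|k|^2)^s|c(k)|^2\qquad (c:\mathbb Z^N\to\mathbb C),$$ where $|k|$ is the Euclidean norm. For $s>N/2$ let $H^s_{qp}$ be the space of real-valued functions $$u(x)=\sum_{k\in\mathbb Z^N}\hat u(k)e^{i(\alpha\cdot k)x}\quad(x\in\mathbb R),\qquad \|u\|_{H^s_{qp}}:=\|\hat u\|_s<\infty ,$$ the coefficients being given by $\hat u(k)=\lim_{R\to\infty}\frac1{2R}\int_{-R}^{R}u(x)e^{-i(\alpha\cdot k)x}\,dx$; for smaller $s$ the elements of $H^s_{qp}$ are formal series of this kind, identified with their coefficient families of finite norm. The Hilbert transform is defined by $\widehat{Hu}(k)=-i\,\mathrm{sgn}(\alpha\cdot k)\,\hat u(k)$, and $\widehat{u_x}(k)=i(\alpha\cdot k)\hat u(k)$. Let $s>N/2+1$. A solution on $[0,T]$ of the quasiperiodic Benjamin–Ono equation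 $$u_t=uu_x+Hu_{xx}$$ with initial data $u_0\in H^s_{qp}$ is a $u\in C([0,T];H^s_{qp})$ with $u(0)=u_0$ such that at every $t\in[0,T]$ the right-hand side belongs to $H^{s-2}_{qp}$ and is the derivative of $u$ at $t$ with respect to the norm of $H^{s-2}_{qp}$ (one-sided at the end points). (i) For fixed $N,\alpha,s$ there is a positive nonincreasing function $T(s,\cdot)$ of a real variable such that, for every $u_0\in H^s_{qp}$, the equation has a unique solution $u\in C([0,T];H^s_{qp})$ with $u(0)=u_0$ on $[0,T]$, where $T=T(s,\|u_0\|_{H^s_{qp}})$. (In particular, all data of norm at most $r$ have solutions on the common interval $[0,T(s,r)]$.) (ii) The solution map is continuous in $H^s_{qp}$, uniformly in time: if $T>0$, $u$ is a solution on $[0,T]$ with data $u_0\in H^s_{qp}$, and $\varepsilon>0$, then there is $\delta>0$ such that every solution $v$ on $[0,T]$ with data $v_0\in H^s_{qp}$, $\|v_0-u_0\|_{H^s_{qp}}<\delta$, satisfies $\|v(t)-u(t)\|_{H^s_{qp}}<\varepsilon$ for all $t\in[0,T]$. -/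

import Mathlib

open Filter Topology

noncomputable section

namespace QPBO

/-- The frequency `α · k`, for `k ∈ ℤ^N`. -/
def freq {N : ℕ} (α : Fin N → ℝ) (k : Fin N → ℤ) : ℝ := ∑ j, α j * (k j : ℝ)

/-- Rational independence: `α · k ≠ 0` for every nonzero `k ∈ ℤ^N`. -/
def RationallyIndependent {N : ℕ} (α : Fin N → ℝ) : Prop :=
  ∀ k : Fin N → ℤ, k ≠ 0 → freq α k ≠ 0

/-- The squared Japanese bracket `⟨k⟩² = 1 + k₁² + ⋯ + k_N²`. -/
def bracketSq {N : ℕ} (k : Fin N → ℤ) : ℝ := 1 + ∑ j, (k j : ℝ) ^ 2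

/-- A family of Fourier coefficients has finite `H^s_qp` norm. For arbitrary real `s` this describes
the elements of `H^s_qp` as (possibly only formal) quasiperiodic Fourier series. -/
def SobolevSummable {N : ℕ} (s : ℝ) (c : (Fin N → ℤ) → ℂ) : Prop :=
  Summable fun k => bracketSq k ^ s * ‖c k‖ ^ 2

/-- The `H^s_qp` norm `(∑_k ⟨k⟩^{2s} |c k|²)^{1/2}` in terms of Fourier coefficients
(meaningful under `SobolevSummable s c`). -/
def sobolevNorm {N : ℕ} (s : ℝ) (c : (Fin N → ℤ) → ℂ) : ℝ :=
  Real.sqrt (∑' k, bracketSq k ^ s * ‖c k‖ ^ 2)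

/-- The quasiperiodic Fourier coefficient of a real-valued function: the averaged integral
`lim_{R → ∞} (1 / 2R) ∫_{-R}^{R} f(x) exp(-i (α · k) x) dx`. -/
def qpCoeff {N : ℕ} (α : Fin N → ℝ) (f : ℝ → ℝ) (k : Fin N → ℤ) : ℂ :=
  limUnder atTop fun R : ℝ =>
    ((2 * R : ℝ) : ℂ)⁻¹ *
      ∫ x in (-R)..R, (f x : ℂ) * Complex.exp (-(Complex.I * (freq α k : ℂ) * (x : ℂ)))

/-- The real-valued functions `f(x) = ∑_k f̂(k) exp(i (α · k) x)` in `H^s_qp`. The series is required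
to converge (unconditionally) at every point, which is automatic for `s > N/2`, the range in which
this definition is used. -/
def MemHqp {N : ℕ} (α : Fin N → ℝ) (s : ℝ) (f : ℝ → ℝ) : Prop :=
  SobolevSummable s (qpCoeff α f) ∧
    ∀ x : ℝ, HasSum
      (fun k => qpCoeff α f k * Complex.exp (Complex.I * (freq α k : ℂ) * (x : ℂ))) (f x : ℂ)

/-- The `H^s_qp` norm of a function. -/
def hqpNorm {N : ℕ} (α : Fin N → ℝ) (s : ℝ) (f : ℝ → ℝ) : ℝ := sobolevNorm s (qpCoeff α f)

/-- `∂ₓ` on Fourier coefficients: multiplication by `i (α · k)`. -/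
def derivCoeff {N : ℕ} (α : Fin N → ℝ) (c : (Fin N → ℤ) → ℂ) : (Fin N → ℤ) → ℂ :=
  fun k => Complex.I * (freq α k : ℂ) * c k

/-- The Hilbert transform on Fourier coefficients: multiplication by `-i sgn(α · k)`. -/
def hilbertCoeff {N : ℕ} (α : Fin N → ℝ) (c : (Fin N → ℤ) → ℂ) : (Fin N → ℤ) → ℂ :=
  fun k => -Complex.I * (Real.sign (freq α k) : ℂ) * c k

/-- The Fourier coefficients of `f fₓ + H fₓₓ`. The product `f fₓ` is the pointwise one, with the
classical derivative. -/
def boRHS {N : ℕ} (α : Fin N → ℝ) (f : ℝ → ℝ) : (Fin N → ℤ) → ℂ :=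
  fun k => qpCoeff α (fun x => f x * deriv f x) k +
    hilbertCoeff α (derivCoeff α (derivCoeff α (qpCoeff α f))) k

/-- `u` (where `u t` is the function `x ↦ u(t, x)`) is a solution in `C([0,T]; H^s_qp)` of the
Benjamin–Ono equation `u_t = u u_x + H u_xx` with `u(0) = u₀`: at every `t ∈ [0,T]` the right-hand
side lies in `H^{s-2}_qp`, and it is the derivative of `u` in time with respect to the norm of
`H^{s-2}_qp` (one-sided at the end points). -/
structure IsSolution {N : ℕ} (α : Fin N → ℝ) (s T : ℝ) (u₀ : ℝ → ℝ) (u : ℝ → ℝ → ℝ) : Prop where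
  mem : ∀ t ∈ Set.Icc 0 T, MemHqp α s (u t)
  cont : ∀ t ∈ Set.Icc 0 T,
    Tendsto (fun τ => hqpNorm α s (fun x => u τ x - u t x)) (𝓝[Set.Icc 0 T] t) (𝓝 0)
  init : u 0 = u₀
  rhs_mem : ∀ t ∈ Set.Icc 0 T, SobolevSummable (s - 2) (boRHS α (u t))
  eqn : ∀ t ∈ Set.Icc 0 T,
    Tendsto
      (fun τ => sobolevNorm (s - 2) fun k =>
        (qpCoeff α (u τ) k - qpCoeff α (u t) k) / ((τ - t : ℝ) : ℂ) - boRHS α (u t) k)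
      (𝓝[Set.Icc 0 T \ {t}] t) (𝓝 0)

end QPBO

end

/-! In terms of Fourier coefficients c on ℤ^N the equation reads c' = c * Dc + i ω|ω| c, where ω =
α·k and D is multiplication by iω. The analysis on families uses only the linearity of ω and |ω| ≤
A⟨k⟩. Rational independence enters when coefficients are recovered from a function by averaging,
which makes solutions as functions equivalent to solutions as families (`isSolution_iff`).

The term c * Dc loses a derivative, but not in energy estimates. For a weight φ put b = φ(⟨k⟩)c.
Then Re Σ φ² conj(c)(c * Dc) splits into a transport term with b in place of c, where reality of the
solution moves the derivative onto the coefficient c, and a commutator, where the polynomial growth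
of φ gives |φ(⟨k⟩) - φ(⟨j⟩)|⟨j⟩ ≲ φ(⟨j⟩)⟨k-j⟩ + φ(⟨k-j⟩)⟨j⟩. Since s > N/2 + 1 puts ⟨k⟩c in ℓ¹, both
are at most a constant times ‖c‖_s Σ φ²|c|² (`energy_bound`). The dispersive symbol is imaginary and
drops out; a sharp frequency truncation drops out as well, because the solution vanishes off the
retained set.

The constant depends on φ only through its growth exponent, so φ may be chosen to select high
frequencies: the tail of a solution beyond L is bounded at all times by the tail of its data
(`Sol.high_le`). Differences of solutions are controlled in L² (`Sol.difference_le`). Since ‖w‖_s ≤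
L^s ‖w‖_0 + (tail of w beyond L), these two facts give closeness in H^s itself (`Sol.norm_sub_le`),
with no regularisation of the data.

Existence follows by truncating to balls of frequencies: this gives bounded vector fields solvable
by Picard–Lindelöf, the energy with φ(r) = r^s gives a common lifespan (`exists_truncated_sol`), and
`Sol.norm_sub_le` makes the approximations uniformly Cauchy. Uniqueness is the L² estimate, and
continuous dependence is `Sol.norm_sub_le` with a bootstrap for the size of the second solution
(`Sol.continuous_dependence`). -/

namespace QPBO

variable {N : ℕ}

/-! ### The Japanese bracket and the frequencies -/

/-- The Japanese bracket `⟨k⟩ = (1 + |k|²)^{1/2}`. -/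
noncomputable def bracket (k : Fin N → ℤ) : ℝ := Real.sqrt (bracketSq k)

lemma one_le_bracketSq (k : Fin N → ℤ) : 1 ≤ bracketSq k := by
  unfold bracketSq
  have : 0 ≤ ∑ j, (k j : ℝ) ^ 2 := Finset.sum_nonneg fun _ _ => sq_nonneg _
  linarith

lemma bracket_sq (k : Fin N → ℤ) : bracket k ^ 2 = bracketSq k :=
  Real.sq_sqrt (by linarith [one_le_bracketSq k])

lemma one_le_bracket (k : Fin N → ℤ) : 1 ≤ bracket k :=
  Real.one_le_sqrt.2 (one_le_bracketSq k)

lemma bracket_pos (k : Fin N → ℤ) : 0 < bracket k := by linarith [one_le_bracket k]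

lemma bracket_nonneg (k : Fin N → ℤ) : 0 ≤ bracket k := (bracket_pos k).le

@[simp] lemma bracket_neg (k : Fin N → ℤ) : bracket (-k) = bracket k := by
  simp [bracket, bracketSq]

lemma bracketSq_rpow (s : ℝ) (k : Fin N → ℤ) : bracketSq k ^ s = (bracket k ^ s) ^ 2 := by
  rw [← bracket_sq, ← Real.rpow_natCast, ← Real.rpow_natCast, ← Real.rpow_mul (bracket_nonneg k),
    ← Real.rpow_mul (bracket_nonneg k), mul_comm]

lemma bracket_add_le (j k : Fin N → ℤ) : bracket (j + k) ≤ bracket j + bracket k := by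
  have h1 : ∑ i, (j i : ℝ) * k i ≤ bracket j * bracket k := by
    apply le_of_abs_le
    apply abs_le_of_sq_le_sq _ (mul_nonneg (bracket_nonneg _) (bracket_nonneg _))
    have h2 := Finset.sum_mul_sq_le_sq_mul_sq Finset.univ (fun i => (j i : ℝ)) (fun i => (k i : ℝ))
    rw [mul_pow, bracket_sq, bracket_sq]
    refine h2.trans ?_
    unfold bracketSq
    have a : 0 ≤ ∑ i, (j i : ℝ) ^ 2 := Finset.sum_nonneg fun _ _ => sq_nonneg _
    have b : 0 ≤ ∑ i, (k i : ℝ) ^ 2 := Finset.sum_nonneg fun _ _ => sq_nonneg _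
    nlinarith
  apply abs_le_of_sq_le_sq' _ (add_nonneg (bracket_nonneg _) (bracket_nonneg _)) |>.2
  have h3 : bracketSq (j + k) = bracketSq j + bracketSq k - 1 + 2 * ∑ i, (j i : ℝ) * k i := by
    simp only [bracketSq, Pi.add_apply, Int.cast_add, add_sq, Finset.sum_add_distrib,
      Finset.mul_sum, mul_assoc]
    ring
  rw [add_sq, bracket_sq, bracket_sq, bracket_sq, h3]
  nlinarith

lemma abs_bracket_sub_le (j k : Fin N → ℤ) : |bracket j - bracket k| ≤ bracket (k - j) := by
  have h1 := bracket_add_le (k - j) j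
  have h2 := bracket_add_le (-(k - j)) k
  rw [bracket_neg] at h2
  rw [sub_add_cancel] at h1
  rw [neg_sub, sub_add_cancel] at h2
  rw [abs_le]; constructor <;> linarith

/-- The constant in `|α · k| ≤ A ⟨k⟩`. -/
noncomputable def freqConst (α : Fin N → ℝ) : ℝ := ∑ j, |α j|

lemma freqConst_nonneg (α : Fin N → ℝ) : 0 ≤ freqConst α :=
  Finset.sum_nonneg fun _ _ => abs_nonneg _

lemma abs_freq_le (α : Fin N → ℝ) (k : Fin N → ℤ) : |freq α k| ≤ freqConst α * bracket k := by
  unfold freq freqConst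
  rw [Finset.sum_mul]
  refine (Finset.abs_sum_le_sum_abs _ _).trans (Finset.sum_le_sum fun j _ => ?_)
  rw [abs_mul]
  refine mul_le_mul_of_nonneg_left ?_ (abs_nonneg _)
  apply Real.abs_le_sqrt
  have := Finset.single_le_sum (f := fun i => (k i : ℝ) ^ 2) (fun i _ => sq_nonneg _)
    (Finset.mem_univ j)
  simp only [bracketSq]
  linarith

lemma freq_add (α : Fin N → ℝ) (j k : Fin N → ℤ) : freq α (j + k) = freq α j + freq α k := by
  simp [freq, mul_add, Finset.sum_add_distrib]

lemma freq_neg (α : Fin N → ℝ) (k : Fin N → ℤ) : freq α (-k) = -freq α k := by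
  simp [freq]

lemma freq_sub (α : Fin N → ℝ) (j k : Fin N → ℤ) : freq α (j - k) = freq α j - freq α k := by
  rw [sub_eq_add_neg, freq_add, freq_neg, sub_eq_add_neg]

open Module in
-- The family is compared with the lattice sum of ‖k‖^(-r) over ℤ^N ⊂ ℝ^N with the sup norm, a
-- lattice of rank N. The point k = 0, where that norm vanishes, is dominated separately.
lemma summable_bracket_rpow {r : ℝ} (hr : (N : ℝ) < r) :
    Summable fun k : Fin N → ℤ => bracket k ^ (-r) := by
  let b := Pi.basisFun ℝ (Fin N)
  let Λ : Submodule ℤ (Fin N → ℝ) := Submodule.span ℤ (Set.range b)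
  have hrank : finrank ℤ Λ = N := by
    rw [ZLattice.rank ℝ Λ]; simp
  have hs := ZLattice.summable_norm_rpow Λ (-r) (by rw [hrank]; linarith)
  have hmem : ∀ k : Fin N → ℤ, (fun j => (k j : ℝ)) ∈ Λ := fun k => by
    rw [b.mem_span_iff_repr_mem ℤ]
    intro i
    exact ⟨k i, by simp [b]⟩
  have hinj : Function.Injective fun k : Fin N → ℤ => (⟨fun j => (k j : ℝ), hmem k⟩ : Λ) := by
    intro j k h
    ext i
    have := congrFun (congrArg Subtype.val h) i
    simpa using this
  have hs2 := hs.comp_injective hinj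
  have hs3 : Summable fun k : Fin N → ℤ => if k = 0 then (1 : ℝ) else 0 :=
    summable_of_ne_finset_zero (s := {0}) (by intro k hk; simpa using hk)
  have hr0 : -r ≤ 0 := by have : (0 : ℝ) ≤ N := Nat.cast_nonneg N; linarith
  refine Summable.of_nonneg_of_le (fun k => Real.rpow_nonneg (bracket_nonneg k) _) (fun k => ?_)
    (hs2.add hs3)
  by_cases hk : k = 0
  · have h1 : bracket k ^ (-r) ≤ 1 := Real.rpow_le_one_of_one_le_of_nonpos (one_le_bracket k) hr0
    have h2 : 0 ≤ ‖(⟨fun j => (k j : ℝ), hmem k⟩ : Λ)‖ ^ (-r) := Real.rpow_nonneg (norm_nonneg _) _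
    simp only [hk, if_true] at *
    simp only [Function.comp]
    linarith
  · simp only [hk, if_false, add_zero, Function.comp]
    refine Real.rpow_le_rpow_of_nonpos ?_ ?_ hr0
    · rw [norm_pos_iff]
      intro h
      apply hk
      ext i
      have := congrFun (congrArg Subtype.val h) i
      simpa using this
    · change ‖fun j => (k j : ℝ)‖ ≤ _
      rw [pi_norm_le_iff_of_nonneg (bracket_nonneg k)]
      intro i
      apply Real.abs_le_sqrt
      have := Finset.single_le_sum (f := fun i => (k i : ℝ) ^ 2) (fun i _ => sq_nonneg _)
        (Finset.mem_univ i)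
      simp only [bracketSq]
      linarith

/-! ### Weights of polynomial growth -/

/-- Nonnegative nondecreasing functions on `[1, ∞)` with `φ (c r) ≤ c ^ p φ r` for `c ≥ 1`. -/
structure IsWeight (p : ℕ) (φ : ℝ → ℝ) : Prop where
  nonneg : ∀ r, 1 ≤ r → 0 ≤ φ r
  mono : ∀ r r', 1 ≤ r → r ≤ r' → φ r ≤ φ r'
  scale : ∀ r c, 1 ≤ r → 1 ≤ c → φ (c * r) ≤ c ^ p * φ r

lemma IsWeight.mul {p q : ℕ} {φ ψ : ℝ → ℝ} (hφ : IsWeight p φ) (hψ : IsWeight q ψ) :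
    IsWeight (p + q) fun r => φ r * ψ r where
  nonneg r hr := mul_nonneg (hφ.nonneg r hr) (hψ.nonneg r hr)
  mono r r' hr h := mul_le_mul (hφ.mono r r' hr h) (hψ.mono r r' hr h) (hψ.nonneg r hr)
    (hφ.nonneg r' (hr.trans h))
  scale r c hr hc := by
    have h1 : 1 ≤ c * r := by nlinarith
    refine (mul_le_mul (hφ.scale r c hr hc) (hψ.scale r c hr hc) (hψ.nonneg _ h1)
      (mul_nonneg (by positivity) (hφ.nonneg r hr))).trans_eq (by ring)

lemma isWeight_rpow {p : ℕ} {a : ℝ} (ha : 0 ≤ a) (hp : a ≤ p) : IsWeight p fun r => r ^ a where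
  nonneg r hr := by positivity
  mono r r' hr h := Real.rpow_le_rpow (by linarith) h ha
  scale r c hr hc := by
    rw [Real.mul_rpow (by linarith) (by linarith)]
    refine mul_le_mul_of_nonneg_right ?_ (by positivity)
    rw [← Real.rpow_natCast]
    exact Real.rpow_le_rpow_of_exponent_le hc hp

lemma isWeight_min_div {R : ℝ} (hR : 0 < R) : IsWeight 1 fun r => min 1 (r / R) where
  nonneg r hr := by positivity
  mono r r' hr h := by gcongr
  scale r c hr hc := by
    rw [pow_one, mul_min_of_nonneg _ _ (by linarith), mul_one, mul_div_assoc]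
    exact min_le_min_right _ hc

lemma isWeight_min {R : ℝ} (hR : 0 < R) : IsWeight 1 fun r => min r R where
  nonneg r hr := by positivity
  mono r r' hr h := by gcongr
  scale r c hr hc := by
    rw [pow_one, mul_min_of_nonneg _ _ (by linarith)]
    exact min_le_min_left _ (by nlinarith)

/-- By convexity the power lies below its chord on [0, 1]. -/
lemma one_add_pow_le {x : ℝ} (h0 : 0 ≤ x) (h1 : x ≤ 1) (p : ℕ) :
    (1 + x) ^ p ≤ 1 + (2 ^ p - 1) * x := by
  induction p with
  | zero => simp
  | succ p ih =>
    have h2 : (1 : ℝ) ≤ 2 ^ p := one_le_pow₀ (by norm_num)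
    rw [pow_succ, pow_succ]
    nlinarith [mul_le_mul_of_nonneg_right ih (by linarith : 0 ≤ 1 + x),
      mul_nonneg (mul_nonneg (by linarith : (0 : ℝ) ≤ 2 ^ p - 1) h0) (by linarith : 0 ≤ 1 - x)]

/-- A substitute for the mean value theorem that needs no derivative of φ: the scaling property
alone controls increments, and the constant sees only the exponent p. -/
lemma IsWeight.abs_sub_mul_le {p : ℕ} {φ : ℝ → ℝ} (hφ : IsWeight p φ) {r r' d : ℝ} (hr : 1 ≤ r)
    (hr' : 1 ≤ r') (hd : 1 ≤ d) (h : |r - r'| ≤ d) :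
    |φ r' - φ r| * r ≤ 2 ^ p * (φ r * d + φ d * r) := by
  obtain ⟨h1, h2⟩ := abs_le.1 h
  have hφr := hφ.nonneg r hr
  have hφd := hφ.nonneg d hd
  have h2p : (1 : ℝ) ≤ 2 ^ p := one_le_pow₀ (by norm_num)
  have hr0 : 0 < r := by linarith
  rcases le_total d r with hdr | hdr
  -- For d ≤ r the relative change of φ is at most 2^p d/r: upwards by scaling with factor 1 + d/r,
  -- downwards by scaling with r/r' and Bernoulli's inequality.
  · have hx : d / r * r = d := div_mul_cancel₀ _ hr0.ne'
    have hx0 : 0 ≤ d / r := by positivity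
    have hx1 : d / r ≤ 1 := (div_le_one hr0).2 hdr
    suffices hs : |φ r' - φ r| ≤ 2 ^ p * (φ r * (d / r)) by
      calc |φ r' - φ r| * r ≤ 2 ^ p * (φ r * (d / r)) * r := by gcongr
        _ = 2 ^ p * (φ r * (d / r * r)) := by ring
        _ ≤ _ := by rw [hx]; gcongr; nlinarith
    rcases le_total r r' with hrr | hrr
    · rw [abs_of_nonneg (by linarith [hφ.mono r r' hr hrr])]
      have h3 := hφ.scale r (1 + d / r) hr (by linarith)
      have h4 := hφ.mono r' ((1 + d / r) * r) hr' (by rw [add_mul, hx]; linarith)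
      have h5 := mul_le_mul_of_nonneg_right (one_add_pow_le hx0 hx1 p) hφr
      nlinarith [mul_nonneg hφr hx0]
    · rw [abs_sub_comm, abs_of_nonneg (by linarith [hφ.mono r' r hr' hrr])]
      have hr'0 : 0 < r' := by linarith
      have h3 := hφ.scale r' (r / r') hr' (by rwa [le_div_iff₀ hr'0, one_mul])
      rw [div_mul_cancel₀ _ hr'0.ne', div_pow, div_mul_eq_mul_div, le_div_iff₀ (by positivity)] at h3
      have h4 : φ r * (r' / r) ^ p ≤ φ r' := by
        rw [div_pow, mul_div_assoc', div_le_iff₀ (by positivity)]; linarith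
      have h5 : (1 - d / r) ^ p ≤ (r' / r) ^ p := by
        refine pow_le_pow_left₀ (by linarith) ?_ p
        rw [le_div_iff₀ hr0, sub_mul, hx]; linarith
      have h6 : 1 + (p : ℝ) * (-(d / r)) ≤ (1 + -(d / r)) ^ p :=
        one_add_mul_le_pow (by linarith) p
      have h7 : (p : ℝ) ≤ 2 ^ p := by exact_mod_cast Nat.lt_two_pow_self.le
      rw [← sub_eq_add_neg] at h6
      have h8 := mul_le_mul_of_nonneg_left (h6.trans h5) hφr
      nlinarith [mul_nonneg hφr hx0, mul_le_mul_of_nonneg_right h7 (mul_nonneg hφr hx0)]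
  -- For d ≥ r both arguments are at most 2d, so both values are at most 2^p φ(d).
  · have h3 := hφ.scale d 2 hd (by norm_num)
    have h4 := hφ.mono r' (2 * d) hr' (by linarith)
    have h5 := hφ.mono r d hr hdr
    have h6 := hφ.nonneg r' hr'
    have h7 : |φ r' - φ r| ≤ 2 ^ p * φ d := by
      rw [abs_le]; constructor <;> nlinarith
    have h8 : 0 ≤ φ r * d := by positivity
    nlinarith [mul_le_mul_of_nonneg_right h7 hr0.le]

lemma IsWeight.bracket_commutator {p : ℕ} {φ : ℝ → ℝ} (hφ : IsWeight p φ) (j k : Fin N → ℤ) :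
    |φ (bracket k) - φ (bracket j)| * bracket j ≤
      2 ^ p * (φ (bracket j) * bracket (k - j) + φ (bracket (k - j)) * bracket j) :=
  hφ.abs_sub_mul_le (one_le_bracket j) (one_le_bracket k) (one_le_bracket _)
    (abs_bracket_sub_le j k)

end QPBO

namespace QPBO

/-! ### Convolution inequalities -/

lemma hasSum_of_eq {ι E : Type*} [AddCommMonoid E] [TopologicalSpace E] {f g : ι → E} {a b : E}
    (h : HasSum f a) (hfg : ∀ i, g i = f i) (hab : b = a) : HasSum g b := by
  rw [hab, funext hfg]
  exact h

section Convolution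

variable {G : Type*} [AddCommGroup G]

/-- The shear `(k, j) ↦ (k - j, j)`. -/
def subShear (G : Type*) [AddCommGroup G] : G × G ≃ G × G where
  toFun p := (p.1 - p.2, p.2)
  invFun p := (p.1 + p.2, p.2)
  left_inv p := by simp
  right_inv p := by simp

/-- The involution `(k, j) ↦ (k, k - j)`. -/
def subReflect (G : Type*) [AddCommGroup G] : G × G ≃ G × G where
  toFun p := (p.1, p.1 - p.2)
  invFun p := (p.1, p.1 - p.2)
  left_inv p := by simp
  right_inv p := by simp

lemma hasSum_sub_mul_right {f g : G → ℝ} (hf : Summable f) (hg : Summable g) (hf0 : ∀ k, 0 ≤ f k)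
    (hg0 : ∀ k, 0 ≤ g k) :
    HasSum (fun p : G × G => f (p.1 - p.2) * g p.2) ((∑' k, f k) * ∑' k, g k) := by
  have h := hf.hasSum.mul hg.hasSum (hf.mul_of_nonneg hg hf0 hg0)
  exact (subShear G).hasSum_iff.2 h

lemma hasSum_sub_mul_left {f g : G → ℝ} (hf : Summable f) (hg : Summable g) (hf0 : ∀ k, 0 ≤ f k)
    (hg0 : ∀ k, 0 ≤ g k) :
    HasSum (fun p : G × G => f (p.1 - p.2) * g p.1) ((∑' k, f k) * ∑' k, g k) := by
  have h := hg.hasSum.mul hf.hasSum (hg.mul_of_nonneg hf hg0 hf0)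
  have := (subReflect G).hasSum_iff.2 h
  rw [mul_comm]
  exact hasSum_of_eq this (fun p => by simp [subReflect, mul_comm]) rfl

/-- Pointwise hg ≤ (h² + g²)/2, after which the shear and the reflection of G × G turn each double
series into a product of single ones. This additive form loses nothing here when g and h have the
same ℓ² norm. -/
lemma trilinear_bound {f g h : G → ℝ} (hf : Summable f) (hg : Summable fun k => g k ^ 2)
    (hh : Summable fun k => h k ^ 2) (hf0 : ∀ k, 0 ≤ f k) (hg0 : ∀ k, 0 ≤ g k)
    (hh0 : ∀ k, 0 ≤ h k) :
    Summable (fun p : G × G => h p.1 * (f (p.1 - p.2) * g p.2)) ∧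
      ∑' p : G × G, h p.1 * (f (p.1 - p.2) * g p.2) ≤
        (∑' k, f k) * ((∑' k, h k ^ 2) + ∑' k, g k ^ 2) / 2 := by
  have h1 := hasSum_sub_mul_left hf hh hf0 fun k => sq_nonneg _
  have h2 := hasSum_sub_mul_right hf hg hf0 fun k => sq_nonneg _
  have h3 := (h1.add h2).div_const 2
  have hle : ∀ p : G × G, h p.1 * (f (p.1 - p.2) * g p.2) ≤
      (f (p.1 - p.2) * h p.1 ^ 2 + f (p.1 - p.2) * g p.2 ^ 2) / 2 := fun p => by
    nlinarith [mul_nonneg (hf0 (p.1 - p.2)) (sq_nonneg (h p.1 - g p.2))]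
  have hs : Summable (fun p : G × G => h p.1 * (f (p.1 - p.2) * g p.2)) :=
    Summable.of_nonneg_of_le
      (fun p => mul_nonneg (hh0 _) (mul_nonneg (hf0 _) (hg0 _))) hle h3.summable
  refine ⟨hs, (hs.tsum_le_tsum hle h3.summable).trans_eq ?_⟩
  rw [h3.tsum_eq]; ring

/-- The substitution j ↦ k - j exchanges the roles of the two factors of the convolution. -/
lemma trilinear_bound' {f g h : G → ℝ} (hf : Summable f) (hg : Summable fun k => g k ^ 2)
    (hh : Summable fun k => h k ^ 2) (hf0 : ∀ k, 0 ≤ f k) (hg0 : ∀ k, 0 ≤ g k)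
    (hh0 : ∀ k, 0 ≤ h k) :
    Summable (fun p : G × G => h p.1 * (g (p.1 - p.2) * f p.2)) ∧
      ∑' p : G × G, h p.1 * (g (p.1 - p.2) * f p.2) ≤
        (∑' k, f k) * ((∑' k, h k ^ 2) + ∑' k, g k ^ 2) / 2 := by
  obtain ⟨h1, h2⟩ := trilinear_bound hf hg hh hf0 hg0 hh0
  have he : ((fun p : G × G => h p.1 * (f (p.1 - p.2) * g p.2)) ∘ subReflect G) =
      fun p : G × G => h p.1 * (g (p.1 - p.2) * f p.2) := by
    funext p
    simp [subReflect, mul_comm]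
  rw [← he]
  exact ⟨(subReflect G).summable_iff.2 h1, ((subReflect G).tsum_eq _).trans_le h2⟩

/-- The convolution of two families on a group. -/
noncomputable def conv {R : Type*} [NonUnitalNonAssocSemiring R] [TopologicalSpace R]
    (f g : G → R) (k : G) : R := ∑' j, f (k - j) * g j

lemma summable_conv_term {f g : G → ℝ} (hf : Summable f) (hg : Summable fun k => g k ^ 2)
    (hf0 : ∀ k, 0 ≤ f k) (hg0 : ∀ k, 0 ≤ g k) (k : G) : Summable fun j => f (k - j) * g j := by
  classical
  have hf' : Summable fun j => f (k - j) := (Equiv.subLeft k).summable_iff.2 hf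
  have h2 := (hasSum_sub_mul_right hf hg hf0 fun k => sq_nonneg _).summable.prod_factor k
  refine Summable.of_nonneg_of_le (fun j => mul_nonneg (hf0 _) (hg0 _)) (fun j => ?_)
    (hf'.add h2)
  nlinarith [mul_nonneg (hf0 (k - j)) (sq_nonneg (g j - 1)), hf0 (k - j),
    mul_nonneg (hf0 (k - j)) (sq_nonneg (g j))]

/-- Young's inequality `ℓ¹ * ℓ² ⊂ ℓ²`. -/
lemma conv_sq_bound {f g : G → ℝ} (hf : Summable f) (hg : Summable fun k => g k ^ 2)
    (hf0 : ∀ k, 0 ≤ f k) (hg0 : ∀ k, 0 ≤ g k) :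
    Summable (fun k => conv f g k ^ 2) ∧
      ∑' k, conv f g k ^ 2 ≤ (∑' k, f k) ^ 2 * ∑' k, g k ^ 2 := by
  have h2 := hasSum_sub_mul_right hf hg hf0 fun k => sq_nonneg (g k)
  have hle : ∀ k, conv f g k ^ 2 ≤ (∑' k, f k) * ∑' j, f (k - j) * g j ^ 2 := fun k => by
    have hfk : Summable fun j => f (k - j) := (Equiv.subLeft k).summable_iff.2 hf
    have hfe : ∑' j, f (k - j) = ∑' j, f j := (Equiv.subLeft k).tsum_eq f
    have hgk : Summable fun j => f (k - j) * g j ^ 2 := h2.summable.prod_factor k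
    have hs := summable_conv_term hf hg hf0 hg0 k
    set B := ∑' j, f (k - j) * g j ^ 2
    set A := ∑' k, f k
    set X := conv f g k
    -- Cauchy–Schwarz for the measure f(k - ·): the quadratic polynomial Σ_j f(k-j)(t - g j)² is
    -- nonnegative, so its discriminant is nonpositive.
    have hq : ∀ t : ℝ, 0 ≤ A * (t * t) + (-2 * X) * t + B := fun t => by
      have e : HasSum (fun j => f (k - j) * (t - g j) ^ 2) (A * (t * t) + (-2 * X) * t + B) := by
        have := ((hfk.hasSum.mul_right (t * t)).add ((hs.hasSum.mul_left (-2)).mul_right t)).add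
          hgk.hasSum
        rw [hfe] at this
        exact hasSum_of_eq this (fun j => by ring) (by simp only [X, B, conv])
      exact e.nonneg fun j => mul_nonneg (hf0 _) (sq_nonneg _)
    have := discrim_le_zero hq
    unfold discrim at this
    nlinarith
  have hs2 := h2.summable.prod.mul_left (∑' k, f k)
  have hs1 : Summable (fun k => conv f g k ^ 2) :=
    Summable.of_nonneg_of_le (fun k => sq_nonneg _) hle hs2
  refine ⟨hs1, (hs1.tsum_le_tsum hle hs2).trans_eq ?_⟩
  rw [tsum_mul_left, ← h2.summable.tsum_prod, h2.tsum_eq]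
  ring

lemma summable_sq_of_nonneg {ι : Type*} {f : ι → ℝ} (hf : Summable f) (hf0 : ∀ k, 0 ≤ f k) :
    Summable fun k => f k ^ 2 := by
  refine Summable.of_nonneg_of_le (fun k => sq_nonneg _) (fun k => ?_) (hf.mul_left (∑' k, f k))
  rw [sq]
  exact mul_le_mul_of_nonneg_right (hf.le_tsum k fun j _ => hf0 j) (hf0 k)

lemma summable_conv_complex {f g : G → ℂ} (hf : Summable fun k => ‖f k‖)
    (hg : Summable fun k => ‖g k‖ ^ 2) (k : G) : Summable fun j => f (k - j) * g j := by
  refine Summable.of_norm ?_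
  simpa only [norm_mul] using
    summable_conv_term hf hg (fun _ => norm_nonneg _) (fun _ => norm_nonneg _) k

lemma summable_conv_complex' {f g : G → ℂ} (hf : Summable fun k => ‖f k‖ ^ 2)
    (hg : Summable fun k => ‖g k‖) (k : G) : Summable fun j => f (k - j) * g j := by
  have := (Equiv.subLeft k).summable_iff.2 (summable_conv_complex hg hf k)
  refine this.congr fun j => ?_
  simp [mul_comm]

end Convolution

/-! ### Energy estimates for the quadratic nonlinearity -/

open ComplexConjugate

variable {N : ℕ} {α : Fin N → ℝ}

lemma norm_derivCoeff_le (α : Fin N → ℝ) (c : (Fin N → ℤ) → ℂ) (k : Fin N → ℤ) :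
    ‖derivCoeff α c k‖ ≤ freqConst α * (bracket k * ‖c k‖) := by
  unfold derivCoeff
  rw [norm_mul, norm_mul, Complex.norm_I, one_mul, Complex.norm_real, Real.norm_eq_abs, ← mul_assoc]
  exact mul_le_mul_of_nonneg_right (abs_freq_le α k) (norm_nonneg _)

lemma summable_norm_derivCoeff {c : (Fin N → ℤ) → ℂ}
    (hc : Summable fun k => bracket k * ‖c k‖) : Summable fun k => ‖derivCoeff α c k‖ :=
  Summable.of_nonneg_of_le (fun _ => norm_nonneg _) (norm_derivCoeff_le α c)
    (hc.mul_left (freqConst α))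

lemma summable_norm_of_bracket {c : (Fin N → ℤ) → ℂ}
    (hc : Summable fun k => bracket k * ‖c k‖) : Summable fun k => ‖c k‖ :=
  Summable.of_nonneg_of_le (fun _ => norm_nonneg _)
    (fun k => le_mul_of_one_le_left (norm_nonneg _) (one_le_bracket k)) hc

lemma summable_norm_derivCoeff_sq {c : (Fin N → ℤ) → ℂ}
    (hc : Summable fun k => (bracket k * ‖c k‖) ^ 2) :
    Summable fun k => ‖derivCoeff α c k‖ ^ 2 := by
  refine Summable.of_nonneg_of_le (fun _ => sq_nonneg _) (fun k => ?_)
    (hc.mul_left (freqConst α ^ 2))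
  rw [← mul_pow]
  exact pow_le_pow_left₀ (norm_nonneg _) (norm_derivCoeff_le α c k) 2

/-- Integration by parts on the Fourier side: for real u, Re ∫ conj(b) u bₓ = -½ ∫ uₓ |b|². No
derivative of b survives in the bound; `hb1` only makes the double series absolutely convergent. -/
lemma transport_bound {c b : (Fin N → ℤ) → ℂ} (hc : ∀ k, c (-k) = conj (c k))
    (hc1 : Summable fun k => bracket k * ‖c k‖) (hb : Summable fun k => ‖b k‖ ^ 2)
    (hb1 : Summable fun k => (bracket k * ‖b k‖) ^ 2) :
    Summable (fun p : (Fin N → ℤ) × (Fin N → ℤ) =>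
        conj (b p.1) * (c (p.1 - p.2) * derivCoeff α b p.2)) ∧
      |(∑' p : (Fin N → ℤ) × (Fin N → ℤ),
        conj (b p.1) * (c (p.1 - p.2) * derivCoeff α b p.2)).re| ≤
        freqConst α / 2 * (∑' k, bracket k * ‖c k‖) * ∑' k, ‖b k‖ ^ 2 := by
  set F : (Fin N → ℤ) × (Fin N → ℤ) → ℂ :=
    fun p => conj (b p.1) * (c (p.1 - p.2) * derivCoeff α b p.2)
  have hF : Summable F := by
    refine Summable.of_norm ?_
    have := (trilinear_bound (summable_norm_of_bracket hc1)
      (summable_norm_derivCoeff_sq (α := α) hb1) hb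
      (fun _ => norm_nonneg _) (fun _ => norm_nonneg _) (fun _ => norm_nonneg _)).1
    simpa only [F, norm_mul, RCLike.norm_conj] using this
  refine ⟨hF, ?_⟩
  -- Twice the real part, symmetrised over (k, j) ↔ (j, k): the factors ω(j) and -ω(k) combine to
  -- -ω(k - j), a derivative falling on c.
  have h1 : HasSum (fun p => F p + conj (F p.swap)) ((∑' p, F p) + conj (∑' p, F p)) :=
    hF.hasSum.add ((Equiv.prodComm _ _).hasSum_iff.2
      (Complex.hasSum_conj'.2 (by simpa using hF.hasSum)))
  have hn : ∀ p, ‖F p + conj (F p.swap)‖ ≤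
      freqConst α * (‖b p.1‖ * ((bracket (p.1 - p.2) * ‖c (p.1 - p.2)‖) * ‖b p.2‖)) := fun p => by
    have e : F p + conj (F p.swap) = conj (b p.1) * (-derivCoeff α c (p.1 - p.2) * b p.2) := by
      have hs : conj (c (p.2 - p.1)) = c (p.1 - p.2) := by
        rw [← neg_sub, hc, Complex.conj_conj]
      simp only [F, derivCoeff, Prod.fst_swap, Prod.snd_swap, map_mul, Complex.conj_conj, hs,
        Complex.conj_I, Complex.conj_ofReal, freq_sub, Complex.ofReal_sub]
      ring
    rw [e, norm_mul, norm_mul, norm_neg, RCLike.norm_conj]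
    have := norm_derivCoeff_le α c (p.1 - p.2)
    calc ‖b p.1‖ * (‖derivCoeff α c (p.1 - p.2)‖ * ‖b p.2‖)
        ≤ ‖b p.1‖ * (freqConst α * (bracket (p.1 - p.2) * ‖c (p.1 - p.2)‖) * ‖b p.2‖) := by gcongr
      _ = _ := by ring
  obtain ⟨h2, h3⟩ := trilinear_bound hc1 hb hb
    (fun k => mul_nonneg (bracket_nonneg k) (norm_nonneg _)) (fun _ => norm_nonneg _)
    (fun _ => norm_nonneg _)
  have h4 := tsum_of_norm_bounded (h2.mul_left (freqConst α)).hasSum hn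
  rw [h1.tsum_eq, tsum_mul_left, Complex.add_conj, Complex.norm_real, Real.norm_eq_abs, abs_mul,
    abs_two] at h4
  have h5 := mul_le_mul_of_nonneg_left h3 (freqConst_nonneg α)
  linarith

/-- The derivative in `derivCoeff α c q.2` costs one factor ⟨j⟩, which the difference of the weights
absorbs by `IsWeight.bracket_commutator`. Two trilinear sums remain, each with ⟨k⟩c as its ℓ¹
factor. -/
lemma commutator_bound {p : ℕ} {φ : ℝ → ℝ} (hφ : IsWeight p φ) {c : (Fin N → ℤ) → ℂ}
    (hc1 : Summable fun k => bracket k * ‖c k‖)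
    (hc2 : Summable fun k => (φ (bracket k) * ‖c k‖) ^ 2) :
    Summable (fun q : (Fin N → ℤ) × (Fin N → ℤ) => conj (φ (bracket q.1) * c q.1) *
        ((φ (bracket q.1) - φ (bracket q.2)) * (c (q.1 - q.2) * derivCoeff α c q.2))) ∧
      ‖∑' q : (Fin N → ℤ) × (Fin N → ℤ), conj (φ (bracket q.1) * c q.1) *
        ((φ (bracket q.1) - φ (bracket q.2)) * (c (q.1 - q.2) * derivCoeff α c q.2))‖ ≤
        2 * 2 ^ p * freqConst α * (∑' k, bracket k * ‖c k‖) *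
          ∑' k, (φ (bracket k) * ‖c k‖) ^ 2 := by
  have hφ0 : ∀ k : Fin N → ℤ, 0 ≤ φ (bracket k) := fun k => hφ.nonneg _ (one_le_bracket k)
  have h0 : ∀ k, 0 ≤ φ (bracket k) * ‖c k‖ := fun k => mul_nonneg (hφ0 k) (norm_nonneg _)
  have h0' : ∀ k, 0 ≤ bracket k * ‖c k‖ := fun k => mul_nonneg (bracket_nonneg k) (norm_nonneg _)
  obtain ⟨h1, h2⟩ := trilinear_bound hc1 hc2 hc2 h0' h0 h0
  obtain ⟨h3, h4⟩ := trilinear_bound' hc1 hc2 hc2 h0' h0 h0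
  have hs := (h1.add h3).mul_left (2 ^ p * freqConst α)
  have hn : ∀ q : (Fin N → ℤ) × (Fin N → ℤ), ‖conj (φ (bracket q.1) * c q.1) *
        ((φ (bracket q.1) - φ (bracket q.2)) * (c (q.1 - q.2) * derivCoeff α c q.2))‖ ≤
      2 ^ p * freqConst α * (φ (bracket q.1) * ‖c q.1‖ * (bracket (q.1 - q.2) * ‖c (q.1 - q.2)‖ *
        (φ (bracket q.2) * ‖c q.2‖)) + φ (bracket q.1) * ‖c q.1‖ *
        (φ (bracket (q.1 - q.2)) * ‖c (q.1 - q.2)‖ * (bracket q.2 * ‖c q.2‖))) := fun q => by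
    have h5 := hφ.bracket_commutator q.2 q.1
    have h6 := norm_derivCoeff_le α c q.2
    rw [norm_mul, RCLike.norm_conj, norm_mul, norm_mul, norm_mul, ← Complex.ofReal_sub,
      Complex.norm_real, Complex.norm_real, Real.norm_eq_abs, Real.norm_eq_abs,
      abs_of_nonneg (hφ0 q.1)]
    set D := |φ (bracket q.1) - φ (bracket q.2)|
    have hA := freqConst_nonneg α
    calc φ (bracket q.1) * ‖c q.1‖ * (D * (‖c (q.1 - q.2)‖ * ‖derivCoeff α c q.2‖))
        ≤ φ (bracket q.1) * ‖c q.1‖ *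
          (D * (‖c (q.1 - q.2)‖ * (freqConst α * (bracket q.2 * ‖c q.2‖)))) := by
          have := h0 q.1
          gcongr
      _ = φ (bracket q.1) * ‖c q.1‖ * (freqConst α * ‖c (q.1 - q.2)‖ * ‖c q.2‖) *
          (D * bracket q.2) := by ring
      _ ≤ φ (bracket q.1) * ‖c q.1‖ * (freqConst α * ‖c (q.1 - q.2)‖ * ‖c q.2‖) *
          (2 ^ p * (φ (bracket q.2) * bracket (q.1 - q.2) +
            φ (bracket (q.1 - q.2)) * bracket q.2)) := by
          have := h0 q.1
          gcongr
      _ = _ := by ring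
  refine ⟨Summable.of_norm_bounded hs hn, (tsum_of_norm_bounded hs.hasSum hn).trans ?_⟩
  rw [tsum_mul_left, h1.tsum_add h3]
  have h7 := mul_le_mul_of_nonneg_left (add_le_add h2 h4)
    (mul_nonneg (by positivity : (0 : ℝ) ≤ 2 ^ p) (freqConst_nonneg α))
  linarith

/-- The weighted energy estimate for the Benjamin–Ono nonlinearity. -/
lemma energy_bound {p : ℕ} {φ : ℝ → ℝ} (hφ : IsWeight p φ) {c : (Fin N → ℤ) → ℂ}
    (hc : ∀ k, c (-k) = conj (c k)) (hc1 : Summable fun k => bracket k * ‖c k‖)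
    (hc2 : Summable fun k => (φ (bracket k) * ‖c k‖) ^ 2)
    (hc3 : Summable fun k => (bracket k * (φ (bracket k) * ‖c k‖)) ^ 2) :
    ∃ Z : ℂ, HasSum (fun k => conj ((φ (bracket k) ^ 2 : ℝ) * c k) * conv c (derivCoeff α c) k) Z ∧
      |Z.re| ≤ (1 / 2 + 2 * 2 ^ p) * freqConst α * (∑' k, bracket k * ‖c k‖) *
          ∑' k, (φ (bracket k) * ‖c k‖) ^ 2 := by
  have hφ0 : ∀ k : Fin N → ℤ, 0 ≤ φ (bracket k) := fun k => hφ.nonneg _ (one_le_bracket k)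
  have hnb : ∀ k, ‖(φ (bracket k) : ℂ) * c k‖ = φ (bracket k) * ‖c k‖ := fun k => by
    rw [norm_mul, Complex.norm_real, Real.norm_eq_abs, abs_of_nonneg (hφ0 k)]
  obtain ⟨h1, h2⟩ := transport_bound (α := α) (b := fun k => φ (bracket k) * c k) hc hc1
    (by simpa only [hnb] using hc2) (by simpa only [hnb] using hc3)
  obtain ⟨h3, h4⟩ := commutator_bound (α := α) hφ hc1 hc2
  simp only [hnb] at h2
  -- With b = φc, the identity φ(k) c(k-j) Dc(j) = c(k-j) Db(j) + (φ(k) - φ(j)) c(k-j) Dc(j) splits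
  -- the energy into transport and commutator.
  have h5 := (h1.hasSum.add h3.hasSum)
  refine ⟨_, h5.prod_fiberwise fun k => ?_, ?_⟩
  · have h6 := (summable_conv_complex (summable_norm_of_bracket hc1)
      (summable_sq_of_nonneg (summable_norm_derivCoeff (α := α) hc1)
        fun _ => norm_nonneg _) k).hasSum
    refine hasSum_of_eq (h6.mul_left (conj ((φ (bracket k) ^ 2 : ℝ) * c k))) (fun j => ?_) rfl
    simp only [derivCoeff, map_mul, Complex.conj_ofReal, Complex.ofReal_pow, map_pow]
    ring
  · rw [Complex.add_re]
    refine (abs_add_le _ _).trans ?_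
    have := (Complex.abs_re_le_norm _).trans h4
    linarith

/-- The `L²` energy estimate for the difference of two solutions. -/
lemma difference_bound {c d w : (Fin N → ℤ) → ℂ}
    (hc : ∀ k, c (-k) = conj (c k)) (hc1 : Summable fun k => bracket k * ‖c k‖)
    (hd1 : Summable fun k => bracket k * ‖d k‖) (hw : Summable fun k => ‖w k‖ ^ 2)
    (hw1 : Summable fun k => (bracket k * ‖w k‖) ^ 2) :
    ∃ Z : ℂ, HasSum (fun k => conj (w k) *
        (conv c (derivCoeff α w) k + conv w (derivCoeff α d) k)) Z ∧
      |Z.re| ≤ freqConst α * ((∑' k, bracket k * ‖c k‖) + ∑' k, bracket k * ‖d k‖) *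
          ∑' k, ‖w k‖ ^ 2 := by
  -- In uuₓ - vvₓ = u wₓ + w vₓ the first term is antisymmetric up to uₓ, and the second costs only
  -- the ℓ¹ norm of the coefficients of vₓ.
  obtain ⟨h1, h2⟩ := transport_bound (α := α) (b := w) hc hc1 hw hw1
  have hd' := summable_norm_derivCoeff (α := α) hd1
  obtain ⟨h3, h4⟩ := trilinear_bound' hd' hw hw (fun _ => norm_nonneg _) (fun _ => norm_nonneg _)
    (fun _ => norm_nonneg _)
  have hn : ∀ q : (Fin N → ℤ) × (Fin N → ℤ), ‖conj (w q.1) *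
      (w (q.1 - q.2) * derivCoeff α d q.2)‖ ≤ ‖w q.1‖ * (‖w (q.1 - q.2)‖ * ‖derivCoeff α d q.2‖) :=
    fun q => by rw [norm_mul, norm_mul, RCLike.norm_conj]
  have h5 := Summable.of_norm_bounded h3 hn
  have h6 := tsum_of_norm_bounded h3.hasSum hn
  refine ⟨_, (h1.hasSum.add h5.hasSum).prod_fiberwise fun k => ?_, ?_⟩
  · have h7 := (summable_conv_complex (summable_norm_of_bracket hc1)
      (summable_norm_derivCoeff_sq (α := α) hw1) k).hasSum
    have h8 := (summable_conv_complex' hw hd' k).hasSum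
    exact hasSum_of_eq ((h7.add h8).mul_left (conj (w k))) (fun j => by ring) rfl
  · rw [Complex.add_re]
    refine (abs_add_le _ _).trans ?_
    have h9 : ∑' k, ‖derivCoeff α d k‖ ≤ freqConst α * ∑' k, bracket k * ‖d k‖ := by
      rw [← tsum_mul_left]
      exact hd'.tsum_le_tsum (norm_derivCoeff_le α d) (hd1.mul_left _)
    have h10 := (Complex.abs_re_le_norm _).trans h6
    have hw0 : 0 ≤ ∑' k, ‖w k‖ ^ 2 := tsum_nonneg fun _ => sq_nonneg _
    have hc0 : 0 ≤ freqConst α * (∑' k, bracket k * ‖c k‖) * ∑' k, ‖w k‖ ^ 2 :=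
      mul_nonneg (mul_nonneg (freqConst_nonneg α) (tsum_nonneg fun k =>
        mul_nonneg (bracket_nonneg k) (norm_nonneg _))) hw0
    nlinarith [mul_le_mul_of_nonneg_right h9 hw0]

end QPBO

namespace QPBO

open ComplexConjugate

/-! ### The Hilbert space of square summable families -/

/-- Square summable families on `ℤ^N`. The element `x` stands for the series with coefficients
`⟨k⟩^{-s} x k`, so that its norm is the `H^s` norm of that series. -/
def Hl (N : ℕ) : Type := lp (fun _ : Fin N → ℤ => ℂ) 2

variable {N : ℕ}

noncomputable instance : NormedAddCommGroup (Hl N) :=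
  inferInstanceAs (NormedAddCommGroup (lp (fun _ : Fin N → ℤ => ℂ) 2))

noncomputable instance : InnerProductSpace ℂ (Hl N) :=
  inferInstanceAs (InnerProductSpace ℂ (lp (fun _ : Fin N → ℤ => ℂ) 2))

instance : CompleteSpace (Hl N) :=
  inferInstanceAs (CompleteSpace (lp (fun _ : Fin N → ℤ => ℂ) 2))

/-- The family underlying an element of `Hl N`. -/
def Hl.toFun (x : Hl N) : (Fin N → ℤ) → ℂ := Subtype.val (p := fun f => f ∈ lp _ 2) x

instance : CoeFun (Hl N) fun _ => (Fin N → ℤ) → ℂ := ⟨Hl.toFun⟩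

namespace Hl

@[ext] lemma ext {x y : Hl N} (h : ∀ k, x k = y k) : x = y := Subtype.ext (funext h)

@[simp] lemma add_apply (x y : Hl N) (k : Fin N → ℤ) : (x + y) k = x k + y k := rfl
@[simp] lemma sub_apply (x y : Hl N) (k : Fin N → ℤ) : (x - y) k = x k - y k := rfl
@[simp] lemma smul_apply (a : ℂ) (x : Hl N) (k : Fin N → ℤ) : (a • x) k = a * x k := rfl
@[simp] lemma real_smul_apply (a : ℝ) (x : Hl N) (k : Fin N → ℤ) : (a • x) k = a * x k := rfl

lemma hasSum_inner (x y : Hl N) : HasSum (fun k => conj (x k) * y k) (inner ℂ x y) := by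
  refine hasSum_of_eq (lp.hasSum_inner (𝕜 := ℂ) (G := fun _ : Fin N → ℤ => ℂ) x y)
    (fun k => ?_) rfl
  simp only [RCLike.inner_apply, mul_comm]
  rfl

lemma hasSum_norm_sq (x : Hl N) : HasSum (fun k => ‖x k‖ ^ 2) (‖x‖ ^ 2) := by
  have h := Complex.hasSum_re (hasSum_inner x x)
  rw [inner_self_eq_norm_sq_to_K] at h
  refine hasSum_of_eq h (fun k => ?_) ?_
  · rw [← Complex.normSq_eq_conj_mul_self, Complex.ofReal_re, Complex.normSq_eq_norm_sq]
  · norm_cast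

lemma summable_norm_sq (x : Hl N) : Summable fun k => ‖x k‖ ^ 2 := (hasSum_norm_sq x).summable

lemma norm_sq_eq (x : Hl N) : ‖x‖ ^ 2 = ∑' k, ‖x k‖ ^ 2 := (hasSum_norm_sq x).tsum_eq.symm

lemma norm_apply_le (x : Hl N) (k : Fin N → ℤ) : ‖x k‖ ≤ ‖x‖ := by
  refine le_of_sq_le_sq ?_ (norm_nonneg _)
  rw [norm_sq_eq]
  exact (summable_norm_sq x).le_tsum k fun _ _ => sq_nonneg _

/-- The element with given square summable entries. -/
def mk (f : (Fin N → ℤ) → ℂ) (hf : Summable fun k => ‖f k‖ ^ 2) : Hl N :=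
  ⟨f, memℓp_gen (by simpa using hf)⟩

@[simp] lemma mk_apply (f : (Fin N → ℤ) → ℂ) (hf : Summable fun k => ‖f k‖ ^ 2)
    (k : Fin N → ℤ) : mk f hf k = f k := rfl

lemma norm_le_of_sq_le {x : Hl N} {h : (Fin N → ℤ) → ℝ} {C : ℝ} (hC : 0 ≤ C)
    (hx : ∀ k, ‖x k‖ ^ 2 ≤ h k) (hh : Summable h) (hs : ∑' k, h k ≤ C ^ 2) : ‖x‖ ≤ C := by
  refine le_of_sq_le_sq ?_ hC
  rw [norm_sq_eq]
  exact ((summable_norm_sq x).tsum_le_tsum hx hh).trans hs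

lemma norm_le_norm_of_apply {x y : Hl N} {C : ℝ} (hC : 0 ≤ C) (h : ∀ k, ‖x k‖ ≤ C * ‖y k‖) :
    ‖x‖ ≤ C * ‖y‖ := by
  refine norm_le_of_sq_le (h := fun k => C ^ 2 * ‖y k‖ ^ 2) (by positivity) (fun k => ?_)
    ((summable_norm_sq y).mul_left _) ?_
  · rw [← mul_pow]; exact pow_le_pow_left₀ (norm_nonneg _) (h k) 2
  · rw [tsum_mul_left, ← norm_sq_eq, mul_pow]

/-- Evaluation at `k`. -/
noncomputable def evalCLM (k : Fin N → ℤ) : Hl N →L[ℂ] ℂ :=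
  LinearMap.mkContinuous
    { toFun := fun x => x k, map_add' := fun _ _ => rfl, map_smul' := fun _ _ => rfl } 1
    fun x => (norm_apply_le x k).trans_eq (one_mul _).symm

lemma tendsto_apply {ι : Type*} {l : Filter ι} {f : ι → Hl N} {x : Hl N}
    (h : Tendsto f l (𝓝 x)) (k : Fin N → ℤ) : Tendsto (fun i => f i k) l (𝓝 (x k)) :=
  ((evalCLM k).continuous.tendsto x).comp h

/-- Multiplication by a bounded family. -/
noncomputable def diag (m : (Fin N → ℤ) → ℂ) (C : ℝ) (hm : ∀ k, ‖m k‖ ≤ C) : Hl N →L[ℂ] Hl N :=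
  LinearMap.mkContinuous
    { toFun := fun x => mk (fun k => m k * x k) <| by
        refine Summable.of_nonneg_of_le (fun _ => sq_nonneg _) (fun k => ?_)
          ((summable_norm_sq x).mul_left (C ^ 2))
        rw [norm_mul, ← mul_pow]
        gcongr
        exact hm k
      map_add' := fun x y => by ext k; simp [mul_add]
      map_smul' := fun a x => by ext k; simp; ring } C
    fun x => norm_le_norm_of_apply ((norm_nonneg _).trans (hm 0)) fun k => by
      simp only [LinearMap.coe_mk, AddHom.coe_mk, mk_apply, norm_mul]
      gcongr
      exact hm k

@[simp] lemma diag_apply (m : (Fin N → ℤ) → ℂ) (C : ℝ) (hm : ∀ k, ‖m k‖ ≤ C) (x : Hl N)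
    (k : Fin N → ℤ) : diag m C hm x k = m k * x k := rfl

lemma norm_diag_apply_le (m : (Fin N → ℤ) → ℂ) (C : ℝ) (hm : ∀ k, ‖m k‖ ≤ C) (x : Hl N) :
    ‖diag m C hm x‖ ≤ C * ‖x‖ :=
  norm_le_norm_of_apply ((norm_nonneg _).trans (hm 0)) fun k => by
    rw [diag_apply, norm_mul]; gcongr; exact hm k

end Hl

/-! ### Coefficients and the bilinear operator -/

/-- The Fourier coefficients represented by `x`. -/
noncomputable def coeff (s : ℝ) (x : Hl N) (k : Fin N → ℤ) : ℂ := (bracket k ^ (-s) : ℝ) * x k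

lemma bracket_rpow_pos (k : Fin N → ℤ) (a : ℝ) : 0 < bracket k ^ a :=
  Real.rpow_pos_of_pos (bracket_pos k) a

lemma norm_bracket_rpow (k : Fin N → ℤ) (a : ℝ) : ‖((bracket k ^ a : ℝ) : ℂ)‖ = bracket k ^ a := by
  rw [Complex.norm_real, Real.norm_eq_abs, abs_of_pos (bracket_rpow_pos k a)]

lemma norm_coeff (s : ℝ) (x : Hl N) (k : Fin N → ℤ) :
    ‖coeff s x k‖ = bracket k ^ (-s) * ‖x k‖ := by
  rw [coeff, norm_mul, norm_bracket_rpow]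

lemma bracket_rpow_mul_norm_coeff (s a : ℝ) (x : Hl N) (k : Fin N → ℤ) :
    bracket k ^ a * ‖coeff s x k‖ = bracket k ^ (a - s) * ‖x k‖ := by
  rw [norm_coeff, ← mul_assoc, ← Real.rpow_add (bracket_pos k), sub_eq_add_neg]

lemma bracket_mul_norm_coeff (s : ℝ) (x : Hl N) (k : Fin N → ℤ) :
    bracket k * ‖coeff s x k‖ = bracket k ^ (1 - s) * ‖x k‖ := by
  rw [← bracket_rpow_mul_norm_coeff, Real.rpow_one]

@[simp] lemma coeff_add (s : ℝ) (x y : Hl N) : coeff s (x + y) = coeff s x + coeff s y := by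
  funext k; simp [coeff, mul_add]

@[simp] lemma coeff_sub (s : ℝ) (x y : Hl N) : coeff s (x - y) = coeff s x - coeff s y := by
  funext k; simp [coeff, mul_sub]

@[simp] lemma coeff_smul (s : ℝ) (a : ℂ) (x : Hl N) : coeff s (a • x) = a • coeff s x := by
  funext k; simp [coeff]; ring

variable {α : Fin N → ℝ} {s : ℝ}

lemma half_le_dim : (0 : ℝ) ≤ (N : ℝ) / 2 := by positivity

lemma bracket_rpow_le_one {a : ℝ} (ha : a ≤ 0) (k : Fin N → ℤ) : bracket k ^ a ≤ 1 :=
  Real.rpow_le_one_of_one_le_of_nonpos (one_le_bracket k) ha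

/-- The constant of the embedding `H^{s-1} ⊂ ℓ¹`. -/
noncomputable def embedConst (N : ℕ) (s : ℝ) : ℝ :=
  Real.sqrt (∑' k : Fin N → ℤ, (bracket k ^ (1 - s)) ^ 2)

lemma summable_bracket_sq (hs : (N : ℝ) / 2 + 1 < s) :
    Summable fun k : Fin N → ℤ => (bracket k ^ (1 - s)) ^ 2 := by
  refine (summable_bracket_rpow (N := N) (r := 2 * (s - 1)) (by linarith)).congr fun k => ?_
  rw [← Real.rpow_natCast, ← Real.rpow_mul (bracket_nonneg k)]
  congr 1; push_cast; ring

lemma embedConst_nonneg : 0 ≤ embedConst N s := Real.sqrt_nonneg _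

/-- Cauchy–Schwarz against ⟨k⟩^(1-s), which is square summable exactly because 2(s - 1) > N. -/
lemma embedding (hs : (N : ℝ) / 2 + 1 < s) (x : Hl N) :
    Summable (fun k => bracket k * ‖coeff s x k‖) ∧
      ∑' k, bracket k * ‖coeff s x k‖ ≤ embedConst N s * ‖x‖ := by
  have h := Real.summable_and_inner_le_Lp_mul_Lq_tsum_of_nonneg Real.HolderConjugate.two_two
    (f := fun k : Fin N → ℤ => bracket k ^ (1 - s)) (g := fun k => ‖x k‖)
    (fun k => (bracket_rpow_pos k _).le) (fun k => norm_nonneg _)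
    (by simpa using summable_bracket_sq hs) (by simpa using Hl.summable_norm_sq x)
  simp only [bracket_mul_norm_coeff]
  refine ⟨h.1, h.2.trans_eq ?_⟩
  simp only [Real.rpow_two, ← Real.sqrt_eq_rpow, ← Hl.norm_sq_eq, embedConst]
  rw [Real.sqrt_sq (norm_nonneg _)]

lemma add_rpow_le {a b p : ℝ} (ha : 0 ≤ a) (hb : 0 ≤ b) (hp : 0 ≤ p) :
    (a + b) ^ p ≤ 2 ^ p * (a ^ p + b ^ p) := by
  have ha' := Real.rpow_nonneg ha p
  have hb' := Real.rpow_nonneg hb p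
  have h2 : (0 : ℝ) ≤ 2 ^ p := by positivity
  rcases le_total a b with h | h
  · have := Real.rpow_le_rpow (by positivity) (by linarith : a + b ≤ 2 * b) hp
    rw [Real.mul_rpow (by norm_num) hb] at this
    nlinarith
  · have := Real.rpow_le_rpow (by positivity) (by linarith : a + b ≤ 2 * a) hp
    rw [Real.mul_rpow (by norm_num) ha] at this
    nlinarith

/-- The constant of the product estimate. -/
noncomputable def prodConst (α : Fin N → ℝ) (s : ℝ) : ℝ :=
  2 * 2 ^ (s - 1) * embedConst N s * freqConst α

lemma prodConst_nonneg : 0 ≤ prodConst α s :=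
  mul_nonneg (mul_nonneg (by positivity) embedConst_nonneg) (freqConst_nonneg α)

/-- The weight ⟨k⟩^(s-1) is distributed by ⟨k⟩^(s-1) ≤ 2^(s-1)(⟨j⟩^(s-1) + ⟨k-j⟩^(s-1)). Whichever
factor receives it is in ℓ², the other is in ℓ¹ by `embedding`, and Young's inequality applies. -/
lemma product_bound (hs : (N : ℝ) / 2 + 1 < s) (x y : Hl N) :
    Summable (fun k => ‖((bracket k ^ (s - 1) : ℝ) : ℂ) *
        conv (coeff s x) (derivCoeff α (coeff s y)) k‖ ^ 2) ∧
      ∑' k, ‖((bracket k ^ (s - 1) : ℝ) : ℂ) *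
        conv (coeff s x) (derivCoeff α (coeff s y)) k‖ ^ 2 ≤ (prodConst α s * ‖x‖ * ‖y‖) ^ 2 := by
  have hs1 : 0 ≤ s - 1 := by have := half_le_dim (N := N); linarith
  obtain ⟨hx1, hx2⟩ := embedding hs x
  obtain ⟨hy1, hy2⟩ := embedding hs y
  have hA := freqConst_nonneg α
  have hE := embedConst_nonneg (N := N) (s := s)
  set f₁ : (Fin N → ℤ) → ℝ := fun k => ‖coeff s x k‖
  set g₁ : (Fin N → ℤ) → ℝ := fun k => freqConst α * ‖y k‖
  set f₂ : (Fin N → ℤ) → ℝ := fun k => freqConst α * (bracket k * ‖coeff s y k‖)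
  set g₂ : (Fin N → ℤ) → ℝ := fun k => ‖x k‖
  have hf₁ : Summable f₁ := summable_norm_of_bracket hx1
  have hf₂ : Summable f₂ := hy1.mul_left _
  have hg₁ : Summable fun k => g₁ k ^ 2 := by
    simp only [g₁, mul_pow]; exact (Hl.summable_norm_sq y).mul_left _
  have hg₂ : Summable fun k => g₂ k ^ 2 := Hl.summable_norm_sq x
  have f₁0 : ∀ k, 0 ≤ f₁ k := fun k => norm_nonneg _
  have f₂0 : ∀ k, 0 ≤ f₂ k := fun k =>
    mul_nonneg hA (mul_nonneg (bracket_nonneg k) (norm_nonneg _))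
  have g₁0 : ∀ k, 0 ≤ g₁ k := fun k => mul_nonneg hA (norm_nonneg _)
  have g₂0 : ∀ k, 0 ≤ g₂ k := fun k => norm_nonneg _
  obtain ⟨h1, h2⟩ := conv_sq_bound hf₁ hg₁ f₁0 g₁0
  obtain ⟨h3, h4⟩ := conv_sq_bound hf₂ hg₂ f₂0 g₂0
  have sf₁ : ∑' k, f₁ k ≤ embedConst N s * ‖x‖ :=
    (hf₁.tsum_le_tsum (fun k => le_mul_of_one_le_left (norm_nonneg _) (one_le_bracket k))
      hx1).trans hx2
  have sf₂ : ∑' k, f₂ k ≤ freqConst α * (embedConst N s * ‖y‖) := by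
    simp only [f₂, tsum_mul_left]; gcongr
  have sg₁ : ∑' k, g₁ k ^ 2 = (freqConst α * ‖y‖) ^ 2 := by
    simp only [g₁, mul_pow, tsum_mul_left, ← Hl.norm_sq_eq]
  have sg₂ : ∑' k, g₂ k ^ 2 = ‖x‖ ^ 2 := (Hl.norm_sq_eq x).symm
  have hpt : ∀ k, ‖((bracket k ^ (s - 1) : ℝ) : ℂ) *
      conv (coeff s x) (derivCoeff α (coeff s y)) k‖ ≤
        2 ^ (s - 1) * (conv f₁ g₁ k + conv f₂ g₂ k) := fun k => by
    have e1 := (summable_conv_term hf₁ hg₁ f₁0 g₁0 k).hasSum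
    have e2 := (Equiv.subLeft k).hasSum_iff.2 (summable_conv_term hf₂ hg₂ f₂0 g₂0 k).hasSum
    have e3 := (e1.add e2).mul_left (2 ^ (s - 1))
    rw [conv, ← tsum_mul_left]
    refine tsum_of_norm_bounded e3 fun j => ?_
    simp only [Function.comp, Equiv.subLeft_apply, sub_sub_cancel]
    have b1 : bracket k ^ (s - 1) ≤ 2 ^ (s - 1) * (bracket j ^ (s - 1) + bracket (k - j) ^ (s - 1)) := by
      refine (Real.rpow_le_rpow (bracket_nonneg k) ?_ hs1).trans
        (add_rpow_le (bracket_nonneg _) (bracket_nonneg _) hs1)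
      simpa using bracket_add_le j (k - j)
    have b2 := norm_derivCoeff_le α (coeff s y) j
    rw [norm_mul, norm_mul, norm_bracket_rpow]
    have b3 : bracket j ^ (s - 1) * (bracket j * ‖coeff s y j‖) = ‖y j‖ := by
      rw [← mul_assoc, ← Real.rpow_add_one (bracket_pos j).ne', sub_add_cancel,
        bracket_rpow_mul_norm_coeff, sub_self, Real.rpow_zero, one_mul]
    have b4 : bracket (k - j) ^ (s - 1) * ‖coeff s x (k - j)‖ ≤ ‖x (k - j)‖ := by
      rw [bracket_rpow_mul_norm_coeff]
      exact mul_le_of_le_one_left (norm_nonneg _) (bracket_rpow_le_one (by linarith) _)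
    have q1 := bracket_rpow_pos k (s - 1)
    have q2 := bracket_rpow_pos j (s - 1)
    have q3 := bracket_rpow_pos (k - j) (s - 1)
    have q4 : (0 : ℝ) ≤ 2 ^ (s - 1) := by positivity
    calc bracket k ^ (s - 1) * (‖coeff s x (k - j)‖ * ‖derivCoeff α (coeff s y) j‖)
        ≤ (2 ^ (s - 1) * (bracket j ^ (s - 1) + bracket (k - j) ^ (s - 1))) *
          (‖coeff s x (k - j)‖ * (freqConst α * (bracket j * ‖coeff s y j‖))) := by gcongr
      _ = 2 ^ (s - 1) * (‖coeff s x (k - j)‖ * (freqConst α *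
            (bracket j ^ (s - 1) * (bracket j * ‖coeff s y j‖))) +
            freqConst α * (bracket j * ‖coeff s y j‖) *
            (bracket (k - j) ^ (s - 1) * ‖coeff s x (k - j)‖)) := by ring
      _ ≤ 2 ^ (s - 1) * (f₁ (k - j) * g₁ j + f₂ j * g₂ (k - j)) := by
          rw [b3]
          have := f₂0 j
          gcongr
  have hpt2 : ∀ k, ‖((bracket k ^ (s - 1) : ℝ) : ℂ) *
      conv (coeff s x) (derivCoeff α (coeff s y)) k‖ ^ 2 ≤
        2 * (2 ^ (s - 1)) ^ 2 * (conv f₁ g₁ k ^ 2 + conv f₂ g₂ k ^ 2) := fun k => by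
    refine (pow_le_pow_left₀ (norm_nonneg _) (hpt k) 2).trans ?_
    nlinarith [mul_nonneg (sq_nonneg ((2 : ℝ) ^ (s - 1))) (sq_nonneg (conv f₁ g₁ k - conv f₂ g₂ k))]
  have hsm := (h1.add h3).mul_left (2 * (2 ^ (s - 1)) ^ 2)
  have hsm' := Summable.of_nonneg_of_le (fun k => sq_nonneg _) hpt2 hsm
  refine ⟨hsm', (hsm'.tsum_le_tsum hpt2 hsm).trans ?_⟩
  rw [tsum_mul_left, h1.tsum_add h3]
  have t1 : ∑' k, conv f₁ g₁ k ^ 2 ≤ (embedConst N s * freqConst α * ‖x‖ * ‖y‖) ^ 2 := by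
    refine h2.trans ?_
    rw [sg₁, ← mul_pow]
    refine pow_le_pow_left₀ (mul_nonneg (tsum_nonneg f₁0) (by positivity)) ?_ 2
    calc _ ≤ embedConst N s * ‖x‖ * (freqConst α * ‖y‖) := by gcongr
      _ = _ := by ring
  have t2 : ∑' k, conv f₂ g₂ k ^ 2 ≤ (embedConst N s * freqConst α * ‖x‖ * ‖y‖) ^ 2 := by
    refine h4.trans ?_
    rw [sg₂, ← mul_pow]
    refine pow_le_pow_left₀ (mul_nonneg (tsum_nonneg f₂0) (by positivity)) ?_ 2
    calc _ ≤ freqConst α * (embedConst N s * ‖y‖) * ‖x‖ := by gcongr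
      _ = _ := by ring
  calc _ ≤ 2 * (2 ^ (s - 1)) ^ 2 * ((embedConst N s * freqConst α * ‖x‖ * ‖y‖) ^ 2 +
        (embedConst N s * freqConst α * ‖x‖ * ‖y‖) ^ 2) := by gcongr
    _ = _ := by unfold prodConst; ring

lemma summable_product_term (hs : (N : ℝ) / 2 + 1 < s) (x y : Hl N) (k : Fin N → ℤ) :
    Summable fun j => coeff s x (k - j) * derivCoeff α (coeff s y) j :=
  summable_conv_complex (summable_norm_of_bracket (embedding hs x).1)
    (summable_sq_of_nonneg (summable_norm_derivCoeff (embedding hs y).1) fun _ => norm_nonneg _) k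

lemma derivCoeff_add (c d : (Fin N → ℤ) → ℂ) :
    derivCoeff α (c + d) = derivCoeff α c + derivCoeff α d := by
  funext k; simp [derivCoeff, mul_add]

lemma derivCoeff_smul (a : ℂ) (c : (Fin N → ℤ) → ℂ) :
    derivCoeff α (a • c) = a • derivCoeff α c := by
  funext k; simp [derivCoeff]; ring

/-- The bilinear operator `(u, v) ↦ u v_x`, as a map `H^s × H^s → H^{s-1}`. -/
noncomputable def product (α : Fin N → ℝ) (hs : (N : ℝ) / 2 + 1 < s) :
    Hl N →L[ℂ] Hl N →L[ℂ] Hl N :=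
  LinearMap.mkContinuous₂
    (LinearMap.mk₂ ℂ
      (fun x y => Hl.mk (fun k => ((bracket k ^ (s - 1) : ℝ) : ℂ) *
        conv (coeff s x) (derivCoeff α (coeff s y)) k) (product_bound hs x y).1)
      (fun x x' y => by
        ext k
        have h := (summable_product_term (α := α) hs x y k).tsum_add
          (summable_product_term (α := α) hs x' y k)
        simp only [Hl.mk_apply, Hl.add_apply, conv, ← mul_add, ← h, coeff_add, Pi.add_apply,
          add_mul])
      (fun a x y => by
        ext k
        simp only [Hl.mk_apply, Hl.smul_apply, conv, coeff_smul, Pi.smul_apply, smul_eq_mul,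
          mul_assoc, tsum_mul_left]
        ring)
      (fun x y y' => by
        ext k
        have h := (summable_product_term (α := α) hs x y k).tsum_add
          (summable_product_term (α := α) hs x y' k)
        simp only [Hl.mk_apply, Hl.add_apply, conv, ← mul_add, ← h, coeff_add, derivCoeff_add,
          Pi.add_apply])
      (fun a x y => by
        ext k
        simp only [Hl.mk_apply, Hl.smul_apply, conv, coeff_smul, derivCoeff_smul, Pi.smul_apply,
          smul_eq_mul, mul_left_comm _ a, tsum_mul_left]))
    (prodConst α s)
    fun x y => Hl.norm_le_of_sq_le
      (mul_nonneg (mul_nonneg prodConst_nonneg (norm_nonneg _)) (norm_nonneg _))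
      (fun _ => le_rfl) (product_bound hs x y).1 (product_bound hs x y).2

@[simp] lemma product_apply (hs : (N : ℝ) / 2 + 1 < s) (x y : Hl N) (k : Fin N → ℤ) :
    product α hs x y k = ((bracket k ^ (s - 1) : ℝ) : ℂ) *
        conv (coeff s x) (derivCoeff α (coeff s y)) k := rfl

lemma norm_product_le (hs : (N : ℝ) / 2 + 1 < s) (x y : Hl N) :
    ‖product α hs x y‖ ≤ prodConst α s * ‖x‖ * ‖y‖ :=
  Hl.norm_le_of_sq_le
      (mul_nonneg (mul_nonneg prodConst_nonneg (norm_nonneg _)) (norm_nonneg _))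
      (fun _ => le_rfl) (product_bound hs x y).1 (product_bound hs x y).2

end QPBO

namespace QPBO

open ComplexConjugate

variable {N : ℕ} {α : Fin N → ℝ} {s : ℝ}

/-! ### The equation as an evolution in `Hl N` -/

/-- The symbol `ω |ω|` of `-i H ∂ₓ²`. -/
noncomputable def disp (α : Fin N → ℝ) (k : Fin N → ℤ) : ℝ := freq α k * |freq α k|

lemma abs_disp_le (α : Fin N → ℝ) (k : Fin N → ℤ) :
    |disp α k| ≤ freqConst α ^ 2 * bracket k ^ 2 := by
  rw [disp, abs_mul, abs_abs, ← sq, ← mul_pow]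
  exact pow_le_pow_left₀ (abs_nonneg _) (abs_freq_le α k) 2

/-- Multiplication by `⟨k⟩^a`, for `a ≤ 0`. -/
noncomputable def smoothing (N : ℕ) (a : ℝ) (ha : a ≤ 0) : Hl N →L[ℂ] Hl N :=
  Hl.diag (fun k => (bracket k ^ a : ℝ)) 1 fun k => by
    rw [norm_bracket_rpow]; exact bracket_rpow_le_one ha k

@[simp] lemma smoothing_apply (a : ℝ) (ha : a ≤ 0) (x : Hl N) (k : Fin N → ℤ) :
    smoothing N a ha x k = (bracket k ^ a : ℝ) * x k := rfl

lemma norm_smoothing_le (a : ℝ) (ha : a ≤ 0) (x : Hl N) : ‖smoothing N a ha x‖ ≤ ‖x‖ :=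
  (Hl.norm_diag_apply_le _ _ _ x).trans_eq (one_mul _)

/-- The projection to the frequencies in `S`. -/
noncomputable def proj (S : Set (Fin N → ℤ)) : Hl N →L[ℂ] Hl N :=
  Hl.diag (S.indicator 1) 1 fun k => by
    by_cases hk : k ∈ S <;> simp [hk]

lemma proj_apply (S : Set (Fin N → ℤ)) (x : Hl N) (k : Fin N → ℤ) :
    proj S x k = S.indicator (1 : (Fin N → ℤ) → ℂ) k * x k := rfl

lemma proj_apply_of_mem {S : Set (Fin N → ℤ)} {k : Fin N → ℤ} (hk : k ∈ S) (x : Hl N) :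
    proj S x k = x k := by simp [proj_apply, hk]

lemma proj_apply_of_notMem {S : Set (Fin N → ℤ)} {k : Fin N → ℤ} (hk : k ∉ S) (x : Hl N) :
    proj S x k = 0 := by simp [proj_apply, hk]

lemma norm_proj_le (S : Set (Fin N → ℤ)) (x : Hl N) : ‖proj S x‖ ≤ ‖x‖ :=
  (Hl.norm_diag_apply_le _ _ _ x).trans_eq (one_mul _)

lemma norm_dispersion_le (α : Fin N → ℝ) (k : Fin N → ℤ) :
    ‖Complex.I * ((disp α k * bracket k ^ (-2 : ℝ) : ℝ) : ℂ)‖ ≤ freqConst α ^ 2 := by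
  rw [norm_mul, Complex.norm_I, one_mul, Complex.norm_real, Real.norm_eq_abs, abs_mul,
    abs_of_pos (bracket_rpow_pos k _), Real.rpow_neg (bracket_nonneg k), Real.rpow_two]
  rw [← div_eq_mul_inv, div_le_iff₀ (pow_pos (bracket_pos k) 2)]
  exact abs_disp_le α k

/-- `⟨k⟩^{-2}` times the dispersive term. -/
noncomputable def dispersion (α : Fin N → ℝ) : Hl N →L[ℂ] Hl N :=
  Hl.diag (fun k => Complex.I * ((disp α k * bracket k ^ (-2 : ℝ) : ℝ) : ℂ)) (freqConst α ^ 2)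
    (norm_dispersion_le α)

/-- The right-hand side of the equation truncated to the frequencies in `S`, in `H^{s-2}`. -/
noncomputable def field (α : Fin N → ℝ) (hs : (N : ℝ) / 2 + 1 < s) (S : Set (Fin N → ℤ))
    (x : Hl N) : Hl N :=
  proj S (smoothing N (-1) (by norm_num) (product α hs x x)) + dispersion α x

/-- The Fourier coefficients of `u u_x`. -/
noncomputable def nonlin (α : Fin N → ℝ) (s : ℝ) (x : Hl N) : (Fin N → ℤ) → ℂ :=
  conv (coeff s x) (derivCoeff α (coeff s x))

lemma field_apply (hs : (N : ℝ) / 2 + 1 < s) (S : Set (Fin N → ℤ)) (x : Hl N) (k : Fin N → ℤ) :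
    field α hs S x k = (bracket k ^ (s - 2) : ℝ) *
      (S.indicator (nonlin α s x) k + Complex.I * disp α k * coeff s x k) := by
  have e1 : ((bracket k ^ (-1 : ℝ) : ℝ) : ℂ) * (bracket k ^ (s - 1) : ℝ) =
      (bracket k ^ (s - 2) : ℝ) := by
    rw [← Complex.ofReal_mul, ← Real.rpow_add (bracket_pos k)]; congr 2; ring
  have e2 : ((bracket k ^ (s - 2) : ℝ) : ℂ) * (bracket k ^ (-s) : ℝ) =
      (bracket k ^ (-2 : ℝ) : ℝ) := by
    rw [← Complex.ofReal_mul, ← Real.rpow_add (bracket_pos k)]; congr 2; ring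
  have e3 : field α hs S x k = S.indicator (1 : (Fin N → ℤ) → ℂ) k *
      ((bracket k ^ (-1 : ℝ) : ℝ) * ((bracket k ^ (s - 1) : ℝ) * nonlin α s x k)) +
      Complex.I * ((disp α k * bracket k ^ (-2 : ℝ) : ℝ) : ℂ) * x k := rfl
  rw [e3, ← mul_assoc ((bracket k ^ (-1 : ℝ) : ℝ) : ℂ), e1, coeff, Complex.ofReal_mul, ← e2]
  by_cases hk : k ∈ S
  · simp only [Set.indicator_of_mem hk, Pi.one_apply]; ring
  · simp only [Set.indicator_of_notMem hk]; ring

lemma product_sub (hs : (N : ℝ) / 2 + 1 < s) (x y : Hl N) :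
    product α hs x x - product α hs y y = product α hs x (x - y) + product α hs (x - y) y := by
  simp only [map_sub, sub_apply]; abel

/-- The constant is independent of S, so this local Lipschitz bound from H^s to H^(s-2) survives the
limit of the truncations. -/
lemma norm_field_sub_le (hs : (N : ℝ) / 2 + 1 < s) (S : Set (Fin N → ℤ)) (x y : Hl N) :
    ‖field α hs S x - field α hs S y‖ ≤
      (prodConst α s * (‖x‖ + ‖y‖) + freqConst α ^ 2) * ‖x - y‖ := by
  have e : field α hs S x - field α hs S y =
      proj S (smoothing N (-1) (by norm_num) (product α hs x (x - y) + product α hs (x - y) y)) +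
        dispersion α (x - y) := by
    rw [← product_sub]
    simp only [field, map_sub]; abel
  rw [e]
  have h1 := norm_product_le (α := α) hs x (x - y)
  have h2 := norm_product_le (α := α) hs (x - y) y
  have h3 : ‖dispersion α (x - y)‖ ≤ freqConst α ^ 2 * ‖x - y‖ := Hl.norm_diag_apply_le _ _ _ _
  have h4 := (norm_proj_le S _).trans (norm_smoothing_le (-1) (by norm_num)
    (product α hs x (x - y) + product α hs (x - y) y))
  have h5 := norm_add_le (product α hs x (x - y)) (product α hs (x - y) y)
  refine (norm_add_le _ _).trans ?_
  linarith

/-- Solutions in `C([0,T]; H^s)` of the equation truncated to the frequencies in `S`. -/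
structure Sol (α : Fin N → ℝ) (hs : (N : ℝ) / 2 + 1 < s) (S : Set (Fin N → ℤ)) (T : ℝ)
    (x : ℝ → Hl N) : Prop where
  cont : ContinuousOn x (Set.Icc 0 T)
  deriv : ∀ t ∈ Set.Icc 0 T, HasDerivWithinAt (fun τ => smoothing N (-2) (by norm_num) (x τ))
    (field α hs S (x t)) (Set.Icc 0 T) t
  supp : ∀ t ∈ Set.Icc 0 T, ∀ k, k ∉ S → x t k = 0
  real : ∀ t ∈ Set.Icc 0 T, ∀ k, x t (-k) = conj (x t k)

lemma Sol.mono {hs : (N : ℝ) / 2 + 1 < s} {S : Set (Fin N → ℤ)} {T T' : ℝ} {x : ℝ → Hl N}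
    (hx : Sol α hs S T x) (h : T' ≤ T) : Sol α hs S T' x := by
  have hI : Set.Icc 0 T' ⊆ Set.Icc 0 T := Set.Icc_subset_Icc_right h
  exact ⟨hx.cont.mono hI, fun t ht => (hx.deriv t (hI ht)).mono hI, fun t ht => hx.supp t (hI ht),
    fun t ht => hx.real t (hI ht)⟩

lemma coeff_neg_eq_conj {x : Hl N} (hx : ∀ k, x (-k) = conj (x k)) (k : Fin N → ℤ) :
    coeff s x (-k) = conj (coeff s x k) := by
  simp [coeff, hx]

/-! ### Energies and Grönwall's inequality -/

/-- A quadratic energy can be differentiated although x is only continuous and just its smoothing by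
⟨k⟩^(-2) is differentiable: by symmetry the increment of Re⟨MΛx, x⟩ equals Re⟨MΛ(x τ - x t), x τ + x
t⟩, and the difference quotient falls on the smoothed side alone. -/
lemma energy_hasDerivWithinAt {x : ℝ → Hl N} {y' : Hl N} {I : Set ℝ} {t : ℝ}
    (hx : ContinuousWithinAt x I t)
    (hy : HasDerivWithinAt (fun τ => smoothing N (-2) (by norm_num) (x τ)) y' I t)
    (m : (Fin N → ℤ) → ℝ) (C : ℝ) (hm : ∀ k, ‖(m k : ℂ)‖ ≤ C) :
    HasDerivWithinAt
      (fun τ => (inner ℂ (Hl.diag (fun k => m k) C hm (smoothing N (-2) (by norm_num) (x τ)))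
        (x τ)).re)
      (2 * (inner ℂ (Hl.diag (fun k => m k) C hm y') (x t)).re) I t := by
  set M := Hl.diag (fun k => (m k : ℂ)) C hm
  set Λ := smoothing N (-2) (by norm_num)
  have hsym : ∀ u v : Hl N, (inner ℂ (M (Λ u)) v).re = (inner ℂ (M (Λ v)) u).re := fun u v => by
    have h1 := Complex.hasSum_re (Hl.hasSum_inner (M (Λ u)) v)
    have h2 := Complex.hasSum_re (Hl.hasSum_inner (M (Λ v)) u)
    refine h1.unique (hasSum_of_eq h2 (fun k => ?_) rfl)
    simp only [M, Λ, Hl.diag_apply, smoothing_apply, map_mul, Complex.conj_ofReal]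
    simp only [Complex.mul_re, Complex.mul_im, Complex.conj_re, Complex.conj_im,
      Complex.ofReal_re, Complex.ofReal_im]
    ring
  rw [hasDerivWithinAt_iff_tendsto_slope] at hy ⊢
  have hx' : Tendsto (fun τ => x τ + x t) (𝓝[I \ {t}] t) (𝓝 (x t + x t)) :=
    (hx.mono Set.sdiff_subset).tendsto.add_const _
  have h3 := (((M.continuous.tendsto _).comp hy).inner (𝕜 := ℂ) hx')
  have h4 := (Complex.continuous_re.tendsto _).comp h3
  have e : (inner ℂ (M y') (x t + x t)).re = 2 * (inner ℂ (M y') (x t)).re := by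
    rw [inner_add_right, Complex.add_re, two_mul]
  rw [e] at h4
  refine h4.congr fun τ => ?_
  simp only [Function.comp, slope_def_module]
  have e2 : M ((τ - t)⁻¹ • (Λ (x τ) - Λ (x t))) = ((τ - t)⁻¹ : ℝ) • M (Λ (x τ) - Λ (x t)) := by
    ext k
    simp [M]
  have e3 : ∀ (a : ℝ) (u v : Hl N), (inner ℂ (a • u) v).re = a * (inner ℂ u v).re := fun a u v => by
    have : a • u = (a : ℂ) • u := by ext k; simp
    rw [this, inner_smul_left, Complex.conj_ofReal, Complex.re_ofReal_mul]
  rw [e2, e3, smul_eq_mul, map_sub, inner_sub_left, inner_add_right, inner_add_right]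
  simp only [Complex.sub_re, Complex.add_re]
  rw [hsym (x t) (x τ)]
  ring

lemma gronwall_le {E D : ℝ → ℝ} {T K η : ℝ} (hη : 0 ≤ η) (hK : 0 ≤ K)
    (hE : ∀ t ∈ Set.Icc 0 T, HasDerivWithinAt E (D t) (Set.Icc 0 T) t)
    (hD : ∀ t ∈ Set.Icc 0 T, D t ≤ K * E t + η) {t : ℝ} (ht : t ∈ Set.Icc 0 T) :
    E t ≤ (E 0 + η * t) * Real.exp (K * t) := by
  have hexp : ∀ τ : ℝ, HasDerivAt (fun τ => Real.exp (-(K * τ))) (Real.exp (-(K * τ)) * -K) τ :=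
    fun τ => by
      have := ((hasDerivAt_id τ).const_mul K).neg.exp
      simpa using this
  have hg : ∀ τ ∈ Set.Icc 0 T, HasDerivWithinAt (fun τ => E τ * Real.exp (-(K * τ)) - η * τ)
      (D τ * Real.exp (-(K * τ)) + E τ * (Real.exp (-(K * τ)) * -K) - η * 1) (Set.Icc 0 T) τ :=
    fun τ hτ => ((hE τ hτ).mul (hexp τ).hasDerivWithinAt).sub
      ((hasDerivWithinAt_id τ _).const_mul η)
  -- The source contributes at most η per unit time because e^(-Kτ) ≤ 1.
  have hanti : AntitoneOn (fun τ => E τ * Real.exp (-(K * τ)) - η * τ) (Set.Icc 0 T) := by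
    refine antitoneOn_of_hasDerivWithinAt_nonpos (convex_Icc 0 T)
      (fun τ hτ => (hg τ hτ).continuousWithinAt)
      (fun τ hτ => (hg τ (interior_subset hτ)).mono interior_subset) fun τ hτ => ?_
    have hτ := interior_subset hτ
    have h1 : Real.exp (-(K * τ)) ≤ 1 :=
      Real.exp_le_one_iff.2 (neg_nonpos.2 (mul_nonneg hK hτ.1))
    have h2 := Real.exp_pos (-(K * τ))
    nlinarith [hD τ hτ]
  have h := hanti ⟨le_rfl, ht.1.trans ht.2⟩ ht ht.1
  simp only [mul_zero, neg_zero, Real.exp_zero, mul_one, sub_zero] at h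
  have h3 : E t = E t * Real.exp (-(K * t)) * Real.exp (K * t) := by
    rw [mul_assoc, ← Real.exp_add]; simp
  rw [h3]
  exact mul_le_mul_of_nonneg_right (by linarith) (Real.exp_pos _).le

/-! ### Weighted energy estimates -/

lemma re_energy_le (hs : (N : ℝ) / 2 + 1 < s) {p : ℕ} {φ : ℝ → ℝ} (hφ : IsWeight p φ)
    {S : Set (Fin N → ℤ)} {x : Hl N} (hx : ∀ k, x (-k) = conj (x k)) (hS : ∀ k, k ∉ S → x k = 0)
    (h2 : Summable fun k => (φ (bracket k) * ‖coeff s x k‖) ^ 2)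
    (h3 : Summable fun k => (bracket k * (φ (bracket k) * ‖coeff s x k‖)) ^ 2) {Q : ℂ}
    (hQ : HasSum (fun k => conj ((φ (bracket k) ^ 2 : ℝ) *
      (S.indicator (nonlin α s x) k + Complex.I * disp α k * coeff s x k)) * coeff s x k) Q) :
    |Q.re| ≤ (1 / 2 + 2 * 2 ^ p) * freqConst α * embedConst N s * ‖x‖ *
          ∑' k, (φ (bracket k) * ‖coeff s x k‖) ^ 2 := by
  obtain ⟨h1, h1'⟩ := embedding hs x
  obtain ⟨Z, hZ, hZ'⟩ := energy_bound (α := α) hφ (coeff_neg_eq_conj hx) h1 h2 h3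
  -- Off S both sides vanish because x does, so the truncation is invisible; on S the dispersive
  -- term contributes i ω|ω||c|² up to conjugation, which has no real part.
  have e : Q.re = Z.re := by
    refine (Complex.hasSum_re hQ).unique (hasSum_of_eq (Complex.hasSum_re hZ) (fun k => ?_) rfl)
    by_cases hk : k ∈ S
    · rw [Set.indicator_of_mem hk]
      simp only [nonlin, map_mul, map_add, Complex.conj_ofReal, Complex.conj_I, Complex.mul_re,
        Complex.mul_im, Complex.add_re, Complex.add_im, Complex.conj_re, Complex.conj_im,
        Complex.ofReal_re, Complex.ofReal_im, Complex.neg_re, Complex.neg_im, Complex.I_re,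
        Complex.I_im]
      ring
    · simp [coeff, hS k hk]
  rw [e]
  refine hZ'.trans ?_
  have hA := freqConst_nonneg α
  have h0 : 0 ≤ ∑' k, (φ (bracket k) * ‖coeff s x k‖) ^ 2 := tsum_nonneg fun _ => sq_nonneg _
  rw [mul_assoc _ (embedConst N s)]
  gcongr

/-- The constant in the energy estimates. -/
noncomputable def energyConst (α : Fin N → ℝ) (s : ℝ) : ℝ :=
  (1 + 4 * 2 ^ (⌈s⌉₊ + 2)) * freqConst α * embedConst N s

lemma energyConst_nonneg : 0 ≤ energyConst α s :=
  mul_nonneg (mul_nonneg (by positivity) (freqConst_nonneg α)) embedConst_nonneg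

/-- The assumption φ ≤ B⟨k⟩^(s-1), one power below the norm of the space, makes the energy
differentiable and the double series convergent. The conclusion does not involve B, so φ may
afterwards approach weights of order s. -/
lemma Sol.weighted_le {hs : (N : ℝ) / 2 + 1 < s} {S : Set (Fin N → ℤ)} {T R B : ℝ} {x : ℝ → Hl N}
    (hx : Sol α hs S T x) (hR : ∀ t ∈ Set.Icc 0 T, ‖x t‖ ≤ R) {φ : ℝ → ℝ}
    (hφ : IsWeight (⌈s⌉₊ + 2) φ) (hB : ∀ k : Fin N → ℤ, φ (bracket k) ≤ B * bracket k ^ (s - 1))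
    {t : ℝ} (ht : t ∈ Set.Icc 0 T) :
    Summable (fun k => (φ (bracket k) * ‖coeff s (x t) k‖) ^ 2) ∧
    ∑' k, (φ (bracket k) * ‖coeff s (x t) k‖) ^ 2 ≤
      (∑' k, (φ (bracket k) * ‖coeff s (x 0) k‖) ^ 2) * Real.exp (energyConst α s * R * t) := by
  have hφ0 : ∀ k : Fin N → ℤ, 0 ≤ φ (bracket k) := fun k => hφ.nonneg _ (one_le_bracket k)
  have hB0 : 0 ≤ B := nonneg_of_mul_nonneg_left ((hφ0 0).trans (hB 0)) (bracket_rpow_pos _ _)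
  have hp3 : ∀ (u : Hl N) k, bracket k * (φ (bracket k) * ‖coeff s u k‖) ≤ B * ‖u k‖ := fun u k => by
    calc bracket k * (φ (bracket k) * ‖coeff s u k‖)
        ≤ bracket k * (B * bracket k ^ (s - 1) * ‖coeff s u k‖) := by
          have := bracket_nonneg k
          gcongr
          exact hB k
      _ = B * (bracket k ^ (s - 1) * bracket k * ‖coeff s u k‖) := by ring
      _ = B * ‖u k‖ := by
          rw [← Real.rpow_add_one (bracket_pos k).ne', sub_add_cancel, bracket_rpow_mul_norm_coeff,
            sub_self, Real.rpow_zero, one_mul]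
  have hp0 : ∀ (u : Hl N) k, 0 ≤ φ (bracket k) * ‖coeff s u k‖ :=
    fun u k => mul_nonneg (hφ0 k) (norm_nonneg _)
  have hs3 : ∀ u : Hl N, Summable fun k => (bracket k * (φ (bracket k) * ‖coeff s u k‖)) ^ 2 :=
    fun u => Summable.of_nonneg_of_le (fun _ => sq_nonneg _)
      (fun k => by
        rw [← mul_pow]
        exact pow_le_pow_left₀ (mul_nonneg (bracket_nonneg k) (hp0 u k)) (hp3 u k) 2)
      ((Hl.summable_norm_sq u).mul_left (B ^ 2))
  have hs2 : ∀ u : Hl N, Summable fun k => (φ (bracket k) * ‖coeff s u k‖) ^ 2 :=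
    fun u => Summable.of_nonneg_of_le (fun _ => sq_nonneg _)
      (fun k => pow_le_pow_left₀ (hp0 u k)
        (le_mul_of_one_le_left (hp0 u k) (one_le_bracket k)) 2) (hs3 u)
  refine ⟨hs2 _, ?_⟩
  -- The exponent 2 - 2s cancels the ⟨k⟩^(-2) of the smoothing and the two factors ⟨k⟩^s between x
  -- and its coefficients, leaving φ²|c|².
  have hm : ∀ k, ‖((φ (bracket k) ^ 2 * bracket k ^ (2 - 2 * s) : ℝ) : ℂ)‖ ≤ B ^ 2 := fun k => by
    have h1 := bracket_rpow_pos k (2 - 2 * s)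
    rw [Complex.norm_real, Real.norm_eq_abs, abs_of_nonneg (by positivity)]
    calc φ (bracket k) ^ 2 * bracket k ^ (2 - 2 * s)
        ≤ (B * bracket k ^ (s - 1)) ^ 2 * bracket k ^ (2 - 2 * s) := by
          gcongr
          · exact hφ0 k
          · exact hB k
      _ = B ^ 2 * (bracket k ^ (s - 1) * bracket k ^ (s - 1) * bracket k ^ (2 - 2 * s)) := by ring
      _ = B ^ 2 := by
          rw [← Real.rpow_add (bracket_pos k), ← Real.rpow_add (bracket_pos k)]
          ring_nf
          simp
  set m : (Fin N → ℤ) → ℝ := fun k => φ (bracket k) ^ 2 * bracket k ^ (2 - 2 * s)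
  have hx_eq : ∀ (u : Hl N) k, u k = (bracket k ^ s : ℝ) * coeff s u k := fun u k => by
    rw [coeff, ← mul_assoc, ← Complex.ofReal_mul, ← Real.rpow_add (bracket_pos k)]; simp
  have hE : ∀ u : Hl N, (inner ℂ (Hl.diag (fun k => m k) (B ^ 2) hm
      (smoothing N (-2) (by norm_num) u)) u).re = ∑' k, (φ (bracket k) * ‖coeff s u k‖) ^ 2 :=
    fun u => by
      refine (Complex.hasSum_re (Hl.hasSum_inner _ _)).unique
        (hasSum_of_eq (hs2 u).hasSum (fun k => ?_) rfl)
      have e : (bracket k ^ (2 - 2 * s)) * (bracket k ^ (-2 : ℝ)) * (bracket k ^ s) *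
          (bracket k ^ s) = 1 := by
        simp only [← Real.rpow_add (bracket_pos k)]
        ring_nf
        simp
      rw [Hl.diag_apply, smoothing_apply, hx_eq u k]
      simp only [m, map_mul, Complex.conj_ofReal]
      rw [mul_pow, ← Complex.normSq_eq_norm_sq, ← Complex.ofReal_re (_ * Complex.normSq (coeff s u k))]
      congr 1
      rw [Complex.ofReal_mul _ (Complex.normSq (coeff s u k)), Complex.normSq_eq_conj_mul_self]
      calc _ = ((φ (bracket k) ^ 2 * ((bracket k ^ (2 - 2 * s)) * (bracket k ^ (-2 : ℝ)) *
            (bracket k ^ s) * (bracket k ^ s)) : ℝ) : ℂ) *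
            (conj (coeff s u k) * coeff s u k) := by push_cast; ring
        _ = _ := by rw [e, mul_one]
  have key := gronwall_le (E := fun τ => ∑' k, (φ (bracket k) * ‖coeff s (x τ) k‖) ^ 2)
    (D := fun τ => 2 * (inner ℂ (Hl.diag (fun k => m k) (B ^ 2) hm (field α hs S (x τ)))
      (x τ)).re) (T := T) (K := energyConst α s * R) (η := 0) le_rfl
    (mul_nonneg energyConst_nonneg ((norm_nonneg _).trans (hR t ht)))
    (fun τ hτ => by
      have := energy_hasDerivWithinAt (hx.cont τ hτ) (hx.deriv τ hτ) m (B ^ 2) hm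
      simpa only [hE] using this)
    (fun τ hτ => by
      have hQ : HasSum (fun k => conj ((φ (bracket k) ^ 2 : ℝ) *
          (S.indicator (nonlin α s (x τ)) k + Complex.I * disp α k * coeff s (x τ) k)) *
            coeff s (x τ) k)
          (inner ℂ (Hl.diag (fun k => m k) (B ^ 2) hm (field α hs S (x τ))) (x τ)) := by
        refine hasSum_of_eq (Hl.hasSum_inner _ _) (fun k => ?_) rfl
        have e : bracket k ^ (2 - 2 * s) * bracket k ^ (s - 2) * bracket k ^ s = 1 := by
          simp only [← Real.rpow_add (bracket_pos k)]
          ring_nf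
          simp
        rw [Hl.diag_apply, field_apply, hx_eq (x τ) k]
        simp only [m, map_mul, Complex.conj_ofReal]
        set V := conj (S.indicator (nonlin α s (x τ)) k + Complex.I * disp α k * coeff s (x τ) k)
        symm
        calc _ = ((φ (bracket k) ^ 2 * (bracket k ^ (2 - 2 * s) * bracket k ^ (s - 2) *
              bracket k ^ s) : ℝ) : ℂ) * V * coeff s (x τ) k := by push_cast; ring
          _ = _ := by rw [e, mul_one]
      have h := re_energy_le hs hφ (hx.real τ hτ) (hx.supp τ hτ) (hs2 _) (hs3 _) hQ
      have h' := (le_abs_self _).trans h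
      have h0 : 0 ≤ ∑' k, (φ (bracket k) * ‖coeff s (x τ) k‖) ^ 2 := tsum_nonneg fun _ => sq_nonneg _
      have h4 : energyConst α s * ‖x τ‖ * ∑' k, (φ (bracket k) * ‖coeff s (x τ) k‖) ^ 2 ≤
          energyConst α s * R * ∑' k, (φ (bracket k) * ‖coeff s (x τ) k‖) ^ 2 := by
        have := energyConst_nonneg (α := α) (s := s)
        gcongr
        exact hR τ hτ
      rw [add_zero]
      refine le_trans ?_ h4
      unfold energyConst
      linarith)
    ht
  simpa using key

end QPBO

namespace QPBO

open ComplexConjugate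

variable {N : ℕ} {α : Fin N → ℝ} {s : ℝ}

/-! ### High frequencies -/

/-- The multiplier `min (1, ⟨k⟩ / L)`, which suppresses frequencies much lower than `L`. -/
noncomputable def high (N : ℕ) (L : ℝ) (hL : 0 < L) : Hl N →L[ℂ] Hl N :=
  Hl.diag (fun k => (min 1 (bracket k / L) : ℝ)) 1 fun k => by
    have := bracket_nonneg k
    rw [Complex.norm_real, Real.norm_eq_abs, abs_of_nonneg (by positivity)]
    exact min_le_left _ _

lemma norm_high_apply {L : ℝ} (hL : 0 < L) (x : Hl N) (k : Fin N → ℤ) :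
    ‖high N L hL x k‖ = min 1 (bracket k / L) * ‖x k‖ := by
  have := bracket_nonneg k
  rw [high, Hl.diag_apply, norm_mul, Complex.norm_real, Real.norm_eq_abs,
    abs_of_nonneg (by positivity)]

lemma norm_high_le {L : ℝ} (hL : 0 < L) (x : Hl N) : ‖high N L hL x‖ ≤ ‖x‖ :=
  (Hl.norm_diag_apply_le _ _ _ x).trans_eq (one_mul _)

/-- Dominated convergence as L → ∞. -/
lemma exists_high_lt (x : Hl N) {ε : ℝ} (hε : 0 < ε) :
    ∃ (L : ℝ) (hL : 0 < L), 1 ≤ L ∧ ‖high N L hL x‖ < ε := by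
  have h : Tendsto (fun L : ℝ => ∑' k, (min 1 (bracket k / L) * ‖x k‖) ^ 2) atTop
      (𝓝 (∑' k : Fin N → ℤ, 0)) := by
    refine tendsto_tsum_of_dominated_convergence (Hl.summable_norm_sq x) (fun k => ?_) ?_
    · have h1 : Tendsto (fun L : ℝ => min 1 (bracket k / L)) atTop (𝓝 (min 1 0)) :=
        tendsto_const_nhds.min (tendsto_const_nhds.div_atTop tendsto_id)
      have h2 := (h1.mul_const ‖x k‖).pow 2
      simpa using h2
    · filter_upwards [eventually_gt_atTop 0] with L hL k
      have := bracket_nonneg k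
      rw [Real.norm_eq_abs, abs_of_nonneg (sq_nonneg _)]
      refine pow_le_pow_left₀ (by positivity) ?_ 2
      exact mul_le_of_le_one_left (norm_nonneg _) (min_le_left _ _)
  rw [tsum_zero] at h
  obtain ⟨L, h1, h2⟩ := ((h.eventually_lt_const (by positivity : 0 < ε ^ 2)).and
    (eventually_ge_atTop 1)).exists
  have hL : 0 < L := by linarith
  refine ⟨L, hL, h2, lt_of_pow_lt_pow_left₀ 2 hε.le ?_⟩
  rw [Hl.norm_sq_eq]
  simpa only [norm_high_apply] using h1

/-- At each frequency one term suffices: for ⟨k⟩ ≥ L the multiplier `high` is 1, and for ⟨k⟩ ≤ L one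
has L^s ⟨k⟩^(-s) ≥ 1. -/
lemma norm_le_low_add_high {L : ℝ} (hL : 1 ≤ L) (hs : 0 ≤ s) (w : Hl N) :
    ‖w‖ ≤ L ^ s * ‖smoothing N (-s) (by linarith) w‖ +
      ‖high N L (by linarith) w‖ := by
  have hL0 : 0 < L := by linarith
  have hLs : 0 < L ^ s := Real.rpow_pos_of_pos hL0 s
  refine le_of_sq_le_sq ?_ (by positivity)
  have h1 := (Hl.hasSum_norm_sq (smoothing N (-s) (by linarith) w)).mul_left ((L ^ s) ^ 2)
  have h2 := Hl.hasSum_norm_sq (high N L hL0 w)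
  have h3 := hasSum_le (fun k => ?_) (Hl.hasSum_norm_sq w) (h1.add h2)
  · refine h3.trans ?_
    have := mul_nonneg (mul_nonneg hLs.le (norm_nonneg (smoothing N (-s) (by linarith) w)))
      (norm_nonneg (high N L hL0 w))
    nlinarith
  · rw [norm_high_apply, smoothing_apply, norm_mul, norm_bracket_rpow]
    rcases le_total L (bracket k) with h | h
    · rw [min_eq_left ((one_le_div hL0).2 h), one_mul]
      nlinarith [sq_nonneg (L ^ s), sq_nonneg (bracket k ^ (-s) * ‖w k‖),
        mul_nonneg (sq_nonneg (L ^ s)) (sq_nonneg (bracket k ^ (-s) * ‖w k‖))]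
    · have h4 : 1 ≤ L ^ s * bracket k ^ (-s) := by
        have := Real.rpow_le_rpow (bracket_nonneg k) h hs
        rw [Real.rpow_neg (bracket_nonneg k), ← div_eq_mul_inv,
          one_le_div (bracket_rpow_pos k s)]
        exact this
      have h5 : ‖w k‖ ≤ L ^ s * bracket k ^ (-s) * ‖w k‖ := le_mul_of_one_le_left (norm_nonneg _) h4
      have h6 := pow_le_pow_left₀ (norm_nonneg _) h5 2
      nlinarith [sq_nonneg (min 1 (bracket k / L) * ‖w k‖)]

/-- Persistence of the tail: no frequency mass can escape to infinity faster than the Grönwall rate,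
which does not depend on L. This is what upgrades L² convergence to H^s. -/
lemma Sol.high_le {hs : (N : ℝ) / 2 + 1 < s} {S : Set (Fin N → ℤ)} {T R : ℝ} {x : ℝ → Hl N}
    (hx : Sol α hs S T x) (hR : ∀ t ∈ Set.Icc 0 T, ‖x t‖ ≤ R) {L : ℝ} (hL : 0 < L) {t : ℝ}
    (ht : t ∈ Set.Icc 0 T) :
    ‖high N L hL (x t)‖ ≤ Real.exp (energyConst α s * R * t) * ‖high N L hL (x 0)‖ := by
  have hs1 : 0 ≤ s - 1 := by have := half_le_dim (N := N); linarith
  have h1exp : 1 ≤ Real.exp (energyConst α s * R * t) :=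
    Real.one_le_exp (mul_nonneg (mul_nonneg energyConst_nonneg
      ((norm_nonneg _).trans (hR t ht))) ht.1)
  suffices h : ‖high N L hL (x t)‖ ^ 2 ≤
      ‖high N L hL (x 0)‖ ^ 2 * Real.exp (energyConst α s * R * t) by
    refine le_of_sq_le_sq (h.trans ?_) (by positivity)
    rw [mul_pow, mul_comm]
    refine mul_le_mul_of_nonneg_right ?_ (sq_nonneg _)
    nlinarith
  rw [Hl.norm_sq_eq (high N L hL (x t))]
  refine (Hl.summable_norm_sq _).tsum_le_of_sum_le fun F => ?_
  -- The weight r^(s-1) min(1, r/L) min(r, M) has order s - 1 and is thus admissible, but on the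
  -- finite set F, where ⟨k⟩ ≤ M, it coincides with r^s min(1, r/L). Its growth exponent ⌈s⌉ + 1 + 1
  -- depends on neither L nor M.
  set M : ℝ := 1 + ∑ k ∈ F, bracket k
  have hM0 : 0 < M := by
    have : 0 ≤ ∑ k ∈ F, bracket k := Finset.sum_nonneg fun k _ => bracket_nonneg k
    linarith
  have hMF : ∀ k ∈ F, bracket k ≤ M := fun k hk => by
    have := Finset.single_le_sum (f := fun k : Fin N → ℤ => bracket k)
      (fun i _ => bracket_nonneg i) hk
    linarith
  have hφ : IsWeight (⌈s⌉₊ + 2) fun r => r ^ (s - 1) * min 1 (r / L) * min r M :=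
    ((isWeight_rpow hs1 (by linarith [Nat.le_ceil s])).mul (isWeight_min_div hL)).mul
      (isWeight_min hM0)
  have hφB : ∀ k : Fin N → ℤ, bracket k ^ (s - 1) * min 1 (bracket k / L) * min (bracket k) M ≤
      M * bracket k ^ (s - 1) := fun k => by
    have h0 := bracket_rpow_pos k (s - 1)
    have h1 := bracket_pos k
    calc _ ≤ bracket k ^ (s - 1) * 1 * M := by
          gcongr
          · exact min_le_left _ _
          · exact min_le_right _ _
      _ = _ := by ring
  obtain ⟨h1, h2⟩ := hx.weighted_le hR hφ hφB ht
  have hle : ∀ (u : Hl N) k, bracket k ^ (s - 1) * min 1 (bracket k / L) * min (bracket k) M *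
      ‖coeff s u k‖ = min 1 (bracket k / L) * (min (bracket k) M / bracket k) * ‖u k‖ :=
    fun u k => by
      have := bracket_rpow_mul_norm_coeff s (s - 1) u k
      rw [show s - 1 - s = (-1 : ℝ) by ring, Real.rpow_neg_one] at this
      calc _ = min 1 (bracket k / L) * min (bracket k) M *
            (bracket k ^ (s - 1) * ‖coeff s u k‖) := by ring
        _ = _ := by rw [this]; ring
  simp only [hle] at h1 h2
  have h3 : ∑ k ∈ F, ‖high N L hL (x t) k‖ ^ 2 =
      ∑ k ∈ F, (min 1 (bracket k / L) * (min (bracket k) M / bracket k) * ‖x t k‖) ^ 2 :=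
    Finset.sum_congr rfl fun k hk => by
      rw [norm_high_apply, min_eq_left (hMF k hk), div_self (bracket_pos k).ne', mul_one]
  rw [h3]
  refine (h1.sum_le_tsum F fun _ _ => sq_nonneg _).trans (h2.trans ?_)
  refine mul_le_mul_of_nonneg_right ?_ (Real.exp_pos _).le
  rw [Hl.norm_sq_eq]
  have hpt : ∀ k, (min 1 (bracket k / L) * (min (bracket k) M / bracket k) * ‖x 0 k‖) ^ 2 ≤
      ‖high N L hL (x 0) k‖ ^ 2 := fun k => by
    have h1 := bracket_pos k
    rw [norm_high_apply]
    refine pow_le_pow_left₀ (by positivity) ?_ 2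
    refine mul_le_mul_of_nonneg_right ?_ (norm_nonneg _)
    exact mul_le_of_le_one_right (by positivity) ((div_le_one h1).2 (min_le_left _ _))
  exact (Summable.of_nonneg_of_le (fun _ => sq_nonneg _) hpt
    (Hl.summable_norm_sq _)).tsum_le_tsum hpt (Hl.summable_norm_sq _)

/-! ### Differences of solutions -/

/-- The constant in the estimate of differences. -/
noncomputable def diffConst (α : Fin N → ℝ) (s : ℝ) : ℝ := 4 * freqConst α * embedConst N s

lemma diffConst_nonneg : 0 ≤ diffConst α s :=
  mul_nonneg (mul_nonneg (by norm_num) (freqConst_nonneg α)) embedConst_nonneg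

lemma nonlin_sub (hs : (N : ℝ) / 2 + 1 < s) (x y : Hl N) (k : Fin N → ℤ) :
    nonlin α s x k - nonlin α s y k = conv (coeff s x) (derivCoeff α (coeff s (x - y))) k +
      conv (coeff s (x - y)) (derivCoeff α (coeff s y)) k := by
  have h := congrArg (fun z : Hl N => z k) (product_sub (α := α) hs x y)
  simp only [Hl.sub_apply, Hl.add_apply, product_apply, ← mul_add, ← mul_sub] at h
  exact mul_left_cancel₀ (Complex.ofReal_ne_zero.2 (bracket_rpow_pos k (s - 1)).ne') h

lemma norm_nonlin (hs : (N : ℝ) / 2 + 1 < s) (x : Hl N) (k : Fin N → ℤ) :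
    ‖nonlin α s x k‖ = bracket k ^ (1 - s) * ‖product α hs x x k‖ := by
  rw [product_apply, norm_mul, norm_bracket_rpow, ← mul_assoc, ← Real.rpow_add (bracket_pos k)]
  ring_nf
  simp [nonlin]

lemma re_difference_le (hs : (N : ℝ) / 2 + 1 < s) {S S' : Set (Fin N → ℤ)} (hSS : S' ⊆ S)
    {ε R : ℝ} (hε0 : 0 ≤ ε) (hε : ∀ k ∈ S, k ∉ S' → bracket k ^ (1 - s) ≤ ε) {x y : Hl N}
    (hx : ∀ k, x (-k) = conj (x k)) (hxS : ∀ k, k ∉ S → x k = 0) (hyS : ∀ k, k ∉ S' → y k = 0)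
    (hxR : ‖x‖ ≤ R) (hyR : ‖y‖ ≤ R) {Q : ℂ}
    (hQ : HasSum (fun k => conj (S.indicator (nonlin α s x) k - S'.indicator (nonlin α s y) k +
      Complex.I * disp α k * coeff s (x - y) k) * coeff s (x - y) k) Q) :
    2 * Q.re ≤ (diffConst α s * R + 1) * ∑' k, ‖coeff s (x - y) k‖ ^ 2 +
      (ε * prodConst α s * R ^ 2) ^ 2 := by
  have hs0 : -s ≤ 0 := by have := half_le_dim (N := N); linarith
  obtain ⟨h1, h1'⟩ := embedding hs x
  obtain ⟨h2, h2'⟩ := embedding hs y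
  have hw : Summable fun k => ‖coeff s (x - y) k‖ ^ 2 :=
    Hl.summable_norm_sq (smoothing N (-s) hs0 (x - y))
  have hw1 := summable_sq_of_nonneg (embedding hs (x - y)).1
    fun k => mul_nonneg (bracket_nonneg k) (norm_nonneg _)
  obtain ⟨Z, hZ, hZ'⟩ := difference_bound (α := α) (coeff_neg_eq_conj hx) h1 h2 hw hw1
  set w := coeff s (x - y)
  -- The part of the nonlinearity of y lost by the smaller truncation. The product estimate in
  -- H^(s-1) makes it O(ε) in L², since ⟨k⟩^(1-s) ≤ ε there.
  set r : (Fin N → ℤ) → ℂ := (S \ S').indicator (nonlin α s y)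
  have hr : ∀ k, ‖r k‖ ^ 2 ≤ ε ^ 2 * ‖product α hs y y k‖ ^ 2 := fun k => by
    by_cases hk : k ∈ S \ S'
    · rw [show r k = nonlin α s y k from Set.indicator_of_mem hk _, norm_nonlin hs, ← mul_pow]
      have := (bracket_rpow_pos k (1 - s)).le
      exact pow_le_pow_left₀ (by positivity)
        (mul_le_mul_of_nonneg_right (hε k hk.1 hk.2) (norm_nonneg _)) 2
    · rw [show r k = 0 from Set.indicator_of_notMem hk _]; simp; positivity
  have hrs := Summable.of_nonneg_of_le (fun k => sq_nonneg _) hr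
    ((Hl.summable_norm_sq (product α hs y y)).mul_left _)
  have hrt : ∑' k, ‖r k‖ ^ 2 ≤ (ε * prodConst α s * R ^ 2) ^ 2 := by
    refine (hrs.tsum_le_tsum hr ((Hl.summable_norm_sq _).mul_left _)).trans ?_
    rw [tsum_mul_left, ← Hl.norm_sq_eq, ← mul_pow]
    refine pow_le_pow_left₀ (by positivity) ?_ 2
    rw [mul_assoc]
    refine mul_le_mul_of_nonneg_left ((norm_product_le hs y y).trans ?_) hε0
    have := prodConst_nonneg (α := α) (s := s)
    have hR0 : 0 ≤ R := (norm_nonneg _).trans hxR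
    rw [mul_assoc, sq]
    gcongr
  have hb : ∀ k, ‖(conj (r k) * w k).re‖ ≤ (‖r k‖ ^ 2 + ‖w k‖ ^ 2) / 2 := fun k => by
    refine (Complex.abs_re_le_norm _).trans ?_
    rw [norm_mul, RCLike.norm_conj]
    nlinarith [sq_nonneg (‖r k‖ - ‖w k‖)]
  have hbs := (hrs.add hw).div_const 2
  have hP := Summable.of_norm_bounded hbs hb
  have hP' := (le_abs_self _).trans (tsum_of_norm_bounded hbs.hasSum hb)
  rw [tsum_div_const, hrs.tsum_add hw] at hP'
  have e : Q.re = Z.re + ∑' k, (conj (r k) * w k).re := by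
    refine (Complex.hasSum_re hQ).unique
      (hasSum_of_eq ((Complex.hasSum_re hZ).add hP.hasSum) (fun k => ?_) rfl)
    by_cases hk : k ∈ S
    · have hd : S.indicator (nonlin α s x) k - S'.indicator (nonlin α s y) k =
          conv (coeff s x) (derivCoeff α w) k + conv w (derivCoeff α (coeff s y)) k + r k := by
        rw [← nonlin_sub hs, Set.indicator_of_mem hk]
        by_cases hk' : k ∈ S'
        · have : k ∉ S \ S' := fun h => h.2 hk'
          simp [r, hk', this]
        · have : k ∈ S \ S' := ⟨hk, hk'⟩
          simp [r, hk', this]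
      rw [hd]
      simp only [map_mul, map_add, Complex.conj_ofReal, Complex.conj_I, Complex.mul_re,
        Complex.mul_im, Complex.add_re, Complex.add_im, Complex.conj_re, Complex.conj_im,
        Complex.ofReal_re, Complex.ofReal_im, Complex.neg_re, Complex.neg_im, Complex.I_re,
        Complex.I_im]
      ring
    · have : w k = 0 := by simp [w, coeff, hxS k hk, hyS k fun h => hk (hSS h)]
      simp [this]
  have hw0 : 0 ≤ ∑' k, ‖w k‖ ^ 2 := tsum_nonneg fun _ => sq_nonneg _
  have hA := freqConst_nonneg α
  have hE := embedConst_nonneg (N := N) (s := s)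
  have h3 : Z.re ≤ freqConst α * (embedConst N s * R + embedConst N s * R) *
      ∑' k, ‖w k‖ ^ 2 := by
    refine (le_abs_self _).trans (hZ'.trans ?_)
    have h4 := h1'.trans (mul_le_mul_of_nonneg_left hxR hE)
    have h5 := h2'.trans (mul_le_mul_of_nonneg_left hyR hE)
    gcongr
  rw [e]
  unfold diffConst
  linarith

/-- Stability in `L²` of solutions of the truncated equations. -/
lemma Sol.difference_le {hs : (N : ℝ) / 2 + 1 < s} (hs0 : -s ≤ 0) {S S' : Set (Fin N → ℤ)}
    (hSS : S' ⊆ S) {ε R T : ℝ} (hε0 : 0 ≤ ε) (hε : ∀ k ∈ S, k ∉ S' → bracket k ^ (1 - s) ≤ ε)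
    {x y : ℝ → Hl N} (hx : Sol α hs S T x) (hy : Sol α hs S' T y)
    (hxR : ∀ t ∈ Set.Icc 0 T, ‖x t‖ ≤ R) (hyR : ∀ t ∈ Set.Icc 0 T, ‖y t‖ ≤ R) {t : ℝ}
    (ht : t ∈ Set.Icc 0 T) :
    ‖smoothing N (-s) hs0 (x t - y t)‖ ^ 2 ≤ (‖smoothing N (-s) hs0 (x 0 - y 0)‖ ^ 2 +
      (ε * prodConst α s * R ^ 2) ^ 2 * t) * Real.exp ((diffConst α s * R + 1) * t) := by
  -- Together with the smoothing by ⟨k⟩^(-2) this multiplier is ⟨k⟩^(-2s), so the energy is the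
  -- squared L² norm of the difference.
  have hm : ∀ k : Fin N → ℤ, ‖((bracket k ^ (2 - 2 * s) : ℝ) : ℂ)‖ ≤ 1 := fun k => by
    rw [norm_bracket_rpow]
    exact bracket_rpow_le_one (by have := half_le_dim (N := N); linarith) k
  have hu : ∀ (u : Hl N) k, u k = (bracket k ^ s : ℝ) * coeff s u k := fun u k => by
    rw [coeff, ← mul_assoc, ← Complex.ofReal_mul, ← Real.rpow_add (bracket_pos k)]; simp
  have hE : ∀ u : Hl N, (inner ℂ (Hl.diag (fun k => (bracket k ^ (2 - 2 * s) : ℝ)) 1 hm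
      (smoothing N (-2) (by norm_num) u)) u).re = ‖smoothing N (-s) hs0 u‖ ^ 2 := fun u => by
    refine (Complex.hasSum_re (Hl.hasSum_inner _ _)).unique
      (hasSum_of_eq (Hl.hasSum_norm_sq _) (fun k => ?_) rfl)
    have e : (bracket k ^ (2 - 2 * s)) * (bracket k ^ (-2 : ℝ)) =
        bracket k ^ (-s) * bracket k ^ (-s) := by
      simp only [← Real.rpow_add (bracket_pos k)]
      ring_nf
    rw [Hl.diag_apply, smoothing_apply, smoothing_apply, ← mul_assoc, ← Complex.ofReal_mul, e,
      ← Complex.normSq_eq_norm_sq, ← Complex.ofReal_re (Complex.normSq _)]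
    congr 1
    rw [Complex.normSq_eq_conj_mul_self]
    simp only [map_mul, Complex.conj_ofReal, Complex.ofReal_mul]
    ring
  refine gronwall_le (E := fun τ => ‖smoothing N (-s) hs0 (x τ - y τ)‖ ^ 2)
    (D := fun τ => 2 * (inner ℂ (Hl.diag (fun k => (bracket k ^ (2 - 2 * s) : ℝ)) 1 hm
      (field α hs S (x τ) - field α hs S' (y τ))) (x τ - y τ)).re) (sq_nonneg _)
    (add_nonneg (mul_nonneg diffConst_nonneg ((norm_nonneg _).trans (hxR t ht))) zero_le_one)
    (fun τ hτ => ?_) (fun τ hτ => ?_) ht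
  · have h1 : HasDerivWithinAt (fun τ => smoothing N (-2) (by norm_num) (x τ - y τ))
        (field α hs S (x τ) - field α hs S' (y τ)) (Set.Icc 0 T) τ := by
      simpa only [map_sub] using! (hx.deriv τ hτ).sub (hy.deriv τ hτ)
    have := energy_hasDerivWithinAt ((hx.cont τ hτ).sub (hy.cont τ hτ)) h1 _ 1 hm
    simpa only [hE] using! this
  · have e0 : ‖smoothing N (-s) hs0 (x τ - y τ)‖ ^ 2 = ∑' k, ‖coeff s (x τ - y τ) k‖ ^ 2 :=
      Hl.norm_sq_eq _
    simp only [e0]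
    refine re_difference_le hs hSS hε0 hε (hx.real τ hτ) (hx.supp τ hτ) (hy.supp τ hτ) (hxR τ hτ)
      (hyR τ hτ) (hasSum_of_eq (Hl.hasSum_inner _ _) (fun k => ?_) rfl)
    have e : bracket k ^ (2 - 2 * s) * bracket k ^ (s - 2) * bracket k ^ s = 1 := by
      simp only [← Real.rpow_add (bracket_pos k)]
      ring_nf
      simp
    rw [Hl.diag_apply, Hl.sub_apply, field_apply, field_apply, hu (x τ - y τ) k]
    simp only [coeff_sub, Pi.sub_apply]
    rw [← mul_sub]
    simp only [map_mul, Complex.conj_ofReal]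
    set a := S.indicator (nonlin α s (x τ)) k
    set b := S'.indicator (nonlin α s (y τ)) k
    set c := coeff s (x τ) k
    set d := coeff s (y τ) k
    symm
    calc _ = ((bracket k ^ (2 - 2 * s) * bracket k ^ (s - 2) * bracket k ^ s : ℝ) : ℂ) *
          conj (a + Complex.I * disp α k * c - (b + Complex.I * disp α k * d)) * (c - d) := by
          push_cast; ring
      _ = conj (a + Complex.I * disp α k * c - (b + Complex.I * disp α k * d)) * (c - d) := by
          rw [e]; simp
      _ = _ := by congr 2; ring

end QPBO

namespace QPBO

open ComplexConjugate

/-! ### Ordinary differential equations with a cutoff -/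

/-- The cutoff equal to `1` on `[0, R]` and to `0` on `[R + 1, ∞)`. -/
noncomputable def cutoff (R a : ℝ) : ℝ := max 0 (min 1 (R + 1 - a))

lemma cutoff_nonneg (R a : ℝ) : 0 ≤ cutoff R a := le_max_left _ _

lemma cutoff_le_one (R a : ℝ) : cutoff R a ≤ 1 := max_le zero_le_one (min_le_left _ _)

lemma cutoff_eq_one {R a : ℝ} (h : a ≤ R) : cutoff R a = 1 := by
  rw [cutoff, min_eq_left (by linarith), max_eq_right zero_le_one]

lemma cutoff_eq_zero {R a : ℝ} (h : R + 1 ≤ a) : cutoff R a = 0 := by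
  rw [cutoff, max_eq_left]
  exact (min_le_right _ _).trans (by linarith)

lemma abs_cutoff_sub_le (R a b : ℝ) : |cutoff R a - cutoff R b| ≤ |a - b| := by
  have h1 : |cutoff R a - cutoff R b| ≤ |min 1 (R + 1 - a) - min 1 (R + 1 - b)| := by
    have := abs_max_sub_max_le_abs (min 1 (R + 1 - a)) (min 1 (R + 1 - b)) 0
    rwa [max_comm, max_comm (min 1 (R + 1 - b))] at this
  have h2 := abs_min_sub_min_le_max 1 (R + 1 - a) 1 (R + 1 - b)
  refine h1.trans (h2.trans ?_)
  rw [sub_self, abs_zero, max_eq_right (abs_nonneg _), abs_sub_comm]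
  ring_nf
  exact le_rfl

/-- A quadratic field could blow up before T. Cutting it off in norm makes it globally bounded by M,
so Picard–Lindelöf on the ball of radius MT reaches T in one step. An a priori bound removes the
cutoff later. -/
lemma exists_cutoff_solution {E : Type*} [NormedAddCommGroup E] [NormedSpace ℝ E] [CompleteSpace E]
    {F : E → E} {a b : ℝ} (ha : 0 ≤ a) (hb : 0 ≤ b) (hF0 : F 0 = 0)
    (hF : ∀ x y, ‖F x - F y‖ ≤ (a * (‖x‖ + ‖y‖) + b) * ‖x - y‖) {R T : ℝ} (hR : 0 ≤ R)
    (hT : 0 ≤ T) (x₀ : E) :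
    ∃ x : ℝ → E, x 0 = x₀ ∧ ∀ t ∈ Set.Icc 0 T,
      HasDerivWithinAt x (cutoff R ‖x t‖ • F (x t)) (Set.Icc 0 T) t := by
  have hFn : ∀ x, ‖F x‖ ≤ (a * ‖x‖ + b) * ‖x‖ := fun x => by
    simpa [hF0] using hF x 0
  set M : ℝ := (a * (R + 1) + b) * (R + 1)
  have hM : 0 ≤ M := by positivity
  have hbound : ∀ x, ‖cutoff R ‖x‖ • F x‖ ≤ M := fun x => by
    rcases le_total (R + 1) ‖x‖ with h | h
    · rw [cutoff_eq_zero h, zero_smul, norm_zero]; exact hM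
    · rw [norm_smul, Real.norm_eq_abs, abs_of_nonneg (cutoff_nonneg _ _)]
      calc cutoff R ‖x‖ * ‖F x‖ ≤ 1 * ((a * ‖x‖ + b) * ‖x‖) := by
            gcongr
            · exact cutoff_le_one _ _
            · exact hFn x
        _ ≤ (a * (R + 1) + b) * (R + 1) := by rw [one_mul]; gcongr
  set ρ : ℝ := ‖x₀‖ + M * T
  have hρ : 0 ≤ ρ := by positivity
  set K : ℝ := (a * (ρ + ρ) + b) + (a * ρ + b) * ρ
  have hK : 0 ≤ K := by positivity
  have hlip : ∀ x y, ‖x‖ ≤ ρ → ‖y‖ ≤ ρ →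
      ‖cutoff R ‖x‖ • F x - cutoff R ‖y‖ • F y‖ ≤ K * ‖x - y‖ := fun x y hx hy => by
    have e : cutoff R ‖x‖ • F x - cutoff R ‖y‖ • F y =
        cutoff R ‖x‖ • (F x - F y) + (cutoff R ‖x‖ - cutoff R ‖y‖) • F y := by
      rw [smul_sub, sub_smul]; abel
    rw [e]
    refine (norm_add_le _ _).trans ?_
    rw [norm_smul, norm_smul, Real.norm_eq_abs, Real.norm_eq_abs,
      abs_of_nonneg (cutoff_nonneg _ _)]
    have h1 : |cutoff R ‖x‖ - cutoff R ‖y‖| ≤ ‖x - y‖ :=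
      (abs_cutoff_sub_le _ _ _).trans (abs_norm_sub_norm_le x y)
    calc cutoff R ‖x‖ * ‖F x - F y‖ + |cutoff R ‖x‖ - cutoff R ‖y‖| * ‖F y‖
        ≤ 1 * ((a * (‖x‖ + ‖y‖) + b) * ‖x - y‖) + ‖x - y‖ * ((a * ‖y‖ + b) * ‖y‖) := by
          gcongr
          · exact cutoff_le_one _ _
          · exact hF x y
          · exact hFn y
      _ ≤ 1 * ((a * (ρ + ρ) + b) * ‖x - y‖) + ‖x - y‖ * ((a * ρ + b) * ρ) := by gcongr
      _ = K * ‖x - y‖ := by ring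
  have hmem : ∀ x ∈ Metric.closedBall x₀ (M * T), ‖x‖ ≤ ρ := fun x hx => by
    rw [mem_closedBall_iff_norm] at hx
    have := norm_add_le x₀ (x - x₀)
    rw [add_sub_cancel] at this
    linarith
  have hPL : IsPicardLindelof (fun _ : ℝ => fun x : E => cutoff R ‖x‖ • F x)
      (⟨0, le_rfl, hT⟩ : Set.Icc (0 : ℝ) T) x₀ ⟨M * T, by positivity⟩ 0 ⟨M, hM⟩ ⟨K, hK⟩ := by
    refine ⟨fun t _ => ?_, fun x _ => continuousOn_const, fun t _ x _ => hbound x, ?_⟩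
    · refine LipschitzOnWith.of_dist_le_mul fun x hx y hy => ?_
      rw [dist_eq_norm, dist_eq_norm]
      exact hlip x y (hmem x hx) (hmem y hy)
    · simp only [sub_zero, max_eq_left hT, NNReal.coe_zero, sub_self]
      exact le_rfl
  exact hPL.exists_eq_forall_mem_Icc_hasDerivWithinAt₀

/-- Comparison with the Riccati equation y' = Ky² for y = 1 + E: the function 1/y + Kt is
nondecreasing, so y at most doubles while 2Kt y(0) ≤ 1. -/
lemma one_add_le_of_deriv_le {E D : ℝ → ℝ} {T K : ℝ} (hE0 : ∀ t ∈ Set.Icc 0 T, 0 ≤ E t)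
    (hE : ∀ t ∈ Set.Icc 0 T, HasDerivWithinAt E (D t) (Set.Icc 0 T) t)
    (hD : ∀ t ∈ Set.Icc 0 T, D t ≤ K * (1 + E t) ^ 2) {t : ℝ} (ht : t ∈ Set.Icc 0 T)
    (hK : 2 * K * t * (1 + E 0) ≤ 1) : 1 + E t ≤ 2 * (1 + E 0) := by
  have hg : ∀ τ ∈ Set.Icc 0 T, HasDerivWithinAt (fun τ => (1 + E τ)⁻¹ + K * τ)
      (-(D τ) / (1 + E τ) ^ 2 + K * 1) (Set.Icc 0 T) τ := fun τ hτ =>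
    (((hE τ hτ).const_add 1).inv (by linarith [hE0 τ hτ])).add
      ((hasDerivWithinAt_id τ _).const_mul K)
  have hmono : MonotoneOn (fun τ => (1 + E τ)⁻¹ + K * τ) (Set.Icc 0 T) := by
    refine monotoneOn_of_hasDerivWithinAt_nonneg (convex_Icc 0 T)
      (fun τ hτ => (hg τ hτ).continuousWithinAt)
      (fun τ hτ => (hg τ (interior_subset hτ)).mono interior_subset) fun τ hτ => ?_
    have hτ := interior_subset hτ
    have h1 := hE0 τ hτ
    have h2 : D τ / (1 + E τ) ^ 2 ≤ K := by
      rw [div_le_iff₀ (by positivity)]; exact hD τ hτ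
    rw [neg_div]; linarith
  have h0 : (0 : ℝ) ∈ Set.Icc 0 T := ⟨le_rfl, ht.1.trans ht.2⟩
  have h := hmono h0 ht ht.1
  simp only [mul_zero, add_zero] at h
  have p0 : 0 < 1 + E 0 := by linarith [hE0 0 h0]
  have pt : 0 < 1 + E t := by linarith [hE0 t ht]
  have h3 : K * t ≤ (1 + E 0)⁻¹ / 2 := by
    rw [inv_eq_one_div, div_div, le_div_iff₀ (by positivity)]; linarith
  have h4 : (2 * (1 + E 0))⁻¹ ≤ (1 + E t)⁻¹ := by
    rw [mul_inv]; linarith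
  exact (inv_le_inv₀ (by positivity) pt).1 h4

/-! ### Solutions of the truncated equations -/

variable {N : ℕ} {α : Fin N → ℝ} {s : ℝ}

/-- The map `c ↦ conj (c (-·))`, whose fixed points correspond to real functions. -/
noncomputable def reflect (N : ℕ) : Hl N →L[ℝ] Hl N :=
  LinearMap.mkContinuous
    { toFun := fun x => Hl.mk (fun k => conj (x (-k))) (by
        refine ((Equiv.neg (Fin N → ℤ)).summable_iff.2 (Hl.summable_norm_sq x)).congr fun k => ?_
        simp)
      map_add' := fun x y => by ext k; simp
      map_smul' := fun a x => by ext k; simp } 1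
    fun x => by
      rw [one_mul]
      refine Hl.norm_le_of_sq_le (norm_nonneg _) (fun _ => le_rfl) ?_ ?_
      · exact Hl.summable_norm_sq _
      · rw [Hl.norm_sq_eq x, ← (Equiv.neg (Fin N → ℤ)).tsum_eq]
        simp

lemma norm_reflect_le (x : Hl N) : ‖reflect N x‖ ≤ ‖x‖ := by
  have := (LinearMap.mkContinuous_norm_le _ zero_le_one _ : ‖reflect N‖ ≤ 1)
  exact ((reflect N).le_of_opNorm_le this x).trans_eq (one_mul _)

/-- The projection to the real families supported in `S`. -/
noncomputable def realProj (S : Set (Fin N → ℤ)) : Hl N →L[ℝ] Hl N :=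
  ((proj S).restrictScalars ℝ).comp ((1 / 2 : ℝ) • (ContinuousLinearMap.id ℝ (Hl N) + reflect N))

lemma realProj_apply (S : Set (Fin N → ℤ)) (x : Hl N) (k : Fin N → ℤ) :
    realProj S x k = S.indicator (1 : (Fin N → ℤ) → ℂ) k * ((1 / 2 : ℝ) * (x k + conj (x (-k)))) :=
  rfl

lemma norm_realProj_le (S : Set (Fin N → ℤ)) (x : Hl N) : ‖realProj S x‖ ≤ ‖x‖ := by
  refine (norm_proj_le S _).trans ?_
  change ‖(1 / 2 : ℝ) • (x + reflect N x)‖ ≤ ‖x‖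
  rw [norm_smul]
  have := norm_add_le x (reflect N x)
  have := norm_reflect_le x
  norm_num
  linarith

lemma realProj_eq_self_iff {S : Set (Fin N → ℤ)} (hS : ∀ k, -k ∈ S ↔ k ∈ S) {x : Hl N} :
    realProj S x = x ↔ (∀ k, k ∉ S → x k = 0) ∧ ∀ k, x (-k) = conj (x k) := by
  constructor
  · intro h
    refine ⟨fun k hk => ?_, fun k => ?_⟩
    · rw [← h, realProj_apply, Set.indicator_of_notMem hk, zero_mul]
    · rw [← h, realProj_apply, realProj_apply]
      by_cases hk : k ∈ S
      · rw [Set.indicator_of_mem hk, Set.indicator_of_mem ((hS k).2 hk)]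
        simp [add_comm, Complex.conj_ofNat]
      · rw [Set.indicator_of_notMem hk, Set.indicator_of_notMem (fun h => hk ((hS k).1 h))]
        simp
  · rintro ⟨h1, h2⟩
    ext k
    rw [realProj_apply]
    by_cases hk : k ∈ S
    · rw [Set.indicator_of_mem hk, h2, Complex.conj_conj, Pi.one_apply]
      push_cast; ring
    · rw [Set.indicator_of_notMem hk, h1 k hk, zero_mul]

lemma nonlin_neg {x : Hl N} (hx : ∀ k, x (-k) = conj (x k)) (k : Fin N → ℤ) :
    nonlin α s x (-k) = conj (nonlin α s x k) := by
  unfold nonlin conv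
  rw [Complex.conj_tsum, ← (Equiv.neg (Fin N → ℤ)).tsum_eq]
  refine tsum_congr fun j => ?_
  have h1 : -k - -j = -(k - j) := by abel
  simp only [Equiv.neg_apply, h1, derivCoeff, coeff_neg_eq_conj hx, freq_neg, map_mul,
    Complex.conj_I, Complex.conj_ofReal, Complex.ofReal_neg]
  ring

lemma field_neg (hs : (N : ℝ) / 2 + 1 < s) {S : Set (Fin N → ℤ)} (hS : ∀ k, -k ∈ S ↔ k ∈ S)
    {x : Hl N} (hx : ∀ k, x (-k) = conj (x k)) (k : Fin N → ℤ) :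
    field α hs S x (-k) = conj (field α hs S x k) := by
  have h1 : S.indicator (nonlin α s x) (-k) = conj (S.indicator (nonlin α s x) k) := by
    by_cases hk : k ∈ S
    · rw [Set.indicator_of_mem hk, Set.indicator_of_mem ((hS k).2 hk), nonlin_neg hx]
    · rw [Set.indicator_of_notMem hk, Set.indicator_of_notMem (fun h => hk ((hS k).1 h)), map_zero]
  rw [field_apply, field_apply, h1, bracket_neg, coeff_neg_eq_conj hx, disp, disp, freq_neg,
    abs_neg]
  simp only [map_mul, map_add, Complex.conj_I, Complex.conj_ofReal, Complex.ofReal_mul,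
    Complex.ofReal_neg]
  ring

lemma field_zero (hs : (N : ℝ) / 2 + 1 < s) (S : Set (Fin N → ℤ)) : field α hs S 0 = 0 := by
  simp [field]

lemma norm_lift_le {S : Set (Fin N → ℤ)} {B : ℝ} (hB : ∀ k ∈ S, bracket k ≤ B)
    (k : Fin N → ℤ) : ‖S.indicator (fun k => ((bracket k ^ 2 : ℝ) : ℂ)) k‖ ≤ B ^ 2 := by
  by_cases hk : k ∈ S
  · rw [Set.indicator_of_mem hk, Complex.norm_real, Real.norm_eq_abs, abs_of_nonneg (sq_nonneg _)]
    exact pow_le_pow_left₀ (bracket_nonneg k) (hB k hk) 2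
  · rw [Set.indicator_of_notMem hk, norm_zero]; positivity

/-- The lower bound for the time of existence. -/
noncomputable def lifespan (α : Fin N → ℝ) (s r : ℝ) : ℝ :=
  1 / (2 * (energyConst α s + 1) * (1 + max r 0 ^ 2))

lemma lifespan_pos (r : ℝ) : 0 < lifespan α s r := by
  have := energyConst_nonneg (α := α) (s := s)
  unfold lifespan; positivity

/-- The `max r 0` in `lifespan` secures monotonicity for negative r as well, and the `+ 1` keeps the
denominator positive when `energyConst` vanishes. -/
lemma lifespan_antitone : Antitone (lifespan α s) := fun r r' h => by
  have := energyConst_nonneg (α := α) (s := s)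
  unfold lifespan
  gcongr

lemma re_inner_field_le (hs : (N : ℝ) / 2 + 1 < s) {S : Set (Fin N → ℤ)} {B : ℝ}
    (hB : ∀ k ∈ S, bracket k ≤ B) {x : Hl N} (hx : ∀ k, x (-k) = conj (x k))
    (hS : ∀ k, k ∉ S → x k = 0) :
    |(inner ℂ (Hl.diag _ _ (norm_lift_le hB) (field α hs S x)) x).re| ≤
      energyConst α s / 2 * ‖x‖ * ‖x‖ ^ 2 := by
  have hs0 : 0 ≤ s := by have := half_le_dim (N := N); linarith
  have hφ : IsWeight (⌈s⌉₊ + 2) fun r => r ^ s :=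
    isWeight_rpow hs0 (by push_cast; linarith [Nat.le_ceil s])
  have he : ∀ k, bracket k ^ s * ‖coeff s x k‖ = ‖x k‖ := fun k => by
    rw [bracket_rpow_mul_norm_coeff, sub_self, Real.rpow_zero, one_mul]
  have h := re_energy_le (α := α) hs hφ hx hS (by simpa only [he] using Hl.summable_norm_sq x)
    (by
      simp only [he]
      refine Summable.of_nonneg_of_le (fun _ => sq_nonneg _) (fun k => ?_)
        ((Hl.summable_norm_sq x).mul_left (B ^ 2))
      rw [← mul_pow]
      refine pow_le_pow_left₀ (mul_nonneg (bracket_nonneg k) (norm_nonneg _)) ?_ 2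
      by_cases hk : k ∈ S
      · exact mul_le_mul_of_nonneg_right (hB k hk) (norm_nonneg _)
      · rw [hS k hk]; simp)
    (Q := inner ℂ (Hl.diag _ _ (norm_lift_le hB) (field α hs S x)) x)
    (hasSum_of_eq (Hl.hasSum_inner _ _) (fun k => by
      by_cases hk : k ∈ S
      · have e : x k = (bracket k ^ s : ℝ) * coeff s x k := by
          rw [coeff, ← mul_assoc, ← Complex.ofReal_mul, ← Real.rpow_add (bracket_pos k)]; simp
        have e2 : bracket k ^ 2 * bracket k ^ (s - 2) = bracket k ^ s := by
          rw [← Real.rpow_natCast, ← Real.rpow_add (bracket_pos k)]; simp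
        rw [Hl.diag_apply, field_apply, Set.indicator_of_mem hk (fun k => ((bracket k ^ 2 : ℝ) : ℂ)),
          e, ← mul_assoc ((bracket k ^ 2 : ℝ) : ℂ), ← Complex.ofReal_mul, e2]
        simp only [map_mul, map_pow, Complex.conj_ofReal, Complex.ofReal_pow]
        ring
      · simp [coeff, hS k hk]) rfl)
  simp only [he, ← Hl.norm_sq_eq] at h
  refine h.trans_eq ?_
  unfold energyConst
  ring

/-- Solutions of the truncated equations exist on a time interval that depends only on the norm
of the data. -/
lemma exists_truncated_sol (hs : (N : ℝ) / 2 + 1 < s) {S : Set (Fin N → ℤ)}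
    (hS : ∀ k, -k ∈ S ↔ k ∈ S) {B : ℝ} (hB : ∀ k ∈ S, bracket k ≤ B) {r : ℝ}
    {x₀ : Hl N} (hr : ‖x₀‖ ≤ r) (h0S : ∀ k, k ∉ S → x₀ k = 0)
    (h0 : ∀ k, x₀ (-k) = conj (x₀ k)) :
    ∃ x : ℝ → Hl N, x 0 = x₀ ∧ Sol α hs S (lifespan α s r) x ∧
      ∀ t ∈ Set.Icc 0 (lifespan α s r), ‖x t‖ ≤ 2 * (1 + r ^ 2) := by
  set T := lifespan α s r
  set R := 2 * (1 + r ^ 2)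
  have hT : 0 ≤ T := (lifespan_pos r).le
  have hr0 : 0 ≤ r := (norm_nonneg _).trans hr
  set Λ := Hl.diag _ _ (norm_lift_le hB)
  set Q := realProj S
  -- On S, `Λ` undoes the smoothing by ⟨k⟩^(-2), which is bounded because S is. Precomposing with
  -- `Q` makes `F` take values in the real families supported in S.
  set F : Hl N → Hl N := fun x => Λ (field α hs S (Q x))
  have hP := prodConst_nonneg (α := α) (s := s)
  have hF0 : F 0 = 0 := by simp [F, field_zero]
  have hF : ∀ x y, ‖F x - F y‖ ≤ (B ^ 2 * prodConst α s * (‖x‖ + ‖y‖) +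
      B ^ 2 * freqConst α ^ 2) * ‖x - y‖ := fun x y => by
    have h1 : ‖F x - F y‖ ≤ B ^ 2 * ‖field α hs S (Q x) - field α hs S (Q y)‖ := by
      simp only [F, ← map_sub]
      exact Hl.norm_diag_apply_le _ _ _ _
    have h2 := norm_field_sub_le (α := α) hs S (Q x) (Q y)
    have hx := norm_realProj_le S x
    have hy := norm_realProj_le S y
    have hxy : ‖Q x - Q y‖ ≤ ‖x - y‖ := by rw [← map_sub]; exact norm_realProj_le S _
    calc ‖F x - F y‖ ≤ B ^ 2 * ((prodConst α s * (‖Q x‖ + ‖Q y‖) + freqConst α ^ 2) *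
          ‖Q x - Q y‖) := h1.trans (by gcongr)
      _ ≤ B ^ 2 * ((prodConst α s * (‖x‖ + ‖y‖) + freqConst α ^ 2) * ‖x - y‖) := by gcongr
      _ = _ := by ring
  obtain ⟨x, hx0, hx⟩ := exists_cutoff_solution (by positivity) (by positivity) hF0 hF
    (R := R) (by positivity) hT x₀
  have h0T : (0 : ℝ) ∈ Set.Icc 0 T := ⟨le_rfl, hT⟩
  have hQQ : ∀ y, Q (Q y) = Q y := fun y => by
    ext k
    simp only [Q, realProj_apply]
    by_cases hk : k ∈ S
    · rw [Set.indicator_of_mem hk, Set.indicator_of_mem ((hS k).2 hk)]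
      simp [Complex.conj_ofNat]; ring
    · rw [Set.indicator_of_notMem hk]; simp
  have hQF : ∀ y, Q (F y) = F y := fun y => by
    have hy := (realProj_eq_self_iff hS).1 (hQQ y)
    refine (realProj_eq_self_iff hS).2 ⟨fun k hk => ?_, fun k => ?_⟩
    · simp [F, Λ, Set.indicator_of_notMem hk]
    · simp only [F, Λ, Hl.diag_apply]
      rw [field_neg hs hS hy.2]
      by_cases hk : k ∈ S
      · rw [Set.indicator_of_mem hk, Set.indicator_of_mem ((hS k).2 hk)]; simp
      · rw [Set.indicator_of_notMem hk, Set.indicator_of_notMem (fun h => hk ((hS k).1 h))]; simp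
  -- Q x - x has zero derivative because `Q` fixes the range of `F`, and it starts at zero.
  have hQx : ∀ t ∈ Set.Icc 0 T, Q (x t) = x t := fun t ht => by
    have hz : ∀ τ ∈ Set.Icc 0 T, HasDerivWithinAt (fun τ => Q (x τ) - x τ) 0 (Set.Icc 0 T) τ :=
      fun τ hτ => by
        have h1 := (Q.hasFDerivAt.comp_hasDerivWithinAt τ (hx τ hτ)).sub (hx τ hτ)
        rw [map_smul, hQF, sub_self] at h1
        exact h1
    have h2 := (convex_Icc (0 : ℝ) T).norm_image_sub_le_of_norm_hasDerivWithin_le hz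
      (fun τ _ => (norm_zero (E := Hl N)).le) h0T ht
    rw [zero_mul, hx0, (realProj_eq_self_iff hS).2 ⟨h0S, h0⟩, sub_self, sub_zero] at h2
    exact sub_eq_zero.1 (norm_le_zero_iff.1 h2)
  have hprop := fun t ht => (realProj_eq_self_iff hS).1 (hQx t ht)
  have hFx : ∀ t ∈ Set.Icc 0 T, F (x t) = Λ (field α hs S (x t)) := fun t ht => by
    simp only [F, hQx t ht]
  have hE : ∀ t ∈ Set.Icc 0 T, HasDerivWithinAt (fun τ => ‖x τ‖ ^ 2)
      (2 * cutoff R ‖x t‖ * (inner ℂ (F (x t)) (x t)).re) (Set.Icc 0 T) t := fun t ht => by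
    have h1 := Complex.reCLM.hasFDerivAt.comp_hasDerivWithinAt t ((hx t ht).inner ℂ (hx t ht))
    refine (h1.congr_deriv ?_).congr_of_mem (fun τ _ => ?_) ht
    · have e : cutoff R ‖x t‖ • F (x t) = (cutoff R ‖x t‖ : ℂ) • F (x t) := by ext k; simp
      rw [e, inner_smul_left, inner_smul_right, Complex.conj_ofReal]
      simp only [Complex.reCLM_apply, Complex.add_re, Complex.re_ofReal_mul]
      rw [← inner_conj_symm (x t) (F (x t)), Complex.conj_re]
      ring
    · simp only [Function.comp, Complex.reCLM_apply, inner_self_eq_norm_sq_to_K]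
      norm_cast
  have hK := energyConst_nonneg (α := α) (s := s)
  -- The energy law for the cut-off flow carries an extra factor in [0, 1], so the Riccati bound
  -- holds for it too. It gives 1 + ‖x‖² ≤ 2(1 + r²) = R, hence ‖x‖ ≤ R, and the cutoff is never
  -- active.
  have hbd : ∀ t ∈ Set.Icc 0 T, ‖x t‖ ≤ R := fun t ht => by
    have h1 := one_add_le_of_deriv_le (fun τ _ => sq_nonneg ‖x τ‖) hE (K := energyConst α s + 1)
      (fun τ hτ => by
        have h2 := re_inner_field_le (α := α) hs hB (hprop τ hτ).2 (hprop τ hτ).1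
        rw [← hFx τ hτ] at h2
        have h3 := cutoff_nonneg R ‖x τ‖
        have h4 := cutoff_le_one R ‖x τ‖
        have h5 := (le_abs_self _).trans h2
        have h6 : 0 ≤ energyConst α s / 2 * ‖x τ‖ * ‖x τ‖ ^ 2 := by positivity
        calc 2 * cutoff R ‖x τ‖ * (inner ℂ (F (x τ)) (x τ)).re
            ≤ 2 * cutoff R ‖x τ‖ * (energyConst α s / 2 * ‖x τ‖ * ‖x τ‖ ^ 2) := by gcongr
          _ ≤ 2 * 1 * (energyConst α s / 2 * ‖x τ‖ * ‖x τ‖ ^ 2) := by gcongr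
          _ = energyConst α s * (‖x τ‖ * ‖x τ‖ ^ 2) := by ring
          _ ≤ (energyConst α s + 1) * (1 + ‖x τ‖ ^ 2) ^ 2 := by
              gcongr
              · linarith
              · nlinarith [sq_nonneg (‖x τ‖ - 1), sq_nonneg ‖x τ‖]) ht (by
        simp only [hx0]
        have h7 : ‖x₀‖ ^ 2 ≤ r ^ 2 := pow_le_pow_left₀ (norm_nonneg _) hr 2
        have h8 : T * (2 * (energyConst α s + 1) * (1 + r ^ 2)) = 1 := by
          simp only [T, lifespan, max_eq_left hr0]
          exact div_mul_cancel₀ _ (by positivity)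
        have ht0 := ht.1
        calc 2 * (energyConst α s + 1) * t * (1 + ‖x₀‖ ^ 2)
            ≤ 2 * (energyConst α s + 1) * T * (1 + r ^ 2) := by
              gcongr
              exact ht.2
          _ = 1 := by linarith)
    rw [hx0] at h1
    have h7 : ‖x₀‖ ^ 2 ≤ r ^ 2 := pow_le_pow_left₀ (norm_nonneg _) hr 2
    nlinarith [sq_nonneg (‖x t‖ - 1), norm_nonneg (x t)]
  refine ⟨x, hx0, ⟨fun t ht => (hx t ht).continuousWithinAt, fun t ht => ?_,
    fun t ht => (hprop t ht).1, fun t ht => (hprop t ht).2⟩, hbd⟩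
  have h1 := hx t ht
  rw [cutoff_eq_one (hbd t ht), one_smul, hFx t ht] at h1
  have h2 := ((smoothing N (-2) (by norm_num)).restrictScalars
    ℝ).hasFDerivAt.comp_hasDerivWithinAt t h1
  refine h2.congr_deriv ?_
  ext k
  change smoothing N (-2) (by norm_num) (Λ (field α hs S (x t))) k = _
  rw [smoothing_apply, Hl.diag_apply]
  by_cases hk : k ∈ S
  · rw [Set.indicator_of_mem hk, ← mul_assoc, ← Complex.ofReal_mul, ← Real.rpow_natCast,
      ← Real.rpow_add (bracket_pos k)]
    simp
  · rw [field_apply]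
    simp [coeff, hk, (hprop t ht).1 k hk]

end QPBO

namespace QPBO

open ComplexConjugate

variable {N : ℕ} {α : Fin N → ℝ} {s : ℝ}

/-! ### Existence of solutions -/

/-- The set of frequencies of size at most `n`. -/
def ballSet (N : ℕ) (n : ℕ) : Set (Fin N → ℤ) := {k | bracket k ≤ n}

lemma neg_mem_ballSet {n : ℕ} (k : Fin N → ℤ) : -k ∈ ballSet N n ↔ k ∈ ballSet N n := by
  simp [ballSet]

lemma tendsto_proj_ballSet (x : Hl N) :
    Tendsto (fun n : ℕ => proj (ballSet N n) x) atTop (𝓝 x) := by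
  rw [Metric.tendsto_atTop]
  intro ε hε
  obtain ⟨L, hL, -, h⟩ := exists_high_lt x hε
  obtain ⟨n₀, hn₀⟩ := exists_nat_ge L
  refine ⟨n₀, fun n hn => ?_⟩
  rw [dist_eq_norm]
  refine lt_of_le_of_lt ?_ h
  have := Hl.norm_le_norm_of_apply (x := proj (ballSet N n) x - x) (y := high N L hL x) (C := 1)
    zero_le_one fun k => ?_
  · simpa using this
  · rw [one_mul, Hl.sub_apply]
    by_cases hk : k ∈ ballSet N n
    · rw [proj_apply_of_mem hk, sub_self, norm_zero]; exact norm_nonneg _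
    · have h1 : L ≤ bracket k := by
        have h2 : (n : ℝ) < bracket k := not_le.1 hk
        have h3 : (n₀ : ℝ) ≤ n := by exact_mod_cast hn
        linarith
      rw [proj_apply_of_notMem hk, zero_sub, norm_neg, norm_high_apply,
        min_eq_left ((one_le_div hL).2 h1), one_mul]

lemma norm_high_proj_le {L : ℝ} (hL : 0 < L) (S : Set (Fin N → ℤ)) (x : Hl N) :
    ‖high N L hL (proj S x)‖ ≤ ‖high N L hL x‖ := by
  have := Hl.norm_le_norm_of_apply (x := high N L hL (proj S x)) (y := high N L hL x) (C := 1)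
    zero_le_one fun k => ?_
  · simpa using this
  · rw [one_mul, norm_high_apply, norm_high_apply]
    have := bracket_nonneg k
    refine mul_le_mul_of_nonneg_left ?_ (by positivity)
    by_cases hk : k ∈ S
    · rw [proj_apply_of_mem hk]
    · rw [proj_apply_of_notMem hk, norm_zero]; exact norm_nonneg _

lemma Sol.norm_sub_le {hs : (N : ℝ) / 2 + 1 < s} (hs0 : -s ≤ 0) {S S' : Set (Fin N → ℤ)} {T R : ℝ}
    {x y : ℝ → Hl N} (hx : Sol α hs S T x) (hy : Sol α hs S' T y)
    (hxR : ∀ t ∈ Set.Icc 0 T, ‖x t‖ ≤ R) (hyR : ∀ t ∈ Set.Icc 0 T, ‖y t‖ ≤ R) {L : ℝ} (hL : 1 ≤ L)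
    (hL0 : 0 < L) {t : ℝ} (ht : t ∈ Set.Icc 0 T) :
    ‖x t - y t‖ ≤ L ^ s * ‖smoothing N (-s) hs0 (x t - y t)‖ +
      Real.exp (energyConst α s * R * T) * (‖high N L hL0 (x 0)‖ + ‖high N L hL0 (y 0)‖) := by
  have h1 := norm_le_low_add_high hL (by linarith : 0 ≤ s) (x t - y t)
  have hR : 0 ≤ R := (norm_nonneg _).trans (hxR t ht)
  have hK := energyConst_nonneg (α := α) (s := s)
  have h2 : ‖high N L hL0 (x t - y t)‖ ≤
      Real.exp (energyConst α s * R * t) * (‖high N L hL0 (x 0)‖ + ‖high N L hL0 (y 0)‖) := by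
    rw [map_sub, mul_add]
    exact (_root_.norm_sub_le _ _).trans
      (add_le_add (hx.high_le hxR hL0 ht) (hy.high_le hyR hL0 ht))
  refine h1.trans (add_le_add_right (h2.trans ?_) _)
  have := ht.2
  gcongr

lemma exists_uniformCauchySeqOn (hs : (N : ℝ) / 2 + 1 < s) {r : ℝ} {x₀ : Hl N} (hr : ‖x₀‖ ≤ r)
    {x : ℕ → ℝ → Hl N} (hx0 : ∀ n, x n 0 = proj (ballSet N n) x₀)
    (hx : ∀ n, Sol α hs (ballSet N n) (lifespan α s r) (x n))
    (hxR : ∀ n, ∀ t ∈ Set.Icc 0 (lifespan α s r), ‖x n t‖ ≤ 2 * (1 + r ^ 2)) :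
    UniformCauchySeqOn x atTop (Set.Icc 0 (lifespan α s r)) := by
  have hs0 : -s ≤ 0 := by have := half_le_dim (N := N); linarith
  have hs1 : 1 - s < 0 := by have := half_le_dim (N := N); linarith
  set T := lifespan α s r
  set R := 2 * (1 + r ^ 2)
  have hT : 0 ≤ T := (lifespan_pos r).le
  have hr0 : 0 ≤ r := (norm_nonneg _).trans hr
  have hR : 0 ≤ R := by positivity
  set e₁ := Real.exp (energyConst α s * R * T)
  set e₂ := Real.exp ((diffConst α s * R + 1) * T)
  -- Both the omitted data and the omitted nonlinearity are O(m^(1-s)) in L².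
  have hlow : ∀ m n : ℕ, 1 ≤ m → m ≤ n → ∀ t ∈ Set.Icc 0 T,
      ‖smoothing N (-s) hs0 (x n t - x m t)‖ ≤
        (m : ℝ) ^ (1 - s) * Real.sqrt ((r ^ 2 + (prodConst α s * R ^ 2) ^ 2 * T) * e₂) := by
    intro m n hm hmn t ht
    have hm1 : (1 : ℝ) ≤ m := by exact_mod_cast hm
    have hmn' : (m : ℝ) ≤ n := by exact_mod_cast hmn
    set ε := (m : ℝ) ^ (1 - s)
    have hε0 : 0 ≤ ε := by positivity
    have hε : ∀ k ∈ ballSet N n, k ∉ ballSet N m → bracket k ^ (1 - s) ≤ ε := fun k _ hk =>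
      Real.rpow_le_rpow_of_nonpos (by linarith) (not_le.1 hk).le hs1.le
    have hsub : ballSet N m ⊆ ballSet N n := fun k hk => le_trans (show bracket k ≤ m from hk) hmn'
    have h1 := (hx n).difference_le hs0 hsub hε0 hε (hx m) (hxR n) (hxR m) ht
    have h2 : ‖smoothing N (-s) hs0 (x n 0 - x m 0)‖ ≤ ε * r := by
      refine (Hl.norm_le_norm_of_apply (y := x₀) hε0 fun k => ?_).trans
        (mul_le_mul_of_nonneg_left hr hε0)
      rw [smoothing_apply, norm_mul, norm_bracket_rpow, hx0, hx0, Hl.sub_apply]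
      by_cases hk : k ∈ ballSet N m
      · rw [proj_apply_of_mem hk, proj_apply_of_mem (hsub hk), sub_self, norm_zero, mul_zero]
        positivity
      · rw [proj_apply_of_notMem hk, sub_zero]
        by_cases hk' : k ∈ ballSet N n
        · rw [proj_apply_of_mem hk']
          refine mul_le_mul_of_nonneg_right (le_trans ?_ (hε k hk' hk)) (norm_nonneg _)
          exact Real.rpow_le_rpow_of_exponent_le (one_le_bracket k) (by linarith)
        · rw [proj_apply_of_notMem hk', norm_zero, mul_zero]; positivity
    refine le_of_sq_le_sq (h1.trans ?_) (by positivity)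
    rw [mul_pow ε, Real.sq_sqrt (by positivity)]
    have h3 := diffConst_nonneg (α := α) (s := s)
    have ht1 := ht.1
    have ht2 := ht.2
    have h6 : Real.exp ((diffConst α s * R + 1) * t) ≤ e₂ := by
      simp only [e₂]
      gcongr
    calc _ ≤ ((ε * r) ^ 2 + (ε * prodConst α s * R ^ 2) ^ 2 * T) * e₂ := by gcongr
      _ = _ := by ring
  rw [Metric.uniformCauchySeqOn_iff]
  intro ε hε
  have he₁ : 0 < e₁ := Real.exp_pos _
  -- The two tails contribute at most 2e₁ times the tail of `x₀`, less than ε/2. With L now fixed, m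
  -- is taken large enough to make the L² part smaller than ε/2.
  obtain ⟨L, hL0, hL, hLε⟩ := exists_high_lt x₀ (show 0 < ε / (4 * e₁) by positivity)
  rw [lt_div_iff₀ (by positivity)] at hLε
  have htend : Tendsto (fun m : ℕ => L ^ s * ((m : ℝ) ^ (1 - s) *
      Real.sqrt ((r ^ 2 + (prodConst α s * R ^ 2) ^ 2 * T) * e₂))) atTop (𝓝 0) := by
    have h1 : Tendsto (fun m : ℕ => (m : ℝ) ^ (1 - s)) atTop (𝓝 0) := by
      have := (tendsto_rpow_neg_atTop (y := s - 1) (by linarith)).comp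
        (tendsto_natCast_atTop_atTop (R := ℝ))
      refine this.congr fun m => ?_
      simp only [Function.comp, neg_sub]
    simpa using (h1.mul_const _).const_mul (L ^ s)
  obtain ⟨m₀, hm₀⟩ := eventually_atTop.1
    ((htend.eventually_lt_const (by positivity : 0 < ε / 2)).and (eventually_ge_atTop 1))
  have main : ∀ m n : ℕ, m₀ ≤ m → m ≤ n → ∀ t ∈ Set.Icc 0 T, ‖x n t - x m t‖ < ε := by
    intro m n hm hmn t ht
    obtain ⟨h1, h2⟩ := hm₀ m hm
    have h3 := (hx n).norm_sub_le hs0 (hx m) (hxR n) (hxR m) hL hL0 ht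
    have h4 := hlow m n h2 hmn t ht
    have h5 : ‖high N L hL0 (x n 0)‖ + ‖high N L hL0 (x m 0)‖ ≤ 2 * ‖high N L hL0 x₀‖ := by
      rw [hx0, hx0]
      linarith [norm_high_proj_le hL0 (ballSet N n) x₀, norm_high_proj_le hL0 (ballSet N m) x₀]
    have h6 : 0 ≤ L ^ s := by positivity
    have h7 := mul_le_mul_of_nonneg_left h4 h6
    have h8 := mul_le_mul_of_nonneg_left h5 he₁.le
    nlinarith
  refine ⟨m₀, fun m hm n hn t ht => ?_⟩
  rw [dist_eq_norm]
  rcases le_total m n with h | h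
  · rw [norm_sub_rev]; exact main m n hm h t ht
  · exact main n m hn h t ht

/-- The projections converge only strongly, so they are applied to the fixed element y; replacing x
n by y costs little by the Lipschitz bound uniform in S. -/
lemma tendsto_field_ballSet (hs : (N : ℝ) / 2 + 1 < s) {x : ℕ → Hl N} {y : Hl N}
    (h : Tendsto x atTop (𝓝 y)) :
    Tendsto (fun n => field α hs (ballSet N n) (x n)) atTop (𝓝 (field α hs Set.univ y)) := by
  have h1 : Tendsto (fun n => field α hs (ballSet N n) y) atTop (𝓝 (field α hs Set.univ y)) := by
    have h2 := (tendsto_proj_ballSet (smoothing N (-1) (by norm_num) (product α hs y y))).add_const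
      (dispersion α y)
    have h3 : field α hs Set.univ y =
        smoothing N (-1) (by norm_num) (product α hs y y) + dispersion α y := by
      ext k
      simp [field, proj_apply_of_mem]
    rw [h3]
    exact h2
  have h4 : Tendsto (fun n => field α hs (ballSet N n) (x n) - field α hs (ballSet N n) y) atTop
      (𝓝 0) := by
    have h5 : Tendsto (fun n => (prodConst α s * (‖x n‖ + ‖y‖) + freqConst α ^ 2) * ‖x n - y‖) atTop
        (𝓝 ((prodConst α s * (‖y‖ + ‖y‖) + freqConst α ^ 2) * ‖y - y‖)) :=
      (((h.norm.add_const _).const_mul _).add_const _).mul (h.sub_const y).norm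
    rw [sub_self, norm_zero, mul_zero] at h5
    exact squeeze_zero_norm (fun n => norm_field_sub_le hs _ _ _) h5
  simpa using h4.add h1

lemma sol_of_tendstoUniformlyOn (hs : (N : ℝ) / 2 + 1 < s) {T R : ℝ} {x : ℕ → ℝ → Hl N}
    {y : ℝ → Hl N} (hx : ∀ n, Sol α hs (ballSet N n) T (x n))
    (hxR : ∀ n, ∀ t ∈ Set.Icc 0 T, ‖x n t‖ ≤ R)
    (hy : TendstoUniformlyOn x y atTop (Set.Icc 0 T)) : Sol α hs Set.univ T y := by
  have hpt : ∀ t ∈ Set.Icc 0 T, Tendsto (fun n => x n t) atTop (𝓝 (y t)) :=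
    fun t ht => hy.tendsto_at ht
  have hcont : ContinuousOn y (Set.Icc 0 T) :=
    hy.continuousOn (Frequently.of_forall fun n => (hx n).cont)
  refine ⟨hcont, fun t ht => ?_, fun t _ k hk => absurd (Set.mem_univ k) hk, fun t ht k => ?_⟩
  · set Λ := smoothing N (-2) (by norm_num)
    have hR : 0 ≤ R := (norm_nonneg _).trans (hxR 0 t ht)
    set C := prodConst α s * (R + R) + freqConst α ^ 2
    have hC : 0 ≤ C := by
      have := prodConst_nonneg (α := α) (s := s)
      positivity
    rw [hasDerivWithinAt_iff_isLittleO, Asymptotics.isLittleO_iff]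
    intro ε hε
    -- Near t, and for large n, x n σ and x n t differ by at most 3η (two approximation errors and
    -- one modulus of continuity), so the fields differ by at most ε. The mean value inequality for
    -- x n then passes to the limit.
    set η := ε / (3 * (C + 1))
    have hη : 0 < η := by positivity
    obtain ⟨δ, hδ, hcδ⟩ := Metric.continuousWithinAt_iff.1 (hcont t ht) η hη
    have hev : ∀ᶠ τ in 𝓝[Set.Icc 0 T] t, τ ∈ Set.Icc 0 T ∩ Metric.ball t δ :=
      (eventually_mem_nhdsWithin).and (mem_nhdsWithin_of_mem_nhds (Metric.ball_mem_nhds t hδ))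
    filter_upwards [hev] with τ hτ
    have hI : Convex ℝ (Set.Icc 0 T ∩ Metric.ball t δ) :=
      (convex_Icc 0 T).inter (convex_ball t δ)
    have htI : t ∈ Set.Icc 0 T ∩ Metric.ball t δ := ⟨ht, Metric.mem_ball_self hδ⟩
    have hn : ∀ᶠ n in atTop, ‖Λ (x n τ) - Λ (x n t) - (τ - t) • field α hs (ballSet N n) (x n t)‖ ≤
        ε * ‖τ - t‖ := by
      filter_upwards [Metric.tendstoUniformlyOn_iff.1 hy η hη] with n hn
      have hd : ∀ σ ∈ Set.Icc 0 T ∩ Metric.ball t δ, HasDerivWithinAt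
          (fun σ => Λ (x n σ) - σ • field α hs (ballSet N n) (x n t))
          (field α hs (ballSet N n) (x n σ) - (1 : ℝ) • field α hs (ballSet N n) (x n t))
          (Set.Icc 0 T ∩ Metric.ball t δ) σ := fun σ hσ =>
        (((hx n).deriv σ hσ.1).mono Set.inter_subset_left).sub
          ((hasDerivWithinAt_id σ _).smul_const _)
      have hb : ∀ σ ∈ Set.Icc 0 T ∩ Metric.ball t δ,
          ‖field α hs (ballSet N n) (x n σ) - (1 : ℝ) • field α hs (ballSet N n) (x n t)‖ ≤ ε :=
        fun σ hσ => by
          rw [one_smul]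
          refine (norm_field_sub_le hs _ _ _).trans ?_
          have h1 := hn σ hσ.1
          have h2 := hn t ht
          have h3 := hcδ hσ.1 hσ.2
          have h4 : dist (x n σ) (x n t) ≤ 3 * η := by
            have := dist_triangle4 (x n σ) (y σ) (y t) (x n t)
            rw [dist_comm (x n σ) (y σ)] at this
            linarith
          rw [dist_eq_norm] at h4
          have hP := prodConst_nonneg (α := α) (s := s)
          have h5 : prodConst α s * (‖x n σ‖ + ‖x n t‖) + freqConst α ^ 2 ≤ C := by
            have h6 := hxR n σ hσ.1
            have h7 := hxR n t ht
            simp only [C]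
            gcongr
          calc _ ≤ C * (3 * η) := by gcongr
            _ ≤ (C + 1) * (3 * η) := by nlinarith
            _ = ε := by simp only [η]; field_simp
      have h5 := hI.norm_image_sub_le_of_norm_hasDerivWithin_le hd hb htI hτ
      convert h5 using 2
      rw [sub_smul]; abel
    have hlim : Tendsto (fun n =>
        ‖Λ (x n τ) - Λ (x n t) - (τ - t) • field α hs (ballSet N n) (x n t)‖) atTop
        (𝓝 ‖Λ (y τ) - Λ (y t) - (τ - t) • field α hs Set.univ (y t)‖) :=
      ((((Λ.continuous.tendsto _).comp (hpt τ hτ.1)).sub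
        ((Λ.continuous.tendsto _).comp (hpt t ht))).sub
        ((tendsto_field_ballSet hs (hpt t ht)).const_smul (τ - t))).norm
    exact le_of_tendsto hlim hn
  · refine tendsto_nhds_unique (Hl.tendsto_apply (hpt t ht) (-k)) ?_
    refine ((Complex.continuous_conj.tendsto _).comp (Hl.tendsto_apply (hpt t ht) k)).congr
      fun n => ?_
    simp only [Function.comp]
    rw [(hx n).real t ht k]

/-- Existence of solutions on a time interval that depends only on the norm of the data. -/
theorem exists_sol (hs : (N : ℝ) / 2 + 1 < s) {r : ℝ} {x₀ : Hl N} (hr : ‖x₀‖ ≤ r)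
    (h0 : ∀ k, x₀ (-k) = conj (x₀ k)) :
    ∃ x : ℝ → Hl N, x 0 = x₀ ∧ Sol α hs Set.univ (lifespan α s r) x := by
  have hex : ∀ n : ℕ, ∃ x : ℝ → Hl N, x 0 = proj (ballSet N n) x₀ ∧
      Sol α hs (ballSet N n) (lifespan α s r) x ∧
      ∀ t ∈ Set.Icc 0 (lifespan α s r), ‖x t‖ ≤ 2 * (1 + r ^ 2) := fun n => by
    refine exists_truncated_sol hs neg_mem_ballSet (B := n) (fun k hk => hk)
      ((norm_proj_le _ _).trans hr) (fun k hk => proj_apply_of_notMem hk _) fun k => ?_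
    by_cases hk : k ∈ ballSet N n
    · rw [proj_apply_of_mem hk, proj_apply_of_mem ((neg_mem_ballSet k).2 hk), h0]
    · rw [proj_apply_of_notMem hk, proj_apply_of_notMem fun h => hk ((neg_mem_ballSet k).1 h),
        map_zero]
  choose x hx0 hx hxR using hex
  have hC := exists_uniformCauchySeqOn hs hr hx0 hx hxR
  have hlim : ∀ t, ∃ y, t ∈ Set.Icc 0 (lifespan α s r) → Tendsto (fun n => x n t) atTop (𝓝 y) :=
    fun t => by
      by_cases ht : t ∈ Set.Icc 0 (lifespan α s r)
      · obtain ⟨y, hy⟩ := cauchySeq_tendsto_of_complete (hC.cauchySeq ht)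
        exact ⟨y, fun _ => hy⟩
      · exact ⟨0, fun h => absurd h ht⟩
  choose y hy using hlim
  refine ⟨y, ?_, sol_of_tendstoUniformlyOn hs hx hxR (hC.tendstoUniformlyOn_of_tendsto hy)⟩
  have h1 := hy 0 ⟨le_rfl, (lifespan_pos r).le⟩
  simp only [hx0] at h1
  exact tendsto_nhds_unique h1 (tendsto_proj_ballSet x₀)

/-! ### Uniqueness and continuous dependence -/

lemma Sol.exists_bound {hs : (N : ℝ) / 2 + 1 < s} {S : Set (Fin N → ℤ)} {T : ℝ} {x : ℝ → Hl N}
    (hx : Sol α hs S T x) : ∃ R, 0 ≤ R ∧ ∀ t ∈ Set.Icc 0 T, ‖x t‖ ≤ R := by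
  obtain ⟨R, hR⟩ := isCompact_Icc.exists_bound_of_continuousOn hx.cont
  exact ⟨max R 0, le_max_right _ _, fun t ht => (hR t ht).trans (le_max_left _ _)⟩

lemma Sol.norm_low_le {hs : (N : ℝ) / 2 + 1 < s} (hs0 : -s ≤ 0) {S : Set (Fin N → ℤ)} {T R : ℝ}
    {x y : ℝ → Hl N} (hx : Sol α hs S T x) (hy : Sol α hs S T y)
    (hxR : ∀ t ∈ Set.Icc 0 T, ‖x t‖ ≤ R) (hyR : ∀ t ∈ Set.Icc 0 T, ‖y t‖ ≤ R) {t : ℝ}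
    (ht : t ∈ Set.Icc 0 T) :
    ‖smoothing N (-s) hs0 (x t - y t)‖ ≤
      ‖x 0 - y 0‖ * Real.exp ((diffConst α s * R + 1) * T) := by
  have h := hx.difference_le hs0 subset_rfl le_rfl (fun k h1 h2 => absurd h1 h2) hy hxR hyR ht
  simp only [zero_mul, ne_eq, OfNat.ofNat_ne_zero, not_false_eq_true, zero_pow, add_zero] at h
  have hK := diffConst_nonneg (α := α) (s := s)
  have hR : 0 ≤ R := (norm_nonneg _).trans (hxR t ht)
  have h1 : Real.exp ((diffConst α s * R + 1) * t) ≤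
      Real.exp ((diffConst α s * R + 1) * T) := by
    have := ht.2
    gcongr
  have hT : 0 ≤ T := ht.1.trans ht.2
  have h2 : 1 ≤ Real.exp ((diffConst α s * R + 1) * T) := Real.one_le_exp (by positivity)
  refine le_of_sq_le_sq (h.trans ?_) (by positivity)
  rw [mul_pow]
  have h3 := norm_smoothing_le (-s) hs0 (x 0 - y 0)
  gcongr
  exact h1.trans (le_self_pow₀ h2 (by norm_num))

theorem Sol.unique {hs : (N : ℝ) / 2 + 1 < s} {S : Set (Fin N → ℤ)} {T : ℝ} {x y : ℝ → Hl N}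
    (hx : Sol α hs S T x) (hy : Sol α hs S T y) (h0 : x 0 = y 0) {t : ℝ}
    (ht : t ∈ Set.Icc 0 T) : x t = y t := by
  have hs0 : -s ≤ 0 := by have := half_le_dim (N := N); linarith
  obtain ⟨R₁, -, h1⟩ := hx.exists_bound
  obtain ⟨R₂, -, h2⟩ := hy.exists_bound
  have h := hx.norm_low_le hs0 hy (R := max R₁ R₂) (fun τ hτ => (h1 τ hτ).trans (le_max_left _ _))
    (fun τ hτ => (h2 τ hτ).trans (le_max_right _ _)) ht
  rw [h0, sub_self, norm_zero, zero_mul] at h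
  have h3 := norm_le_zero_iff.1 h
  ext k
  have h4 : smoothing N (-s) hs0 (x t - y t) k = 0 := by rw [h3]; rfl
  rw [smoothing_apply] at h4
  rcases mul_eq_zero.1 h4 with h5 | h5
  · exact absurd h5 (Complex.ofReal_ne_zero.2 (bracket_rpow_pos k _).ne')
  · exact sub_eq_zero.1 h5

/-- At the first time with g ≥ ε, the intermediate value theorem gives g ≤ ε on all of [0, t], and
the hypothesis contradicts the choice of t. -/
lemma lt_of_bootstrap {g : ℝ → ℝ} {T ε : ℝ} (hg : ContinuousOn g (Set.Icc 0 T)) (h0 : g 0 < ε)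
    (h : ∀ t ∈ Set.Icc 0 T, (∀ τ ∈ Set.Icc 0 t, g τ ≤ ε) → g t < ε) :
    ∀ t ∈ Set.Icc 0 T, g t < ε := by
  by_contra! hcon
  obtain ⟨t₁, ht₁, hgt₁⟩ := hcon
  set A := Set.Icc 0 T ∩ g ⁻¹' Set.Ici ε
  have hA : IsCompact A :=
    isCompact_Icc.of_isClosed_subset (hg.preimage_isClosed_of_isClosed isClosed_Icc isClosed_Ici)
      Set.inter_subset_left
  obtain ⟨t, ⟨htI, htg⟩, hmin⟩ := hA.exists_isLeast ⟨t₁, ht₁, hgt₁⟩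
  refine absurd (h t htI fun τ hτ => ?_) (not_lt.2 htg)
  by_contra! hτg
  have hIT : Set.Icc 0 τ ⊆ Set.Icc 0 T := Set.Icc_subset_Icc_right (hτ.2.trans htI.2)
  obtain ⟨σ, hσ, hgσ⟩ := intermediate_value_Icc hτ.1 (hg.mono hIT)
    (⟨h0.le, hτg.le⟩ : ε ∈ Set.Icc (g 0) (g τ))
  have h1 := hmin ⟨hIT hσ, hgσ.ge⟩
  have h2 : σ = τ := le_antisymm hσ.2 (hτ.2.trans h1)
  rw [h2] at hgσ
  exact hτg.ne' hgσ

theorem Sol.continuous_dependence {hs : (N : ℝ) / 2 + 1 < s} {S : Set (Fin N → ℤ)} {T : ℝ}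
    {x : ℝ → Hl N} (hT : 0 ≤ T) (hx : Sol α hs S T x) {ε : ℝ} (hε : 0 < ε) :
    ∃ δ, 0 < δ ∧ ∀ y, Sol α hs S T y → ‖y 0 - x 0‖ < δ → ∀ t ∈ Set.Icc 0 T, ‖y t - x t‖ < ε := by
  have hs0 : -s ≤ 0 := by have := half_le_dim (N := N); linarith
  obtain ⟨R₀, hR₀, hxR₀⟩ := hx.exists_bound
  set R := R₀ + 1
  -- While ‖y - x‖ ≤ η ≤ 1, the unknown solution y satisfies ‖y‖ ≤ R₀ + 1 = R; this supplies the
  -- uniform size bound that is not available beforehand.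
  set η := min ε 1
  have hη : 0 < η := lt_min hε one_pos
  set e₁ := Real.exp (energyConst α s * R * T)
  set e₂ := Real.exp ((diffConst α s * R + 1) * T)
  have he₁ : 1 ≤ e₁ := Real.one_le_exp (mul_nonneg (mul_nonneg energyConst_nonneg
    (by positivity)) hT)
  have he₂ : 0 < e₂ := Real.exp_pos _
  obtain ⟨L, hL0, hL, hLη⟩ := exists_high_lt (x 0) (show 0 < η / (4 * e₁) by positivity)
  rw [lt_div_iff₀ (by positivity)] at hLη
  have hLs : 0 < L ^ s := Real.rpow_pos_of_pos hL0 s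
  have hD : 0 < L ^ s * e₂ + e₁ := by positivity
  -- With d the distance of the data and h₀ the tail of `x 0`, the final bound is d(L^s e₂ + e₁) +
  -- 2e₁h₀; each summand is below η/2. The tail of `y 0` is at most d + h₀, so L depends on x alone.
  refine ⟨η / (2 * (L ^ s * e₂ + e₁)), by positivity, fun y hy hδ t ht => ?_⟩
  rw [lt_div_iff₀ (by positivity)] at hδ
  refine lt_of_lt_of_le ?_ (min_le_left ε 1)
  refine lt_of_bootstrap (g := fun t => ‖y t - x t‖) ((hy.cont.sub hx.cont).norm) ?_ ?_ t ht
  · have := norm_nonneg (y 0 - x 0)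
    have h1 : 0 ≤ ‖y 0 - x 0‖ * (L ^ s * e₂) := by positivity
    nlinarith
  · intro t ht hb
    have hsub : Set.Icc 0 t ⊆ Set.Icc 0 T := Set.Icc_subset_Icc_right ht.2
    have htt : t ∈ Set.Icc 0 t := ⟨ht.1, le_rfl⟩
    have hxR : ∀ τ ∈ Set.Icc 0 t, ‖x τ‖ ≤ R := fun τ hτ => by
      linarith [hxR₀ τ (hsub hτ)]
    have hyR : ∀ τ ∈ Set.Icc 0 t, ‖y τ‖ ≤ R := fun τ hτ => by
      have h1 := norm_add_le (y τ - x τ) (x τ)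
      rw [sub_add_cancel] at h1
      linarith [hxR₀ τ (hsub hτ), hb τ hτ, min_le_right ε 1]
    have h1 := (hy.mono ht.2).norm_sub_le hs0 (hx.mono ht.2) hyR hxR hL hL0 htt
    have h2 := (hy.mono ht.2).norm_low_le hs0 (hx.mono ht.2) hyR hxR htt
    have hR : 0 ≤ R := by positivity
    have h3 : Real.exp (energyConst α s * R * t) ≤ e₁ := by
      have := energyConst_nonneg (α := α) (s := s)
      have := ht.2
      simp only [e₁]
      gcongr
    have h4 : Real.exp ((diffConst α s * R + 1) * t) ≤ e₂ := by
      have := diffConst_nonneg (α := α) (s := s)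
      have := ht.2
      simp only [e₂]
      gcongr
    have h5 : ‖high N L hL0 (y 0)‖ ≤ ‖y 0 - x 0‖ + ‖high N L hL0 (x 0)‖ := by
      have h6 := norm_add_le (high N L hL0 (y 0 - x 0)) (high N L hL0 (x 0))
      rw [← map_add, sub_add_cancel] at h6
      linarith [norm_high_le hL0 (y 0 - x 0)]
    set d := ‖y 0 - x 0‖
    set h₀ := ‖high N L hL0 (x 0)‖
    have hd0 : 0 ≤ d := norm_nonneg _
    have hh0 : 0 ≤ h₀ := norm_nonneg _
    calc ‖y t - x t‖ ≤ L ^ s * (d * e₂) + e₁ * ((d + h₀) + h₀) := by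
          refine h1.trans (add_le_add ?_ ?_)
          · exact mul_le_mul_of_nonneg_left (h2.trans (by gcongr)) hLs.le
          · gcongr
      _ < η := by nlinarith

end QPBO

namespace QPBO

open ComplexConjugate

variable {N : ℕ} {α : Fin N → ℝ} {s : ℝ}

/-! ### Quasiperiodic Fourier coefficients -/

/-- The character `x ↦ exp (i (α · k) x)`. -/
noncomputable def char (α : Fin N → ℝ) (k : Fin N → ℤ) (x : ℝ) : ℂ :=
  Complex.exp (Complex.I * (freq α k : ℂ) * (x : ℂ))

lemma norm_char (k : Fin N → ℤ) (x : ℝ) : ‖char α k x‖ = 1 := by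
  rw [char, mul_assoc, ← Complex.ofReal_mul, mul_comm, Complex.norm_exp_ofReal_mul_I]

lemma char_add (j k : Fin N → ℤ) (x : ℝ) : char α (j + k) x = char α j x * char α k x := by
  rw [char, char, char, ← Complex.exp_add, freq_add]
  congr 1
  push_cast
  ring

lemma conj_char (k : Fin N → ℤ) (x : ℝ) : conj (char α k x) = char α (-k) x := by
  rw [char, char, ← Complex.exp_conj, freq_neg]
  congr 1
  simp

lemma char_zero (x : ℝ) : char α (0 : Fin N → ℤ) x = 1 := by simp [char, freq]

lemma continuous_char (k : Fin N → ℤ) : Continuous (char α k) := by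
  unfold char; fun_prop

lemma norm_average_char_le (k : Fin N → ℤ) {R : ℝ} (hR : 0 < R) :
    ‖((2 * R : ℝ) : ℂ)⁻¹ * ∫ x in (-R)..R, char α k x‖ ≤ 1 := by
  have h := intervalIntegral.norm_integral_le_of_norm_le_const (f := char α k) (a := -R) (b := R)
    (C := 1) fun x _ => (norm_char k x).le
  rw [sub_neg_eq_add, ← two_mul, one_mul, abs_of_pos (by positivity : 0 < 2 * R)] at h
  rw [norm_mul, norm_inv, Complex.norm_real, Real.norm_eq_abs, abs_of_pos (by positivity)]
  exact (mul_le_mul_of_nonneg_left h (by positivity)).trans_eq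
    (inv_mul_cancel₀ (by positivity : (2 * R : ℝ) ≠ 0))

lemma tendsto_average_char (hα : RationallyIndependent α) (k : Fin N → ℤ) :
    Tendsto (fun R : ℝ => ((2 * R : ℝ) : ℂ)⁻¹ * ∫ x in (-R)..R, char α k x) atTop
      (𝓝 (if k = 0 then 1 else 0)) := by
  by_cases hk : k = 0
  · subst hk
    rw [if_pos rfl]
    refine tendsto_const_nhds.congr' ?_
    filter_upwards [eventually_gt_atTop 0] with R hR
    simp only [char_zero, intervalIntegral.integral_const, sub_neg_eq_add, ← two_mul,
      Complex.real_smul, mul_one]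
    exact (inv_mul_cancel₀ (Complex.ofReal_ne_zero.2 (by positivity))).symm
  · rw [if_neg hk]
    -- Rational independence: a nonconstant character has a bounded primitive, so its mean decays
    -- like 1/R.
    have hω : freq α k ≠ 0 := hα k hk
    have hc : Complex.I * (freq α k : ℂ) ≠ 0 :=
      mul_ne_zero Complex.I_ne_zero (Complex.ofReal_ne_zero.2 hω)
    have hb : ∀ R : ℝ, 0 < R → ‖((2 * R : ℝ) : ℂ)⁻¹ * ∫ x in (-R)..R, char α k x‖ ≤
        |freq α k|⁻¹ * R⁻¹ := fun R hR => by
      have e : ∫ x in (-R)..R, char α k x =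
          (char α k R - char α k (-R)) / (Complex.I * (freq α k : ℂ)) := by
        unfold char
        exact integral_exp_mul_complex hc
      have h2 : ‖char α k R - char α k (-R)‖ ≤ 2 := by
        refine (norm_sub_le _ _).trans ?_
        rw [norm_char, norm_char]; norm_num
      rw [e, norm_mul, norm_div, norm_inv, norm_mul, Complex.norm_I, one_mul, Complex.norm_real,
        Complex.norm_real, Real.norm_eq_abs, Real.norm_eq_abs, abs_of_pos (by positivity : 0 < 2 * R)]
      calc (2 * R)⁻¹ * (‖char α k R - char α k (-R)‖ / |freq α k|)
          ≤ (2 * R)⁻¹ * (2 / |freq α k|) := by gcongr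
        _ = _ := by rw [mul_inv]; ring
    refine squeeze_zero_norm' ?_ (by simpa using tendsto_inv_atTop_zero.const_mul |freq α k|⁻¹)
    filter_upwards [eventually_gt_atTop 0] with R hR using hb R hR

/-- The Fourier coefficients of the sum of an absolutely convergent series. -/
lemma qpCoeff_eq_of_hasSum (hα : RationallyIndependent α) {f : ℝ → ℝ} {c : (Fin N → ℤ) → ℂ}
    (hc : Summable fun k => ‖c k‖)
    (hf : ∀ x, HasSum (fun k => c k * char α k x) (f x : ℂ)) : qpCoeff α f = c := by
  funext k
  refine Tendsto.limUnder_eq ?_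
  have e : ∀ R : ℝ, 0 < R → HasSum
      (fun j => c j * (((2 * R : ℝ) : ℂ)⁻¹ * ∫ x in (-R)..R, char α (j - k) x))
      (((2 * R : ℝ) : ℂ)⁻¹ *
        ∫ x in (-R)..R, (f x : ℂ) * Complex.exp (-(Complex.I * (freq α k : ℂ) * (x : ℂ)))) := by
    intro R hR
    -- Dominated convergence is used twice, with bound ‖c j‖ each time: here to integrate the series
    -- termwise for fixed R, and below to let R → ∞ in the series of averages.
    have h1 := intervalIntegral.hasSum_integral_of_dominated_convergence
      (μ := MeasureTheory.volume) (a := -R) (b := R)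
      (F := fun j x => c j * char α (j - k) x)
      (f := fun x => (f x : ℂ) * Complex.exp (-(Complex.I * (freq α k : ℂ) * (x : ℂ))))
      (fun j _ => ‖c j‖)
      (fun j => ((continuous_char (j - k)).const_mul (c j)).aestronglyMeasurable)
      (fun j => Eventually.of_forall fun x _ => by rw [norm_mul, norm_char, mul_one])
      (Eventually.of_forall fun x _ => hc) intervalIntegrable_const
      (Eventually.of_forall fun x _ => by
        refine hasSum_of_eq ((hf x).mul_right
          (Complex.exp (-(Complex.I * (freq α k : ℂ) * (x : ℂ))))) (fun j => ?_) rfl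
        rw [mul_assoc, sub_eq_add_neg, char_add, char, char, freq_neg]
        congr 3
        push_cast
        ring)
    refine hasSum_of_eq (h1.mul_left _) (fun j => ?_) rfl
    rw [intervalIntegral.integral_const_mul]
    ring
  have h2 : Tendsto (fun R : ℝ => ∑' j, c j *
      (((2 * R : ℝ) : ℂ)⁻¹ * ∫ x in (-R)..R, char α (j - k) x)) atTop
      (𝓝 (∑' j, c j * if j - k = 0 then 1 else 0)) := by
    refine tendsto_tsum_of_dominated_convergence hc
      (fun j => (tendsto_average_char hα (j - k)).const_mul (c j)) ?_
    filter_upwards [eventually_gt_atTop 0] with R hR j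
    rw [norm_mul]
    exact mul_le_of_le_one_right (norm_nonneg _) (norm_average_char_le _ hR)
  have h3 : ∑' j, c j * (if j - k = 0 then 1 else 0) = c k := by
    rw [tsum_eq_single k fun j hj => by rw [if_neg (sub_ne_zero.2 hj), mul_zero]]
    simp
  rw [h3] at h2
  refine h2.congr' ?_
  filter_upwards [eventually_gt_atTop 0] with R hR using (e R hR).tsum_eq

/-! ### Families of finite Sobolev norm -/

lemma norm_bracket_rpow_mul_sq (s : ℝ) (c : (Fin N → ℤ) → ℂ) (k : Fin N → ℤ) :
    ‖((bracket k ^ s : ℝ) : ℂ) * c k‖ ^ 2 = bracketSq k ^ s * ‖c k‖ ^ 2 := by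
  rw [norm_mul, norm_bracket_rpow, mul_pow, bracketSq_rpow]

open Classical in
/-- The element of `Hl N` that represents a family of finite `H^s` norm. -/
noncomputable def ofCoeff (s : ℝ) (c : (Fin N → ℤ) → ℂ) : Hl N :=
  if h : SobolevSummable s c then
    Hl.mk (fun k => (bracket k ^ s : ℝ) * c k) (by
      simpa only [norm_bracket_rpow_mul_sq] using! h)
  else 0

lemma ofCoeff_apply {c : (Fin N → ℤ) → ℂ} (h : SobolevSummable s c) (k : Fin N → ℤ) :
    ofCoeff s c k = (bracket k ^ s : ℝ) * c k := by
  rw [ofCoeff, dif_pos h, Hl.mk_apply]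

lemma coeff_ofCoeff {c : (Fin N → ℤ) → ℂ} (h : SobolevSummable s c) :
    coeff s (ofCoeff s c) = c := by
  funext k
  rw [coeff, ofCoeff_apply h, ← mul_assoc, ← Complex.ofReal_mul, ← Real.rpow_add (bracket_pos k)]
  simp

lemma apply_eq_rpow_mul_coeff (x : Hl N) (k : Fin N → ℤ) :
    x k = (bracket k ^ s : ℝ) * coeff s x k := by
  rw [coeff, ← mul_assoc, ← Complex.ofReal_mul, ← Real.rpow_add (bracket_pos k)]
  simp

lemma sobolevSummable_of_apply {x : Hl N} {c : (Fin N → ℤ) → ℂ}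
    (h : ∀ k, x k = (bracket k ^ s : ℝ) * c k) : SobolevSummable s c := by
  refine (Hl.summable_norm_sq x).congr fun k => ?_
  rw [h, norm_bracket_rpow_mul_sq]

lemma sobolevNorm_eq_of_apply {x : Hl N} {c : (Fin N → ℤ) → ℂ}
    (h : ∀ k, x k = (bracket k ^ s : ℝ) * c k) : sobolevNorm s c = ‖x‖ := by
  rw [sobolevNorm, ← Real.sqrt_sq (norm_nonneg x), Hl.norm_sq_eq]
  simp only [h, norm_bracket_rpow_mul_sq]

lemma sobolevSummable_coeff (x : Hl N) : SobolevSummable s (coeff s x) :=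
  sobolevSummable_of_apply (apply_eq_rpow_mul_coeff x)

/-! ### Functions in `H^s_qp` -/

lemma MemHqp.hasSum {f : ℝ → ℝ} (hf : MemHqp α s f) (x : ℝ) :
    HasSum (fun k => qpCoeff α f k * char α k x) (f x : ℂ) := hf.2 x

lemma MemHqp.coeff_ofCoeff {f : ℝ → ℝ} (hf : MemHqp α s f) :
    coeff s (ofCoeff s (qpCoeff α f)) = qpCoeff α f := QPBO.coeff_ofCoeff hf.1

lemma MemHqp.summable (hs : (N : ℝ) / 2 + 1 < s) {f : ℝ → ℝ} (hf : MemHqp α s f) :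
    Summable fun k => bracket k * ‖qpCoeff α f k‖ := by
  have h := (embedding hs (ofCoeff s (qpCoeff α f))).1
  rwa [hf.coeff_ofCoeff] at h

lemma MemHqp.ext {f g : ℝ → ℝ} (hf : MemHqp α s f) (hg : MemHqp α s g)
    (h : qpCoeff α f = qpCoeff α g) : f = g := by
  funext x
  have h1 := hf.hasSum x
  rw [h] at h1
  exact Complex.ofReal_injective (h1.unique (hg.hasSum x))

lemma MemHqp.qpCoeff_sub (hα : RationallyIndependent α) (hs : (N : ℝ) / 2 + 1 < s) {f g : ℝ → ℝ}
    (hf : MemHqp α s f) (hg : MemHqp α s g) :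
    qpCoeff α (fun x => f x - g x) = qpCoeff α f - qpCoeff α g := by
  have h1 := summable_norm_of_bracket (hf.summable hs)
  have h2 := summable_norm_of_bracket (hg.summable hs)
  refine qpCoeff_eq_of_hasSum hα
    (Summable.of_nonneg_of_le (fun _ => norm_nonneg _) (fun k => norm_sub_le _ _) (h1.add h2))
    fun x => ?_
  refine hasSum_of_eq ((hf.hasSum x).sub (hg.hasSum x)) (fun k => ?_) (by push_cast; rfl)
  simp only [Pi.sub_apply]
  ring

lemma MemHqp.qpCoeff_neg (hα : RationallyIndependent α) (hs : (N : ℝ) / 2 + 1 < s) {f : ℝ → ℝ}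
    (hf : MemHqp α s f) (k : Fin N → ℤ) : qpCoeff α f (-k) = conj (qpCoeff α f k) := by
  have h1 := summable_norm_of_bracket (hf.summable hs)
  have h2 : qpCoeff α f = fun k => conj (qpCoeff α f (-k)) := by
    refine qpCoeff_eq_of_hasSum hα ?_ fun x => ?_
    · refine ((Equiv.neg (Fin N → ℤ)).summable_iff.2 h1).congr fun k => ?_
      simp
    · have h3 : HasSum (fun k => conj (qpCoeff α f k * char α k x)) (conj (f x : ℂ)) :=
        (hf.hasSum x).map (starRingEnd ℂ) Complex.continuous_conj
      exact hasSum_of_eq ((Equiv.neg (Fin N → ℤ)).hasSum_iff.2 h3)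
        (fun k => by simp [conj_char]) (by simp [Complex.conj_ofReal])
  have h4 := congrFun h2 (-k)
  simpa using h4

/-- Since s > N/2 + 1, the differentiated series converges absolutely and uniformly, so the
classical derivative is the sum of the termwise one. -/
lemma MemHqp.hasSum_deriv (hs : (N : ℝ) / 2 + 1 < s) {f : ℝ → ℝ} (hf : MemHqp α s f) (x : ℝ) :
    HasSum (fun k => derivCoeff α (qpCoeff α f) k * char α k x) ((deriv f x : ℝ) : ℂ) := by
  have hu := summable_norm_derivCoeff (α := α) (hf.summable hs)
  have hn : ∀ k y, ‖derivCoeff α (qpCoeff α f) k * char α k y‖ ≤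
      ‖derivCoeff α (qpCoeff α f) k‖ := fun k y => by rw [norm_mul, norm_char, mul_one]
  have h1 : HasDerivAt (fun y => ∑' k, qpCoeff α f k * char α k y)
      (∑' k, derivCoeff α (qpCoeff α f) k * char α k x) x := by
    refine hasDerivAt_tsum hu (fun k y => ?_) hn (hf.hasSum 0).summable x
    have h2 : HasDerivAt (fun y : ℝ => Complex.I * (freq α k : ℂ) * (y : ℂ))
        (Complex.I * (freq α k : ℂ)) y := by
      simpa using (Complex.ofRealCLM.hasDerivAt (x := y)).const_mul (Complex.I * (freq α k : ℂ))
    have h3 := h2.cexp.const_mul (qpCoeff α f k)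
    refine h3.congr_deriv ?_
    unfold derivCoeff char
    ring
  have h4 : (fun y => ∑' k, qpCoeff α f k * char α k y) = fun y => (f y : ℂ) :=
    funext fun y => (hf.hasSum y).tsum_eq
  rw [h4] at h1
  have h5 : HasDerivAt f (∑' k, derivCoeff α (qpCoeff α f) k * char α k x).re x := by
    have := Complex.reCLM.hasFDerivAt.comp_hasDerivAt x h1
    exact this
  have h6 := h5.ofReal_comp.unique h1
  rw [h5.deriv, h6]
  exact (Summable.of_norm_bounded hu (fun k => hn k x)).hasSum

lemma summable_norm_conv {c d : (Fin N → ℤ) → ℂ} (hc : Summable fun k => ‖c k‖)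
    (hd : Summable fun k => ‖d k‖) : Summable fun k => ‖conv c d k‖ := by
  have h : Summable fun p : (Fin N → ℤ) × (Fin N → ℤ) => ‖c (p.1 - p.2)‖ * ‖d p.2‖ :=
    (hasSum_sub_mul_right hc hd (fun _ => norm_nonneg _) fun _ => norm_nonneg _).summable
  have h1 : ∀ k, ‖conv c d k‖ ≤ ∑' j, ‖c (k - j)‖ * ‖d j‖ := fun k =>
    tsum_of_norm_bounded (h.prod_factor k).hasSum fun j => (norm_mul _ _).le
  exact Summable.of_nonneg_of_le (fun _ => norm_nonneg _) h1 h.prod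

lemma hasSum_conv_mul_char {c d : (Fin N → ℤ) → ℂ} (hc : Summable fun k => ‖c k‖)
    (hd : Summable fun k => ‖d k‖) {x : ℝ} {a b : ℂ} (ha : HasSum (fun k => c k * char α k x) a)
    (hb : HasSum (fun k => d k * char α k x) b) :
    HasSum (fun k => conv c d k * char α k x) (a * b) := by
  have h1 : Summable fun p : (Fin N → ℤ) × (Fin N → ℤ) =>
      c p.1 * char α p.1 x * (d p.2 * char α p.2 x) := by
    have hcd := hc.mul_of_nonneg hd (fun _ => norm_nonneg _) fun _ => norm_nonneg _
    refine Summable.of_norm (hcd.congr fun p => ?_)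
    rw [norm_mul, norm_mul, norm_mul, norm_char, norm_char, mul_one, mul_one]
  have h2 : HasSum (fun p : (Fin N → ℤ) × (Fin N → ℤ) =>
      c (p.1 - p.2) * char α (p.1 - p.2) x * (d p.2 * char α p.2 x)) (a * b) :=
    (subShear (Fin N → ℤ)).hasSum_iff.2 (ha.mul hb h1)
  have h3 : ∀ k, HasSum (fun j => c (k - j) * char α (k - j) x * (d j * char α j x))
      (conv c d k * char α k x) := fun k => by
    have h4 : HasSum (fun j => c (k - j) * d j) (conv c d k) :=
      (summable_conv_complex hc (summable_sq_of_nonneg hd fun _ => norm_nonneg _) k).hasSum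
    have h5 : ∀ j, c (k - j) * char α (k - j) x * (d j * char α j x) =
        c (k - j) * d j * char α k x := fun j => by
      have h6 : char α k x = char α (k - j) x * char α j x := by rw [← char_add, sub_add_cancel]
      rw [h6]
      ring
    exact hasSum_of_eq (h4.mul_right (char α k x)) h5 rfl
  exact HasSum.prod_fiberwise h2 h3

/-- The pointwise product f fₓ has an absolutely convergent series whose coefficients are the
convolution, and -i sgn(ω)(iω)² = i ω|ω|. -/
lemma MemHqp.boRHS_eq (hα : RationallyIndependent α) (hs : (N : ℝ) / 2 + 1 < s) {f : ℝ → ℝ}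
    (hf : MemHqp α s f) (k : Fin N → ℤ) :
    boRHS α f k = nonlin α s (ofCoeff s (qpCoeff α f)) k +
      Complex.I * disp α k * coeff s (ofCoeff s (qpCoeff α f)) k := by
  have hc := summable_norm_of_bracket (hf.summable hs)
  have hd := summable_norm_derivCoeff (α := α) (hf.summable hs)
  have h1 : qpCoeff α (fun x => f x * deriv f x) =
      conv (qpCoeff α f) (derivCoeff α (qpCoeff α f)) :=
    qpCoeff_eq_of_hasSum hα (summable_norm_conv hc hd) fun x => by
      rw [Complex.ofReal_mul]
      exact hasSum_conv_mul_char hc hd (hf.hasSum x) (hf.hasSum_deriv hs x)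
  rw [boRHS, nonlin, hf.coeff_ofCoeff, h1]
  congr 1
  have h2 : ((disp α k : ℝ) : ℂ) = Real.sign (freq α k) * freq α k ^ 2 := by
    rw [disp]
    norm_cast
    rcases lt_trichotomy (freq α k) 0 with h | h | h
    · rw [abs_of_neg h, Real.sign_of_neg h]; ring
    · simp [h]
    · rw [abs_of_pos h, Real.sign_of_pos h]; ring
  rw [h2, hilbertCoeff, derivCoeff, derivCoeff]
  linear_combination -Complex.I * Real.sign (freq α k) * freq α k ^ 2 * qpCoeff α f k * Complex.I_sq

/-- The function with the Fourier coefficients represented by `x`. -/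
noncomputable def synth (α : Fin N → ℝ) (s : ℝ) (x : Hl N) (y : ℝ) : ℝ :=
  (∑' k, coeff s x k * char α k y).re

lemma hasSum_synth (hs : (N : ℝ) / 2 + 1 < s) {x : Hl N} (hx : ∀ k, x (-k) = conj (x k)) (y : ℝ) :
    HasSum (fun k => coeff s x k * char α k y) (synth α s x y : ℂ) := by
  have h1 := summable_norm_of_bracket (embedding hs x).1
  have h2 : Summable fun k => coeff s x k * char α k y :=
    Summable.of_norm (by simpa [norm_char] using h1)
  -- Reindexing by k ↦ -k shows the sum to be real, so taking the real part in `synth` loses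
  -- nothing.
  have h3 : conj (∑' k, coeff s x k * char α k y) = ∑' k, coeff s x k * char α k y := by
    rw [Complex.conj_tsum, ← (Equiv.neg (Fin N → ℤ)).tsum_eq]
    refine tsum_congr fun k => ?_
    rw [map_mul, conj_char, Equiv.neg_apply, neg_neg, coeff_neg_eq_conj hx, Complex.conj_conj]
  have h4 : ((synth α s x y : ℝ) : ℂ) = ∑' k, coeff s x k * char α k y := Complex.conj_eq_iff_re.1 h3
  rw [h4]
  exact h2.hasSum

lemma qpCoeff_synth (hα : RationallyIndependent α) (hs : (N : ℝ) / 2 + 1 < s) {x : Hl N}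
    (hx : ∀ k, x (-k) = conj (x k)) : qpCoeff α (synth α s x) = coeff s x :=
  qpCoeff_eq_of_hasSum hα (summable_norm_of_bracket (embedding hs x).1) (hasSum_synth hs hx)

lemma memHqp_synth (hα : RationallyIndependent α) (hs : (N : ℝ) / 2 + 1 < s) {x : Hl N}
    (hx : ∀ k, x (-k) = conj (x k)) : MemHqp α s (synth α s x) := by
  rw [MemHqp, qpCoeff_synth hα hs hx]
  exact ⟨sobolevSummable_coeff x, hasSum_synth hs hx⟩

lemma ofCoeff_neg (hα : RationallyIndependent α) (hs : (N : ℝ) / 2 + 1 < s) {f : ℝ → ℝ}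
    (hf : MemHqp α s f) (k : Fin N → ℤ) :
    ofCoeff s (qpCoeff α f) (-k) = conj (ofCoeff s (qpCoeff α f) k) := by
  rw [ofCoeff_apply hf.1, ofCoeff_apply hf.1, bracket_neg, hf.qpCoeff_neg hα hs, map_mul,
    Complex.conj_ofReal]

lemma hqpNorm_sub (hα : RationallyIndependent α) (hs : (N : ℝ) / 2 + 1 < s) {f g : ℝ → ℝ}
    (hf : MemHqp α s f) (hg : MemHqp α s g) :
    hqpNorm α s (fun x => f x - g x) = ‖ofCoeff s (qpCoeff α f) - ofCoeff s (qpCoeff α g)‖ := by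
  rw [hqpNorm, hf.qpCoeff_sub hα hs hg]
  refine sobolevNorm_eq_of_apply fun k => ?_
  rw [Hl.sub_apply, ofCoeff_apply hf.1, ofCoeff_apply hg.1, Pi.sub_apply]
  ring

lemma field_ofCoeff (hα : RationallyIndependent α) (hs : (N : ℝ) / 2 + 1 < s) {f : ℝ → ℝ}
    (hf : MemHqp α s f) (k : Fin N → ℤ) :
    field α hs Set.univ (ofCoeff s (qpCoeff α f)) k = (bracket k ^ (s - 2) : ℝ) * boRHS α f k := by
  rw [field_apply, hf.boRHS_eq hα hs, Set.indicator_univ]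

/-- Solutions in the sense of functions correspond to solutions in the sense of families. -/
lemma isSolution_iff (hα : RationallyIndependent α) (hs : (N : ℝ) / 2 + 1 < s) {T : ℝ}
    {u₀ : ℝ → ℝ} {u : ℝ → ℝ → ℝ} (hu : ∀ t ∈ Set.Icc 0 T, MemHqp α s (u t)) :
    IsSolution α s T u₀ u ↔
      u 0 = u₀ ∧ Sol α hs Set.univ T fun t => ofCoeff s (qpCoeff α (u t)) := by
  have hcont : ∀ t ∈ Set.Icc 0 T,
      (Tendsto (fun τ => hqpNorm α s (fun x => u τ x - u t x)) (𝓝[Set.Icc 0 T] t) (𝓝 0) ↔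
        ContinuousWithinAt (fun t => ofCoeff s (qpCoeff α (u t))) (Set.Icc 0 T) t) := fun t ht => by
    refine Iff.trans (tendsto_congr' ?_) tendsto_iff_norm_sub_tendsto_zero.symm
    filter_upwards [self_mem_nhdsWithin] with τ hτ
    rw [hqpNorm_sub hα hs (hu τ hτ) (hu t ht)]
  have hderiv : ∀ t ∈ Set.Icc 0 T, (Tendsto (fun τ => sobolevNorm (s - 2) fun k =>
      (qpCoeff α (u τ) k - qpCoeff α (u t) k) / ((τ - t : ℝ) : ℂ) - boRHS α (u t) k)
      (𝓝[Set.Icc 0 T \ {t}] t) (𝓝 0) ↔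
      HasDerivWithinAt (fun τ => smoothing N (-2) (by norm_num) (ofCoeff s (qpCoeff α (u τ))))
        (field α hs Set.univ (ofCoeff s (qpCoeff α (u t)))) (Set.Icc 0 T) t) := fun t ht => by
    rw [hasDerivWithinAt_iff_tendsto_slope]
    refine Iff.trans (tendsto_congr' ?_) tendsto_iff_norm_sub_tendsto_zero.symm
    filter_upwards [self_mem_nhdsWithin] with τ hτ
    refine sobolevNorm_eq_of_apply fun k => ?_
    -- The H^(s-2) norm of the difference quotient is the `Hl` norm after smoothing by ⟨k⟩^(-2), so
    -- the two notions of derivative agree.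
    have e : ((bracket k ^ (s - 2) : ℝ) : ℂ) =
        (bracket k ^ (-2 : ℝ) : ℝ) * (bracket k ^ s : ℝ) := by
      rw [← Complex.ofReal_mul, ← Real.rpow_add (bracket_pos k)]
      congr 2; ring
    rw [Hl.sub_apply, field_ofCoeff hα hs (hu t ht), slope_def_module, Hl.real_smul_apply,
      Hl.sub_apply, smoothing_apply, smoothing_apply, ofCoeff_apply (hu τ hτ.1).1,
      ofCoeff_apply (hu t ht).1, e]
    push_cast
    ring
  constructor
  · intro h
    exact ⟨h.init, fun t ht => (hcont t ht).1 (h.cont t ht), fun t ht => (hderiv t ht).1 (h.eqn t ht),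
      fun t _ k hk => absurd (Set.mem_univ k) hk, fun t ht => ofCoeff_neg hα hs (hu t ht)⟩
  · rintro ⟨h0, h⟩
    exact ⟨hu, fun t ht => (hcont t ht).2 (h.cont t ht), h0,
      fun t ht => sobolevSummable_of_apply (field_ofCoeff hα hs (hu t ht)),
      fun t ht => (hderiv t ht).2 (h.deriv t ht)⟩

lemma ofCoeff_coeff (x : Hl N) : ofCoeff s (coeff s x) = x := by
  ext k
  rw [ofCoeff_apply (sobolevSummable_coeff x), ← apply_eq_rpow_mul_coeff]

lemma isSolution_synth (hα : RationallyIndependent α) (hs : (N : ℝ) / 2 + 1 < s) {T : ℝ}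
    (hT : 0 ≤ T) {u₀ : ℝ → ℝ} (hu₀ : MemHqp α s u₀) {x : ℝ → Hl N}
    (hx : Sol α hs Set.univ T x) (h0 : x 0 = ofCoeff s (qpCoeff α u₀)) :
    IsSolution α s T u₀ fun t => synth α s (x t) := by
  have hmem : ∀ t ∈ Set.Icc 0 T, MemHqp α s (synth α s (x t)) :=
    fun t ht => memHqp_synth hα hs (hx.real t ht)
  have he : ∀ t ∈ Set.Icc 0 T, ofCoeff s (qpCoeff α (synth α s (x t))) = x t := fun t ht => by
    rw [qpCoeff_synth hα hs (hx.real t ht), ofCoeff_coeff]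
  have h0T : (0 : ℝ) ∈ Set.Icc 0 T := ⟨le_rfl, hT⟩
  -- The initial condition is an equality of functions; it holds because an element of H^s_qp is at
  -- every point the sum of its series.
  refine (isSolution_iff hα hs hmem).2 ⟨(hmem 0 h0T).ext hu₀ ?_, ?_, fun t ht => ?_,
    fun t _ k hk => absurd (Set.mem_univ k) hk, fun t ht => ?_⟩
  · rw [qpCoeff_synth hα hs (hx.real 0 h0T), h0, hu₀.coeff_ofCoeff]
  · exact hx.cont.congr he
  · rw [he t ht]
    exact (hx.deriv t ht).congr_of_mem (fun τ hτ => by rw [he τ hτ]) ht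
  · rw [he t ht]
    exact hx.real t ht

end QPBO

/-! ### Well-posedness for functions, transferred from coefficient families -/

theorem mainTheorem1 (N : ℕ) (hN : 1 ≤ N) (α : Fin N → ℝ) (hα : QPBO.RationallyIndependent α)
    (s : ℝ) (hs : (N : ℝ) / 2 + 1 < s) :
    -- existence and uniqueness, on a time interval that depends only on the norm of the data
    (∃ T : ℝ → ℝ, (∀ r, 0 < T r) ∧ Antitone T ∧
      ∀ u₀ : ℝ → ℝ, QPBO.MemHqp α s u₀ →
        ∃ u : ℝ → ℝ → ℝ, QPBO.IsSolution α s (T (QPBO.hqpNorm α s u₀)) u₀ u ∧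
          ∀ v : ℝ → ℝ → ℝ, QPBO.IsSolution α s (T (QPBO.hqpNorm α s u₀)) u₀ v →
            ∀ t ∈ Set.Icc 0 (T (QPBO.hqpNorm α s u₀)), v t = u t) ∧
    -- continuity of the solution map, uniformly on any common time interval of existence
    (∀ T : ℝ, 0 < T → ∀ (u₀ : ℝ → ℝ) (u : ℝ → ℝ → ℝ),
      QPBO.MemHqp α s u₀ → QPBO.IsSolution α s T u₀ u →
      ∀ ε : ℝ, 0 < ε → ∃ δ : ℝ, 0 < δ ∧
        ∀ (v₀ : ℝ → ℝ) (v : ℝ → ℝ → ℝ), QPBO.MemHqp α s v₀ → QPBO.IsSolution α s T v₀ v →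
          QPBO.hqpNorm α s (fun x => v₀ x - u₀ x) < δ →
          ∀ t ∈ Set.Icc 0 T, QPBO.hqpNorm α s (fun x => v t x - u t x) < ε) := by
  refine ⟨⟨QPBO.lifespan α s, QPBO.lifespan_pos, QPBO.lifespan_antitone, fun u₀ hu₀ => ?_⟩,
    fun T hT u₀ u hu₀ hu ε hε => ?_⟩
  · have hn : QPBO.hqpNorm α s u₀ = ‖QPBO.ofCoeff s (QPBO.qpCoeff α u₀)‖ :=
      QPBO.sobolevNorm_eq_of_apply (QPBO.ofCoeff_apply hu₀.1)
    obtain ⟨x, h0, hx⟩ := QPBO.exists_sol (α := α) hs hn.ge (QPBO.ofCoeff_neg hα hs hu₀)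
    have hT := QPBO.lifespan_pos (α := α) (s := s) (QPBO.hqpNorm α s u₀)
    have hu := QPBO.isSolution_synth hα hs hT.le hu₀ hx h0
    refine ⟨_, hu, fun v hv t ht => ?_⟩
    obtain ⟨hv0, hvs⟩ := (QPBO.isSolution_iff hα hs hv.mem).1 hv
    obtain ⟨hu0, hus⟩ := (QPBO.isSolution_iff hα hs hu.mem).1 hu
    have h := hvs.unique hus (by simp only [hv0, hu0]) ht
    refine (hv.mem t ht).ext (hu.mem t ht) ?_
    rw [← (hv.mem t ht).coeff_ofCoeff, h, (hu.mem t ht).coeff_ofCoeff]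
  · obtain ⟨hu0, hus⟩ := (QPBO.isSolution_iff hα hs hu.mem).1 hu
    obtain ⟨δ, hδ, h⟩ := hus.continuous_dependence hT.le hε
    refine ⟨δ, hδ, fun v₀ v hv₀ hv hd t ht => ?_⟩
    obtain ⟨hv0, hvs⟩ := (QPBO.isSolution_iff hα hs hv.mem).1 hv
    rw [QPBO.hqpNorm_sub hα hs (hv.mem t ht) (hu.mem t ht)]
    refine h _ hvs ?_ t ht
    rwa [hv0, hu0, ← QPBO.hqpNorm_sub hα hs hv₀ hu₀]
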